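/- **Setting.** Let $I$ be a finite set and $A=(a_{ij})_{i,j\in I}$ a symmetric generalized Cartan matrix. Let $P$ be a weight lattice with linearly independent simple roots $\alpha_i\in P$, simple coroots $h_i\in P^*$ and fundamental weights $\Lambda_i\in P$, so that $\langle h_i,\alpha_j\rangle=a_{ij}$ and $\langle h_i,\Lambda_j\rangle=\delta_{ij}$. Let $H$ be the set of arrows of the quiver with vertex set $I$ having $|a_{ij}|$ arrows from $i$ to $j$ for $i\neq j$ and no loops, with a fixed-point-free involution $\tau\mapsto\bar\tau$ reversing arrows, and let $\varepsilon:H\to\mathbb C^*$ satisfy $\varepsilon(\tau)+\varepsilon(\bar\tau)=0$. Write $\mathrm{out}(\tau)$, $\mathrm{in}(\tau)$ for the source and the target of $\tau$. Fix a finite-dimensional $I$-graded complex vector space $W$ and put $\lambda=\sum_i(\dim W_i)\Lambda_i$. For an $I$-graded space $V$ of dimension vector $(v_i)\in\mathbb Z_{\ge0}^I$ put $\nu=-\sum_i v_i\alpha_i$; the symbol $\nu$ also stands for the dimension vector $(v_i)$ itself, and "$\nu\pm c\alpha_i$" for the dimension vector with $v_i\mp c$ instead of $v_i$. Let $X(W;\nu)$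 be the space of all $(B,t,s)$ with $B_\tau:V_{\mathrm{out}(\tau)}\to V_{\mathrm{in}(\tau)}$ $(\tau\in H)$, $t_i:V_i\to W_i$, $s_i:W_i\to V_i$, with the action of $G(\nu)=\prod_iGL(V_i)$ and $\mu_i(B,t,s)=\sum_{\mathrm{out}(\tau)=i}\varepsilon(\tau)B_{\bar\tau}B_\tau+s_it_i$. A point is stable if no non-zero family of $B$-invariant subspaces $V_i'\subset V_i$ has $V'_i\subset\operatorname{Ker}t_i$ for all $i$. Let $\mathfrak X(W;\nu)$ be the quotient by $G(\nu)$ of the set of stable points of $\mu^{-1}(0)$, with the Zariski topology; let $\varepsilon_i([B,t,s])=\dim\operatorname{Coker}\big(\bigoplus_{\mathrm{in}(\tau)=i}V_{\mathrm{out}(\tau)}\oplus W_i\xrightarrow{(B_\tau,s_i)}V_i\big)$, and let $\mathfrak X(W;\nu)_{i,c}$ be the locus $\varepsilon_i=c$. Let $\Lambda(W;\nu)\subset\mathfrak X(W;\nu)$ be the Lagrangian subvariety of all $[B,t,s]$ with $s=0$ and $B$ nilpotent (for some $n\ge2$ all compositions of $B$ along paths of length $n$ vanish), and $B(W;\nu)$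 the set of its irreducible components. For $\bar\nu=\nu+c\alpha_i$ let $\mathfrak X(W;\bar\nu)\xleftarrow{\varpi_1}\mathfrak X(W;\bar\nu,\nu)\xrightarrow{\varpi_2}\mathfrak X(W;\nu)$ be the variety of pairs $([B,t,s],\operatorname{Im}\phi)$, where $[B,t,s]\in\mathfrak X(W;\nu)$ and $\phi:\bar V\to V$ is a graded injection whose image is $B$-stable and contains $\operatorname{Im}s$; $\varpi_1$ gives the induced data on $\bar V$, and $\varpi_2$ gives $[B,t,s]$. **Theorem.** 1. For every $i$ and every $\Lambda\in B(W;\nu)$, the function $\varepsilon_i$ is constant on a non-empty open subset of $\Lambda$, with a unique such generic value, denoted $\varepsilon_i(\Lambda)$. Let $B(W;\nu)_{i,c}=\{\Lambda\in B(W;\nu):\varepsilon_i(\Lambda)=c\}$. 2. If $\mathfrak X(W;\nu)_{i,c}\neq\emptyset$ and $\bar\nu=\nu+c\alpha_i$, then there is a bijection $\tilde f_i^{\,c}:B(W;\bar\nu)_{i,0}\to B(W;\nu)_{i,c}$, with inverse $\tilde e_i^{\,c}$, such that $\tilde f_i^{\,c}(\bar\Lambda)=\Lambda$ if and only if, within $\Lambda(W;\nu)$,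 $\varpi_2\varpi_1^{-1}(\bar\Lambda\cap\mathfrak X(W;\bar\nu)_{i,0})=\Lambda\cap\mathfrak X(W;\nu)_{i,c}$. 3. The set $\bigsqcup_\nu B(W;\nu)$ is a crystal with the following (uniquely determined) structure. For $\Lambda\in B(W;\nu)_{i,c}$: $wt(\Lambda)=\lambda+\nu$; $\varepsilon_i(\Lambda)=c$; $\varphi_i(\Lambda)=\varepsilon_i(\Lambda)+\langle h_i,wt(\Lambda)\rangle$; $\tilde e_i(\Lambda)=\tilde f_i^{\,c-1}\tilde e_i^{\,c}(\Lambda)\in B(W;\nu+\alpha_i)_{i,c-1}$ if $c>0$ and $\tilde e_i(\Lambda)=0$ if $c=0$; $\tilde f_i(\Lambda)=\tilde f_i^{\,c+1}\tilde e_i^{\,c}(\Lambda)\in B(W;\nu-\alpha_i)_{i,c+1}$ if $\varphi_i(\Lambda)>0$ and $\tilde f_i(\Lambda)=0$ if $\varphi_i(\Lambda)\le0$. Here a crystal is a set $B$ with maps $wt:B\to P$, $\varepsilon_i,\varphi_i:B\to\mathbb Z\sqcup\{-\infty\}$, $\tilde e_i,\tilde f_i:B\to B\sqcup\{0\}$ $(i\in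 I)$ such that: $\varphi_i(b)=\varepsilon_i(b)+\langle h_i,wt(b)\rangle$; if $\tilde e_ib\in B$, then $wt(\tilde e_ib)=wt(b)+\alpha_i$, $\varepsilon_i(\tilde e_ib)=\varepsilon_i(b)-1$, $\varphi_i(\tilde e_ib)=\varphi_i(b)+1$; if $\tilde f_ib\in B$, then $wt(\tilde f_ib)=wt(b)-\alpha_i$, $\varepsilon_i(\tilde f_ib)=\varepsilon_i(b)+1$, $\varphi_i(\tilde f_ib)=\varphi_i(b)-1$; $b'=\tilde e_ib$ if and only if $b=\tilde f_ib'$ $(b,b'\in B)$; and $\tilde e_ib=\tilde f_ib=0$ if $\varphi_i(b)=-\infty$. -/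

import Mathlib

noncomputable section

namespace QuiverCrystal

open Set

/-! ## Cartan data, weights and crystals -/

/-- A symmetric generalized Cartan matrix. -/
structure IsSymmetricGCM {I : Type*} (A : Matrix I I ℤ) : Prop where
  diag : ∀ i, A i i = 2
  symm : ∀ i j, A i j = A j i
  nonpos : ∀ i j, i ≠ j → A i j ≤ 0

/-- Weight data for a Cartan matrix `A`: simple roots `α i` (linearly independent) and fundamental
weights `Λ i` in the weight lattice `P`, and simple coroots `h i` in the dual lattice. -/
structure WeightData {I : Type*} [DecidableEq I] (A : Matrix I I ℤ)
    (P : Type*) [AddCommGroup P] where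
  α : I → P
  h : I → Module.Dual ℤ P
  Λ : I → P
  linearIndependent_α : LinearIndependent ℤ α
  h_α : ∀ i j, h i (α j) = A i j
  h_Λ : ∀ i j, h i (Λ j) = if i = j then 1 else 0

/-- A crystal structure on the set `B`. The values `-∞` and `0` (outside `B`) are
`⊥ : WithBot ℤ` and `none : Option B`. -/
@[ext]
structure Crystal {I : Type*} [DecidableEq I] {A : Matrix I I ℤ} {P : Type*} [AddCommGroup P]
    (R : WeightData A P) (B : Type*) where
  wt : B → P
  ε : I → B → WithBot ℤ
  φ : I → B → WithBot ℤ
  e : I → B → Option B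
  f : I → B → Option B
  φ_eq : ∀ i b, φ i b = ε i b + ((R.h i (wt b) : ℤ) : WithBot ℤ)
  wt_e : ∀ i b b', e i b = some b' → wt b' = wt b + R.α i
  ε_e : ∀ i b b', e i b = some b' → ε i b' = ε i b + ((-1 : ℤ) : WithBot ℤ)
  φ_e : ∀ i b b', e i b = some b' → φ i b' = φ i b + ((1 : ℤ) : WithBot ℤ)
  wt_f : ∀ i b b', f i b = some b' → wt b' = wt b - R.α i
  ε_f : ∀ i b b', f i b = some b' → ε i b' = ε i b + ((1 : ℤ) : WithBot ℤ)
  φ_f : ∀ i b b', f i b = some b' → φ i b' = φ i b + ((-1 : ℤ) : WithBot ℤ)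
  e_iff_f : ∀ i b b', e i b = some b' ↔ f i b' = some b
  e_eq_none : ∀ i b, φ i b = ⊥ → e i b = none
  f_eq_none : ∀ i b, φ i b = ⊥ → f i b = none

/-! ## The Zariski topology of a vector space -/

/-- The algebra of polynomial functions on a complex vector space. -/
def polynomialFunctions (E : Type*) [AddCommGroup E] [Module ℂ E] : Subalgebra ℂ (E → ℂ) :=
  Algebra.adjoin ℂ (Set.range fun l : Module.Dual ℂ E => (l : E → ℂ))

/-- The Zariski topology: the principal open sets `{f ≠ 0}` of polynomial functions form a
basis. -/
@[reducible]
def zariskiTopology (E : Type*) [AddCommGroup E] [Module ℂ E] : TopologicalSpace E :=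
  TopologicalSpace.generateFrom {U | ∃ f ∈ polynomialFunctions E, U = {x | f x ≠ 0}}

/-! ## Quivers and their representations -/

/-- The quiver with vertex set `I` and arrow reversal `Quiver.reverse` is attached to `A`: there are
`|A i j|` arrows from `i` to `j` for `i ≠ j`, and no edge loops. (As there are no loops, the
involution `Quiver.reverse` on the set of all arrows is automatically free.) -/
def IsQuiverOf {I : Type*} [DecidableEq I] [Quiver I] [∀ i j : I, Fintype (i ⟶ j)]
    (A : Matrix I I ℤ) : Prop :=
  ∀ i j : I, Fintype.card (i ⟶ j) = if i = j then 0 else (A i j).natAbs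

/-- The standard graded vector space of dimension vector `v`. -/
abbrev VSp {I : Type*} (v : I → ℕ) (i : I) : Type := Fin (v i) → ℂ

section Rep

variable {I : Type*} [Quiver I]
  (W : I → Type*) [∀ i, AddCommGroup (W i)] [∀ i, Module ℂ (W i)]

/-- The space of all `(B, t, s)`: linear maps `B τ : V_{out τ} → V_{in τ}` for all arrows `τ`,
`t i : V i → W i` and `s i : W i → V i`. -/
def RepSpace (v : I → ℕ) : Type _ :=
  ((i j : I) → (i ⟶ j) → (VSp v i →ₗ[ℂ] VSp v j)) ×
    ((i : I) → (VSp v i →ₗ[ℂ] W i)) × ((i : I) → (W i →ₗ[ℂ] VSp v i))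

instance (v : I → ℕ) : AddCommGroup (RepSpace W v) :=
  inferInstanceAs (AddCommGroup (((i j : I) → (i ⟶ j) → (VSp v i →ₗ[ℂ] VSp v j)) ×
    ((i : I) → (VSp v i →ₗ[ℂ] W i)) × ((i : I) → (W i →ₗ[ℂ] VSp v i))))

instance (v : I → ℕ) : Module ℂ (RepSpace W v) :=
  inferInstanceAs (Module ℂ (((i j : I) → (i ⟶ j) → (VSp v i →ₗ[ℂ] VSp v j)) ×
    ((i : I) → (VSp v i →ₗ[ℂ] W i)) × ((i : I) → (W i →ₗ[ℂ] VSp v i))))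

instance (v : I → ℕ) : TopologicalSpace (RepSpace W v) := zariskiTopology (RepSpace W v)

/-- The group `∏ i, GL (V i)`. -/
abbrev GaugeGroup (v : I → ℕ) : Type _ := (i : I) → (VSp v i ≃ₗ[ℂ] VSp v i)

variable {W} {v : I → ℕ}

/-- The component of `x = (B, t, s)` at the arrow `τ`. -/
def RepSpace.B (x : RepSpace W v) {i j : I} (τ : i ⟶ j) : VSp v i →ₗ[ℂ] VSp v j := x.1 i j τ

/-- The component `t i` of `x = (B, t, s)`. -/
def RepSpace.t (x : RepSpace W v) (i : I) : VSp v i →ₗ[ℂ] W i := x.2.1 i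

/-- The component `s i` of `x = (B, t, s)`. -/
def RepSpace.s (x : RepSpace W v) (i : I) : W i →ₗ[ℂ] VSp v i := x.2.2 i

instance : MulAction (GaugeGroup v) (RepSpace W v) where
  smul g x := (fun i j τ => (g j).toLinearMap ∘ₗ x.1 i j τ ∘ₗ (g i).symm.toLinearMap,
    fun i => x.2.1 i ∘ₗ (g i).symm.toLinearMap, fun i => (g i).toLinearMap ∘ₗ x.2.2 i)
  one_smul _ := rfl
  mul_smul _ _ _ := rfl

/-- Stable points: the only family of `B`-invariant subspaces contained in the kernels of the `t i`
is zero. -/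
def RepSpace.IsStable (x : RepSpace W v) : Prop :=
  ∀ V' : (i : I) → Submodule ℂ (VSp v i),
    (∀ (i j : I) (τ : i ⟶ j), (V' i).map (x.B τ) ≤ V' j) →
    (∀ i, V' i ≤ LinearMap.ker (x.t i)) → ∀ i, V' i = ⊥

/-- The composition of `B` along a path. -/
def RepSpace.pathComp (x : RepSpace W v) {i : I} :
    {j : I} → Quiver.Path i j → (VSp v i →ₗ[ℂ] VSp v j)
  | _, .nil => LinearMap.id
  | _, .cons p τ => x.B τ ∘ₗ x.pathComp p

/-- `B` is nilpotent: for some `n ≥ 2`, all compositions along paths of length `n` vanish. -/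
def RepSpace.IsNilpotent (x : RepSpace W v) : Prop :=
  ∃ n : ℕ, 2 ≤ n ∧ ∀ (i j : I) (p : Quiver.Path i j), p.length = n → x.pathComp p = 0

variable [Fintype I] [∀ i j : I, Fintype (i ⟶ j)]

/-- The `i`-th component of the moment map:
`μ_i = ∑_{out τ = i} ε(τ) B_{τ̄} B_τ + s_i t_i`. -/
def RepSpace.moment [Quiver.HasInvolutiveReverse I] (sgn : (i j : I) → (i ⟶ j) → ℂˣ)
    (x : RepSpace W v) (i : I) : VSp v i →ₗ[ℂ] VSp v i :=
  (∑ j : I, ∑ τ : i ⟶ j, (sgn i j τ : ℂ) • (x.B (Quiver.reverse τ) ∘ₗ x.B τ)) + x.s i ∘ₗ x.t i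

/-- The map `(B_τ, s_i) : (⨁_{in τ = i} V_{out τ}) ⊕ W_i → V_i`. -/
def RepSpace.inMap (x : RepSpace W v) (i : I) :
    (((p : Σ j : I, (j ⟶ i)) → VSp v p.1) × W i) →ₗ[ℂ] VSp v i :=
  (∑ p : Σ j : I, (j ⟶ i), x.B p.2 ∘ₗ LinearMap.proj p) ∘ₗ LinearMap.fst ℂ _ _
    + x.s i ∘ₗ LinearMap.snd ℂ _ _

/-- `ε_i (B, t, s)`, the dimension of the cokernel of `(B_τ, s_i)`. -/
def RepSpace.eps (i : I) (x : RepSpace W v) : ℕ :=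
  Module.finrank ℂ (VSp v i ⧸ LinearMap.range (x.inMap i))

theorem RepSpace.inMap_smul (g : GaugeGroup v) (x : RepSpace W v) (i : I)
    (u : (p : Σ j : I, (j ⟶ i)) → VSp v p.1) (w : W i) :
    (g • x).inMap i (u, w) = g i (x.inMap i (fun p => (g p.1).symm (u p), w)) := by
  simp only [RepSpace.inMap, LinearMap.add_apply, LinearMap.comp_apply, LinearMap.fst_apply,
    LinearMap.snd_apply, LinearMap.sum_apply, LinearMap.proj_apply, map_add, map_sum]
  rfl

theorem RepSpace.eps_smul (i : I) (g : GaugeGroup v) (x : RepSpace W v) :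
    (g • x).eps i = x.eps i := by
  have hr : (LinearMap.range (x.inMap i)).map (g i).toLinearMap
      = LinearMap.range ((g • x).inMap i) := by
    ext y
    simp only [Submodule.mem_map, LinearMap.mem_range, Prod.exists]
    constructor
    · rintro ⟨_, ⟨u, w, rfl⟩, rfl⟩
      refine ⟨fun p => g p.1 (u p), w, ?_⟩
      rw [RepSpace.inMap_smul]
      simp
    · rintro ⟨u, w, rfl⟩
      exact ⟨_, ⟨_, w, rfl⟩, (RepSpace.inMap_smul g x i u w).symm⟩
  exact (LinearEquiv.finrank_eq (Submodule.Quotient.equiv _ _ (g i) hr)).symm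

end Rep

/-! ## Quiver varieties and their Lagrangian subvarieties -/

section QuiverVariety

variable {I : Type*} [Fintype I] [Quiver I] [Quiver.HasInvolutiveReverse I]
  [∀ i j : I, Fintype (i ⟶ j)]
  (sgn : (i j : I) → (i ⟶ j) → ℂˣ)
  (W : I → Type*) [∀ i, AddCommGroup (W i)] [∀ i, Module ℂ (W i)]

/-- The stable points of `μ⁻¹(0)`, with the Zariski topology. -/
abbrev StableZero (v : I → ℕ) : Type _ :=
  {x : RepSpace W v // (∀ i, x.moment sgn i = 0) ∧ x.IsStable}

/-- Two stable points of `μ⁻¹(0)` are equivalent if they lie in the same gauge orbit. -/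
def orbitSetoid (v : I → ℕ) : Setoid (StableZero sgn W v) :=
  (MulAction.orbitRel (GaugeGroup v) (RepSpace W v)).comap Subtype.val

/-- The quiver variety: the set of orbits of the gauge group on the stable points of `μ⁻¹(0)`. It is
a geometric quotient, so its Zariski topology is the quotient topology. -/
def QuiverVariety (v : I → ℕ) : Type _ := Quotient (orbitSetoid sgn W v)

instance (v : I → ℕ) : TopologicalSpace (QuiverVariety sgn W v) :=
  inferInstanceAs (TopologicalSpace (Quotient (orbitSetoid sgn W v)))

variable {sgn W} {v : I → ℕ}

/-- The orbit `[B, t, s]`. -/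
def QuiverVariety.mk (x : StableZero sgn W v) : QuiverVariety sgn W v :=
  Quotient.mk (orbitSetoid sgn W v) x

/-- The function `ε_i` on the quiver variety. -/
def QuiverVariety.eps (i : I) (q : QuiverVariety sgn W v) : ℕ :=
  Quotient.lift (s := orbitSetoid sgn W v) (fun x => x.1.eps i)
    (by
      rintro a b ⟨g, hg⟩
      rw [← hg]
      exact RepSpace.eps_smul i g b.1) q

variable (sgn W v) in
/-- The Lagrangian subvariety of all `[B, t, s]` with `s = 0` and `B` nilpotent, with the subspace
topology. -/
def Lagrangian : Type _ :=
  {q : QuiverVariety sgn W v // ∃ x : StableZero sgn W v,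
    QuiverVariety.mk x = q ∧ (∀ i, x.1.s i = 0) ∧ x.1.IsNilpotent}

instance : TopologicalSpace (Lagrangian sgn W v) :=
  inferInstanceAs (TopologicalSpace {q : QuiverVariety sgn W v // ∃ x : StableZero sgn W v,
    QuiverVariety.mk x = q ∧ (∀ i, x.1.s i = 0) ∧ x.1.IsNilpotent})

variable (sgn W v) in
/-- The set of irreducible components of the Lagrangian subvariety. -/
abbrev Comp : Type _ := ↥(irreducibleComponents (Lagrangian sgn W v))

/-- `ε_i` takes the value `c` at a generic point of `Z`, i.e. on a non-empty relatively open subset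
of the irreducible set `Z`. -/
def Comp.HasGenericEps (i : I) (Z : Comp sgn W v) (c : ℕ) : Prop :=
  ∃ U : Set (Lagrangian sgn W v), IsOpen U ∧ (Z.1 ∩ U).Nonempty ∧
    ∀ q ∈ Z.1 ∩ U, QuiverVariety.eps i q.1 = c

variable (sgn W v) in
/-- The set of irreducible components with generic value `c` of `ε_i`. -/
abbrev CompEps (i : I) (c : ℕ) : Type _ :=
  {Z : Comp sgn W v // Z.HasGenericEps i c}

/-- The Hecke correspondence between `𝔛(v')` and `𝔛(v)`, as a relation: `q' = ϖ₁ z` and `q = ϖ₂ z`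
for some point `z` of the variety of pairs `([B, t, s], Im φ)`. Here `φ : V' → V` is a graded
injection intertwining `(B', t', s')` with `(B, t, s)`; equivalently, `Im φ` is `B`-stable and
contains `Im s`, and `(B', t', s')` is induced by `(B, t, s)` on `V'` via `φ`. -/
def HeckeRel {v' v : I → ℕ} (q' : QuiverVariety sgn W v') (q : QuiverVariety sgn W v) : Prop :=
  ∃ (x' : StableZero sgn W v') (x : StableZero sgn W v) (φ : (i : I) → (VSp v' i →ₗ[ℂ] VSp v i)),
    QuiverVariety.mk x' = q' ∧ QuiverVariety.mk x = q ∧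
    (∀ i, Function.Injective (φ i)) ∧
    (∀ (i j : I) (τ : i ⟶ j), φ j ∘ₗ x'.1.B τ = x.1.B τ ∘ₗ φ i) ∧
    (∀ i, x'.1.t i = x.1.t i ∘ₗ φ i) ∧
    (∀ i, φ i ∘ₗ x'.1.s i = x.1.s i)

/-- The image `ϖ₂ (ϖ₁⁻¹ S)`, inside the Lagrangian subvariety. -/
def heckeImage {v' : I → ℕ} (v : I → ℕ) (S : Set (Lagrangian sgn W v')) :
    Set (Lagrangian sgn W v) :=
  {q | ∃ q' ∈ S, HeckeRel q'.1 q.1}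

/-- Components `Z'` and `Z` correspond to each other under
`ϖ₁ : 𝔛(v', v)_{i,0} → 𝔛(v')_{i,0}` and `ϖ₂ : 𝔛(v', v)_{i,0} ≅ 𝔛(v)_{i,c}`:
the irreducible component `Z ∩ 𝔛(v)_{i,c}` of the stratum `𝔛(v)_{i,c}` of the Lagrangian subvariety
is `ϖ₂ (ϖ₁⁻¹ (Z' ∩ 𝔛(v')_{i,0}))`. -/
def Comp.Matches {v' : I → ℕ} (i : I) (c : ℕ) (Z' : Comp sgn W v') (Z : Comp sgn W v) : Prop :=
  heckeImage v {q ∈ Z'.1 | QuiverVariety.eps i q.1 = 0} = {q ∈ Z.1 | QuiverVariety.eps i q.1 = c}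

variable (sgn W) in
/-- The disjoint union over all dimension vectors of the sets of irreducible components. -/
abbrev AllComp : Type _ := Σ v : I → ℕ, Comp sgn W v

/-- The relation `Z = f̃_i^c Z'`, equivalently `Z' = ẽ_i^c Z`, between components `Z'` with
`ε_i = 0` and components `Z` with `ε_i = c`. -/
def IsStringPair [DecidableEq I] (i : I) (c : ℕ) (Z' Z : AllComp sgn W) : Prop :=
  Z.1 = Z'.1 + Pi.single i c ∧ Z'.2.HasGenericEps i 0 ∧ Z.2.HasGenericEps i c ∧
    Z'.2.Matches i c Z.2

/-- The weight `λ + ν`, where `λ = ∑ i, dim W_i • Λ_i` and `ν = - ∑ i, v_i • α_i`. -/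
def weight [DecidableEq I] {A : Matrix I I ℤ} {P : Type*} [AddCommGroup P] (R : WeightData A P)
    (W : I → Type*) [∀ i, AddCommGroup (W i)] [∀ i, Module ℂ (W i)] (v : I → ℕ) : P :=
  (∑ i, Module.finrank ℂ (W i) • R.Λ i) + -(∑ i, v i • R.α i)

end QuiverVariety

end QuiverCrystal

end

/-!
Write `L(v)` for the Lagrangian subvariety of `𝔛(v)`, and call `(⨁_{out τ = i} V_{in τ}) ⊕ W_i` the
outgoing space at `i` (`OutSp`). The map `(ε(τ) B_{τ̄}, s_i)` from it to `V_i` (`retMap`) has corank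
`ε_i`, and the moment map equation says that it kills the image of `(B_τ, t_i)` (`outMap`), a map
which is injective at stable points.

The function `ε_i` is upper semicontinuous, so its generic value on a component is its minimum
there (`hasGenericEps_iff`), and a component with generic value `c` is the closure of its open
locus `ε_i = c`. Restricting a point with `ε_i = c` to the image of the incoming map at `i` defines
a map `down` from the stratum `ε_i = c` of `L(v' + c e_i)` to the stratum `ε_i = 0` of `L(v')`, and
the Hecke correspondence between these strata is its graph. A point over `x'` is an extension of
`x'` by a space `C` of dimension `c` at `i`; it is given by a map `f` from `C` to the kernel of
`retMap` at `x'` that is injective modulo the image of `outMap`. The map `down` therefore has the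
following properties.

* Its fibre over a point with `ε_i = 0` is non-empty if and only if `2 v'_i + c` is at most the
  dimension of the outgoing space (`exists_down_eq`, `le_finrank_outSp`), and fibres are
  irreducible, being images of open subsets of the vector space of all `f`
  (`isPreirreducible_fiber_down`).
* It is continuous (`continuous_down`), because the image of the incoming map is locally a graph
  depending regularly on the point, and open (`isOpenMap_down`), because it has local sections.

Hence the preimage of an irreducible set is irreducible, and components with generic value `c`
inject into components with generic value `0` by taking closures of images and preimages, once
these closures are known to be components. For images this is formal
(`exists_matches_of_hasGenericEps`). For preimages dimensions are needed.

Dimensions are measured in the representation space, as transcendence degrees of coordinate rings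
of the inverse images of subsets of `L(v)`. A biregular chart (`extChart`) shows that taking the
preimage under `down` adds `c` times the dimension of the outgoing space (`hasDim_lift_upSet`).
If `v ≠ 0`, nilpotency forbids that `ε_i` is generically `0` for all `i`
(`exists_hasGenericEps_pos`); so every component is obtained from a component for a smaller
dimension vector, and induction shows that all components of `L(v)` have the same dimension
(`exists_hasDim_comp`). The closure of the preimage of a component is then contained in a component
of the same dimension, and is equal to it (`exists_matches_of_hasGenericEps_zero`).

The crystal axioms follow formally from these bijections. By `pairing_weight`, a component of
generic value `c` coming from dimension vector `v'` has `φ_i` equal to the dimension of the outgoing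
space minus `2 v'_i + c`, so `φ_i > 0` is the condition for the string to continue.
-/

noncomputable section

namespace QuiverCrystal

open Set

set_option linter.unusedSectionVars false

/-! ### Transcendence degree of algebras over a field -/

/-- A proper quotient domain has strictly smaller transcendence degree. -/
theorem trdeg_lt_of_surjective {k A B : Type*} [Field k] [CommRing A] [IsDomain A] [Algebra k A]
    [CommRing B] [IsDomain B] [Algebra k B] (f : A →ₐ[k] B) (hf : Function.Surjective f)
    {g : A} (hg : g ≠ 0) (hfg : f g = 0) {m n : ℕ} (hA : Algebra.trdeg k A = m)
    (hB : Algebra.trdeg k B = n) : n < m := by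
  by_contra hmn
  obtain ⟨s, hs⟩ := exists_isTranscendenceBasis k B
  choose r hr using hf
  set x : s → A := fun i => r i.1 with hxdef
  have hfx : f ∘ x = ((↑) : s → B) := funext fun i => hr i.1
  have hx : AlgebraicIndependent k x := AlgebraicIndependent.of_comp f (hfx ▸ hs.1)
  have hcard : Cardinal.mk s = (n : Cardinal) := by rw [hs.cardinalMk_eq_trdeg, hB]
  have hfin : Finite s := Cardinal.mk_lt_aleph0_iff.1 (hcard ▸ Cardinal.natCast_lt_aleph0)
  have hbas : IsTranscendenceBasis k x := by
    refine hx.isTranscendenceBasis_of_lift_trdeg_le_of_finite ?_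
    rw [hA, hcard]
    simpa using (not_lt.1 hmn)
  have halg : IsAlgebraic (Algebra.adjoin k (range x)) g :=
    hbas.isAlgebraic.isAlgebraic g
  obtain ⟨q, hq0, hq⟩ :=
    halg.exists_nonzero_coeff_and_aeval_eq_zero (mem_nonZeroDivisors_of_ne_zero hg)
  -- The constant coefficient of `q` lies in the ideal of `g`, so `f` kills it.
  have hcoef : f (q.coeff 0 : A) = 0 := by
    have h := congrArg f hq
    rw [map_zero, Polynomial.aeval_def, ← Polynomial.divX_mul_X_add q] at h
    simpa [Polynomial.eval₂_add, Polynomial.eval₂_mul, hfg, Subalgebra.algebraMap_def] using h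
  obtain ⟨p, hp⟩ : (q.coeff 0 : A) ∈ (MvPolynomial.aeval (R := k) x).range :=
    Algebra.adjoin_range_eq_range_aeval k x ▸ (q.coeff 0).2
  have hp' : MvPolynomial.aeval x p = (q.coeff 0 : A) := hp
  rw [← hp', MvPolynomial.comp_aeval_apply] at hcoef
  have hp0 : p = 0 := by
    have hinj : Function.Injective (MvPolynomial.aeval (R := k) (f ∘ x)) := hfx ▸ hs.1
    exact hinj (by rw [map_zero]; exact hcoef)
  apply hq0
  ext
  rw [← hp', hp0, map_zero]; rfl

/-- Algebraic extensions do not change a finite transcendence degree. -/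
theorem trdeg_eq_of_isAlgebraic_algebra {k A B : Type*} [Field k] [CommRing A] [IsDomain A]
    [Algebra k A] [CommRing B] [IsDomain B] [Algebra k B] [Algebra A B] [IsScalarTower k A B]
    [FaithfulSMul A B] [Algebra.IsAlgebraic A B] {n : ℕ} :
    Algebra.trdeg k A = n ↔ Algebra.trdeg k B = n := by
  have h := lift_trdeg_add_eq k A B
  rw [_root_.trdeg_eq_zero (R := A), Cardinal.lift_zero, add_zero] at h
  rw [← Cardinal.lift_eq_nat_iff, h, Cardinal.lift_eq_nat_iff]

/-! ### Polynomial and regular functions on subsets of a vector space -/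

section Functions

variable {E F G : Type*} [AddCommGroup E] [Module ℂ E] [AddCommGroup F] [Module ℂ F]
  [AddCommGroup G] [Module ℂ G]

theorem dual_mem_polynomialFunctions (l : Module.Dual ℂ E) :
    (l : E → ℂ) ∈ polynomialFunctions E := Algebra.subset_adjoin ⟨l, rfl⟩

theorem polynomialFunctions_comp (L : E →ₗ[ℂ] F) {f : F → ℂ} (hf : f ∈ polynomialFunctions F) :
    f ∘ L ∈ polynomialFunctions E := by
  induction hf using Algebra.adjoin_induction with
  | mem f hf =>
    obtain ⟨l, rfl⟩ := hf
    exact dual_mem_polynomialFunctions (l ∘ₗ L)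
  | algebraMap r => exact (polynomialFunctions E).algebraMap_mem r
  | add f g _ _ hf hg => exact (polynomialFunctions E).add_mem hf hg
  | mul f g _ _ hf hg => exact (polynomialFunctions E).mul_mem hf hg

/-- Restricted to an affine line, a polynomial function is a polynomial in one variable. -/
theorem exists_polynomial_on_line {f : E → ℂ} (hf : f ∈ polynomialFunctions E) (x d : E) :
    ∃ P : Polynomial ℂ, ∀ t : ℂ, f (x + t • d) = P.eval t := by
  induction hf using Algebra.adjoin_induction with
  | mem f hf =>
    obtain ⟨l, rfl⟩ := hf
    refine ⟨Polynomial.C (l x) + Polynomial.X * Polynomial.C (l d), fun t => ?_⟩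
    simp; ring
  | algebraMap r => exact ⟨Polynomial.C r, fun t => by simp⟩
  | add f g _ _ hf hg =>
    obtain ⟨P, hP⟩ := hf
    obtain ⟨Q, hQ⟩ := hg
    exact ⟨P + Q, fun t => by simp [hP, hQ]⟩
  | mul f g _ _ hf hg =>
    obtain ⟨P, hP⟩ := hf
    obtain ⟨Q, hQ⟩ := hg
    exact ⟨P * Q, fun t => by simp [hP, hQ]⟩

/-- Restriction of functions to a subset, as a homomorphism of algebras. -/
def restrictHom {X : Type*} (S : Set X) : (X → ℂ) →ₐ[ℂ] (S → ℂ) :=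
  AlgHom.pi fun x : S => Pi.evalAlgHom ℂ (fun _ : X => ℂ) x.1

/-- The algebra of functions on `S` that are restrictions of polynomial functions. -/
def coordRing (S : Set E) : Subalgebra ℂ (S → ℂ) := (polynomialFunctions E).map (restrictHom S)

theorem mem_coordRing {S : Set E} {f : S → ℂ} :
    f ∈ coordRing S ↔ ∃ p ∈ polynomialFunctions E, ∀ x : S, f x = p x := by
  simp only [coordRing, Subalgebra.mem_map]
  exact ⟨fun ⟨p, hp, h⟩ => ⟨p, hp, fun x => (congrFun h x).symm⟩,
    fun ⟨p, hp, h⟩ => ⟨p, hp, funext fun x => (h x).symm⟩⟩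

/-- The algebra of functions on `S` of the form `p / q`, where `p` and `q` are polynomial functions
and `q` has no zero on `S`. -/
def regularRing (S : Set E) : Subalgebra ℂ (S → ℂ) where
  carrier := {f | ∃ p ∈ polynomialFunctions E, ∃ q ∈ polynomialFunctions E,
    ∀ x : S, q x ≠ 0 ∧ f x * q x = p x}
  mul_mem' := by
    rintro f g ⟨p, hp, q, hq, h⟩ ⟨p', hp', q', hq', h'⟩
    refine ⟨_, mul_mem hp hp', _, mul_mem hq hq', fun x => ⟨mul_ne_zero (h x).1 (h' x).1, ?_⟩⟩
    simp only [Pi.mul_apply, ← (h x).2, ← (h' x).2]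
    ring
  add_mem' := by
    rintro f g ⟨p, hp, q, hq, h⟩ ⟨p', hp', q', hq', h'⟩
    refine ⟨_, add_mem (mul_mem hp hq') (mul_mem hp' hq), _, mul_mem hq hq',
      fun x => ⟨mul_ne_zero (h x).1 (h' x).1, ?_⟩⟩
    simp only [Pi.mul_apply, Pi.add_apply, ← (h x).2, ← (h' x).2]
    ring
  algebraMap_mem' r := ⟨_, (polynomialFunctions E).algebraMap_mem r, 1, one_mem _,
    fun x => ⟨by simp, by simp⟩⟩

theorem coordRing_le_regularRing (S : Set E) : coordRing S ≤ regularRing S := by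
  intro f hf
  obtain ⟨p, hp, h⟩ := mem_coordRing.1 hf
  exact ⟨p, hp, 1, one_mem _, fun x => ⟨by simp, by simp [h x]⟩⟩

theorem inv_mem_regularRing {S : Set E} {f : S → ℂ} (hf : f ∈ regularRing S)
    (h0 : ∀ x, f x ≠ 0) : f⁻¹ ∈ regularRing S := by
  obtain ⟨p, hp, q, hq, h⟩ := hf
  refine ⟨q, hq, p, hp, fun x => ?_⟩
  have hx := (h x).2
  have hp0 : p x ≠ 0 := by rw [← hx]; exact mul_ne_zero (h0 x) (h x).1
  refine ⟨hp0, ?_⟩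
  rw [← hx, Pi.inv_apply]
  field_simp [h0 x]

/-- `S` is irreducible for the Zariski topology: the product of two polynomial functions which do
not vanish identically on `S` does not vanish identically on `S`. -/
def ZariskiIrreducible (S : Set E) : Prop :=
  S.Nonempty ∧ ∀ f ∈ polynomialFunctions E, ∀ g ∈ polynomialFunctions E,
    (∃ x ∈ S, f x ≠ 0) → (∃ x ∈ S, g x ≠ 0) → ∃ x ∈ S, f x ≠ 0 ∧ g x ≠ 0

theorem zariskiIrreducible_univ : ZariskiIrreducible (univ : Set E) := by
  refine ⟨⟨0, mem_univ _⟩, ?_⟩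
  rintro f hf g hg ⟨x, -, hx⟩ ⟨y, -, hy⟩
  obtain ⟨P, hP⟩ := exists_polynomial_on_line hf x (y - x)
  obtain ⟨Q, hQ⟩ := exists_polynomial_on_line hg x (y - x)
  have hP0 : P ≠ 0 := by rintro rfl; exact hx (by simpa using hP 0)
  have hQ0 : Q ≠ 0 := by rintro rfl; exact hy (by simpa using hQ 1)
  obtain ⟨t, ht⟩ := Polynomial.exists_eval_ne_zero_of_natDegree_lt_card (P * Q)
    (mul_ne_zero hP0 hQ0) (Cardinal.natCast_lt_aleph0.trans_le
      (Cardinal.aleph0_le_mk ℂ))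
  rw [Polynomial.eval_mul] at ht
  exact ⟨x + t • (y - x), mem_univ _, by rw [hP]; exact left_ne_zero_of_mul ht,
    by rw [hQ]; exact right_ne_zero_of_mul ht⟩

theorem ZariskiIrreducible.inter_ne_zero {S : Set E} (hS : ZariskiIrreducible S) {q : E → ℂ}
    (hq : q ∈ polynomialFunctions E) (hne : ∃ x ∈ S, q x ≠ 0) :
    ZariskiIrreducible {x ∈ S | q x ≠ 0} := by
  refine ⟨let ⟨x, hx, h⟩ := hne; ⟨x, hx, h⟩, ?_⟩
  rintro f hf g hg ⟨x, hx, hfx⟩ ⟨y, hy, hgy⟩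
  obtain ⟨z, hz, h1, h2⟩ := hS.2 _ (mul_mem hf hq) _ (mul_mem hg hq)
    ⟨x, hx.1, mul_ne_zero hfx hx.2⟩ ⟨y, hy.1, mul_ne_zero hgy hy.2⟩
  exact ⟨z, ⟨hz, right_ne_zero_of_mul h1⟩, left_ne_zero_of_mul h1, left_ne_zero_of_mul h2⟩

theorem ZariskiIrreducible.isDomain_regularRing {S : Set E} (hS : ZariskiIrreducible S) :
    IsDomain (regularRing S) := by
  have : Nontrivial (regularRing S) := by
    obtain ⟨x, hx⟩ := hS.1
    refine ⟨0, 1, fun h => ?_⟩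
    have := congrFun (congrArg Subtype.val h) ⟨x, hx⟩
    simp at this
  have : NoZeroDivisors (regularRing S) := by
    refine ⟨fun {a b} hab => ?_⟩
    by_contra! hne
    obtain ⟨a, p, hp, q, hq, hf⟩ := a
    obtain ⟨b, p', hp', q', hq', hg⟩ := b
    have key : ∀ (f : S → ℂ) (p q : E → ℂ), (∀ x : S, q x ≠ 0 ∧ f x * q x = p x) → f ≠ 0 →
        ∃ x ∈ S, p x ≠ 0 := by
      intro f p q h h0
      obtain ⟨x, hx⟩ := Function.ne_iff.1 h0
      exact ⟨x, x.2, by rw [← (h x).2]; exact mul_ne_zero hx (h x).1⟩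
    obtain ⟨x, hx, h1, h2⟩ := hS.2 p hp p' hp' (key a p q hf fun h => hne.1 (Subtype.ext h))
      (key b p' q' hg fun h => hne.2 (Subtype.ext h))
    have h3 : a ⟨x, hx⟩ * b ⟨x, hx⟩ = 0 := congrFun (congrArg Subtype.val hab) ⟨x, hx⟩
    rcases mul_eq_zero.1 h3 with h | h
    · exact h1 (by rw [← (hf ⟨x, hx⟩).2, h, zero_mul])
    · exact h2 (by rw [← (hg ⟨x, hx⟩).2, h, zero_mul])
  exact NoZeroDivisors.to_isDomain _

theorem ZariskiIrreducible.isDomain_coordRing {S : Set E} (hS : ZariskiIrreducible S) :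
    IsDomain (coordRing S) :=
  have := hS.isDomain_regularRing
  (Subalgebra.inclusion_injective (coordRing_le_regularRing S)).isDomain
    (Subalgebra.inclusion (coordRing_le_regularRing S)).toRingHom

/-- The dimension of `S`, as the transcendence degree of its coordinate ring, is `n`. -/
def HasDim (S : Set E) (n : ℕ) : Prop := Algebra.trdeg ℂ (coordRing S) = n

/-- Regular functions are quotients of polynomial functions, so they give the same dimension. -/
theorem hasDim_iff_trdeg_regularRing {S : Set E} (hS : ZariskiIrreducible S) {n : ℕ} :
    HasDim S n ↔ Algebra.trdeg ℂ (regularRing S) = n := by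
  have := hS.isDomain_regularRing
  have := hS.isDomain_coordRing
  let _ : Algebra (coordRing S) (regularRing S) :=
    (Subalgebra.inclusion (coordRing_le_regularRing S)).toAlgebra
  have : IsScalarTower ℂ (coordRing S) (regularRing S) :=
    IsScalarTower.of_algebraMap_eq fun _ => rfl
  have : FaithfulSMul (coordRing S) (regularRing S) :=
    (faithfulSMul_iff_algebraMap_injective _ _).2
      (Subalgebra.inclusion_injective (coordRing_le_regularRing S))
  have : Algebra.IsAlgebraic (coordRing S) (regularRing S) := by
    refine ⟨fun ⟨f, p, hp, q, hq, h⟩ => ?_⟩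
    let P : coordRing S := ⟨restrictHom S p, p, hp, rfl⟩
    let Q : coordRing S := ⟨restrictHom S q, q, hq, rfl⟩
    refine ⟨Polynomial.C Q * Polynomial.X - Polynomial.C P, fun h0 => ?_, ?_⟩
    · have h1 := congrArg (fun r => Polynomial.coeff r 1) h0
      simp only [Polynomial.coeff_sub, Polynomial.coeff_C_mul, Polynomial.coeff_X_one, mul_one,
        Polynomial.coeff_C_succ, sub_zero, Polynomial.coeff_zero] at h1
      obtain ⟨x, hx⟩ := hS.1
      exact (h ⟨x, hx⟩).1 (congrFun (congrArg Subtype.val h1) ⟨x, hx⟩)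
    · simp only [map_sub, map_mul, Polynomial.aeval_C, Polynomial.aeval_X]
      ext x
      change q x * f x - p x = 0
      rw [← (h x).2]; ring
  exact trdeg_eq_of_isAlgebraic_algebra

/-- If polynomial functions vanishing on `S` vanish on the larger set `S'`, then both sets have the
same coordinate ring, hence the same dimension. -/
theorem HasDim.of_dense {S S' : Set E} (hss : S ⊆ S')
    (hd : ∀ f ∈ polynomialFunctions E, (∀ x ∈ S, f x = 0) → ∀ x ∈ S', f x = 0) {n : ℕ} :
    HasDim S n ↔ HasDim S' n := by
  let r : (S' → ℂ) →ₐ[ℂ] (S → ℂ) :=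
    AlgHom.pi fun x : S => Pi.evalAlgHom ℂ (fun _ : S' => ℂ) ⟨x.1, hss x.2⟩
  have hr : (coordRing S').map r = coordRing S := by
    rw [coordRing, Subalgebra.map_map]; rfl
  have hinj : Function.Injective (r.comp (coordRing S').val) := by
    rw [injective_iff_map_eq_zero]
    rintro ⟨f, p, hp, rfl⟩ h
    ext x
    exact hd p hp (fun y hy => congrFun h ⟨y, hy⟩) x x.2
  let e : coordRing S' ≃ₐ[ℂ] coordRing S :=
    (AlgEquiv.ofInjective _ hinj).trans (Subalgebra.equivOfEq _ _ (by
      rw [AlgHom.range_comp, Subalgebra.range_val, hr]))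
  have h := e.lift_trdeg_eq
  unfold HasDim
  rw [← Cardinal.lift_eq_nat_iff, ← h, Cardinal.lift_eq_nat_iff]

/-- An irreducible subset that is not dense has smaller dimension. -/
theorem HasDim.lt {S S' : Set E} (hS : ZariskiIrreducible S) (hS' : ZariskiIrreducible S')
    (hss : S ⊆ S') {f : E → ℂ} (hf : f ∈ polynomialFunctions E) (h0 : ∀ x ∈ S, f x = 0)
    (h1 : ∃ x ∈ S', f x ≠ 0) {m n : ℕ} (hn : HasDim S n) (hm : HasDim S' m) : n < m := by
  have := hS.isDomain_coordRing
  have := hS'.isDomain_coordRing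
  let r : (S' → ℂ) →ₐ[ℂ] (S → ℂ) :=
    AlgHom.pi fun x : S => Pi.evalAlgHom ℂ (fun _ : S' => ℂ) ⟨x.1, hss x.2⟩
  have hmem : ∀ g : coordRing S', r g.1 ∈ coordRing S := by
    rintro ⟨g, p, hp, rfl⟩
    exact ⟨p, hp, rfl⟩
  let φ : coordRing S' →ₐ[ℂ] coordRing S := (r.comp (coordRing S').val).codRestrict _ hmem
  have hφ : Function.Surjective φ := by
    rintro ⟨g, p, hp, rfl⟩
    exact ⟨⟨restrictHom S' p, p, hp, rfl⟩, rfl⟩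
  refine trdeg_lt_of_surjective φ hφ (g := ⟨restrictHom S' f, f, hf, rfl⟩) ?_ ?_ hm hn
  · obtain ⟨x, hx, hfx⟩ := h1
    exact fun h => hfx (congrFun (congrArg Subtype.val h) ⟨x, hx⟩)
  · ext x
    exact h0 x x.2

theorem hasDim_zero_of_subsingleton {S : Set E} (hS : S.Subsingleton) (hne : S.Nonempty) :
    HasDim S 0 := by
  obtain ⟨a, ha⟩ := hne
  have hs : Function.Surjective (algebraMap ℂ (coordRing S)) := by
    rintro ⟨f, hf⟩
    refine ⟨f ⟨a, ha⟩, ?_⟩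
    ext x
    rw [show x = ⟨a, ha⟩ from Subtype.ext (hS x.2 ha)]
    rfl
  have : Algebra.IsAlgebraic ℂ (coordRing S) := ⟨fun f => by
    obtain ⟨z, rfl⟩ := hs f
    exact isAlgebraic_algebraMap z⟩
  have : Nontrivial (coordRing S) := by
    refine ⟨0, 1, fun h => ?_⟩
    have := congrFun (congrArg Subtype.val h) ⟨a, ha⟩
    simp at this
  rw [HasDim, _root_.trdeg_eq_zero, Nat.cast_zero]

end Functions

section RegularMaps

variable {E F G H : Type*} [AddCommGroup E] [Module ℂ E] [AddCommGroup F] [Module ℂ F]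
  [AddCommGroup G] [Module ℂ G] [AddCommGroup H] [Module ℂ H]

/-- A map from a subset `S` of a vector space to a vector space is regular if all its coordinates
are regular functions. -/
def IsRegular {S : Set E} (f : S → F) : Prop :=
  ∀ l : Module.Dual ℂ F, (fun x => l (f x)) ∈ regularRing S

variable {S : Set E}

theorem isRegular_val : IsRegular (fun x : S => (x : E)) := fun l =>
  coordRing_le_regularRing S (mem_coordRing.2 ⟨l, dual_mem_polynomialFunctions l, fun _ => rfl⟩)

theorem isRegular_const (c : F) : IsRegular (fun _ : S => c) := fun l =>
  (regularRing S).algebraMap_mem (l c)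

theorem IsRegular.linear {f : S → F} (hf : IsRegular f) (L : F →ₗ[ℂ] G) :
    IsRegular fun x => L (f x) := fun l => hf (l ∘ₗ L)

theorem IsRegular.add {f g : S → F} (hf : IsRegular f) (hg : IsRegular g) :
    IsRegular fun x => f x + g x := fun l => by
  simp only [map_add]
  exact (regularRing S).add_mem (hf l) (hg l)

theorem IsRegular.sub {f g : S → F} (hf : IsRegular f) (hg : IsRegular g) :
    IsRegular fun x => f x - g x := fun l => by
  simp only [map_sub]
  exact (regularRing S).sub_mem (hf l) (hg l)

theorem IsRegular.sum {ι : Type*} {s : Finset ι} {f : ι → S → F} (hf : ∀ i ∈ s, IsRegular (f i)) :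
    IsRegular fun x => ∑ i ∈ s, f i x := fun l => by
  have h := (regularRing S).sum_mem fun i hi => hf i hi l
  convert h using 1
  ext x
  simp

theorem IsRegular.smul {r : S → ℂ} {f : S → F} (hr : r ∈ regularRing S) (hf : IsRegular f) :
    IsRegular fun x => r x • f x := fun l => by
  simp only [map_smul]
  exact (regularRing S).mul_mem hr (hf l)

theorem IsRegular.bilinear [FiniteDimensional ℂ F] {f : S → F} {g : S → G}
    (hf : IsRegular f) (hg : IsRegular g) (β : F →ₗ[ℂ] G →ₗ[ℂ] H) :
    IsRegular fun x => β (f x) (g x) := by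
  have h : ∀ x, β (f x) (g x) = ∑ i, (Module.finBasis ℂ F).coord i (f x) •
      β (Module.finBasis ℂ F i) (g x) := fun x => by
    conv_lhs => rw [← (Module.finBasis ℂ F).sum_repr (f x)]
    simp only [map_sum, map_smul, LinearMap.sum_apply, LinearMap.smul_apply]
    rfl
  simp only [h]
  exact IsRegular.sum fun i _ => (hg.linear _).smul (hf _)

theorem IsRegular.pi {ι : Type*} [Finite ι] {M : ι → Type*} [∀ i, AddCommGroup (M i)]
    [∀ i, Module ℂ (M i)] {f : S → (i : ι) → M i} (hf : ∀ i, IsRegular fun x => f x i) :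
    IsRegular f := by
  classical
  have := Fintype.ofFinite ι
  have h : ∀ x, f x = ∑ i, LinearMap.single ℂ M i (f x i) := fun x => by
    simp [Finset.univ_sum_single]
  rw [show f = fun x => ∑ i, LinearMap.single ℂ M i (f x i) from funext h]
  exact IsRegular.sum fun i _ => (hf i).linear _

theorem IsRegular.prodMk {f : S → F} {g : S → G} (hf : IsRegular f) (hg : IsRegular g) :
    IsRegular fun x => (f x, g x) := by
  have h : ∀ x, (f x, g x) = LinearMap.inl ℂ F G (f x) + LinearMap.inr ℂ F G (g x) := fun x => by
    simp
  simp only [h]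
  exact (hf.linear _).add (hg.linear _)

theorem IsRegular.comp_linearMap [FiniteDimensional ℂ F] [FiniteDimensional ℂ G]
    {f : S → (F →ₗ[ℂ] G)} {g : S → (H →ₗ[ℂ] F)} (hf : IsRegular f) (hg : IsRegular g) :
    IsRegular fun x => f x ∘ₗ g x :=
  hf.bilinear hg (LinearMap.llcomp ℂ H F G)

/-- The determinant and the entries of the adjugate of a matrix with entries in an algebra of
functions belong to that algebra. -/
theorem det_mem_of_forall_mem {X n : Type*} [Fintype n] [DecidableEq n] (R : Subalgebra ℂ (X → ℂ))
    {M : X → Matrix n n ℂ} (hM : ∀ i j, (fun x => M x i j) ∈ R) :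
    (fun x => (M x).det) ∈ R ∧ ∀ i j, (fun x => (M x).adjugate i j) ∈ R := by
  let M' : Matrix n n R := fun i j => ⟨_, hM i j⟩
  let ev : X → (R →+* ℂ) := fun x => (Pi.evalRingHom (fun _ : X => ℂ) x).comp R.val.toRingHom
  have hMx : ∀ x, (ev x).mapMatrix M' = M x := fun x => rfl
  constructor
  · convert M'.det.2 using 1
    ext x
    rw [← hMx x, ← RingHom.map_det]; rfl
  · intro i j
    convert (M'.adjugate i j).2 using 1
    ext x
    rw [← hMx x, ← RingHom.map_adjugate]; rfl

/-- The inverse of a regular family of automorphisms is regular, by Cramer's rule. -/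
theorem IsRegular.right_inverse {V : Type*} [AddCommGroup V] [Module ℂ V] [FiniteDimensional ℂ V]
    {f g : S → (V →ₗ[ℂ] V)} (hf : IsRegular f) (h : ∀ x, f x ∘ₗ g x = LinearMap.id) :
    IsRegular g := by
  let b := Module.finBasis ℂ V
  let T := LinearMap.toMatrix b b
  have hT : ∀ x, T (f x) * T (g x) = 1 := fun x => by
    rw [← LinearMap.toMatrix_comp, h, LinearMap.toMatrix_id]
  have hent : ∀ i j, (fun x => T (f x) i j) ∈ regularRing S := fun i j =>
    hf (LinearMap.proj j ∘ₗ LinearMap.proj i ∘ₗ T.toLinearMap)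
  obtain ⟨hdet, hadj⟩ := det_mem_of_forall_mem _ hent
  have hdet0 : ∀ x, (T (f x)).det ≠ 0 := fun x h0 => by
    have := congrArg Matrix.det (hT x)
    rw [Matrix.det_mul, h0, zero_mul, Matrix.det_one] at this
    exact zero_ne_one this
  have hg : ∀ x, g x = T.symm (((T (f x)).det)⁻¹ • (T (f x)).adjugate) := fun x => by
    rw [LinearEquiv.eq_symm_apply, ← Matrix.inv_eq_right_inv (hT x), Matrix.inv_def,
      Ring.inverse_eq_inv']
  rw [show g = _ from funext hg]
  refine IsRegular.linear (f := fun x => ((T (f x)).det)⁻¹ • (T (f x)).adjugate) ?_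
    T.symm.toLinearMap
  refine IsRegular.smul (inv_mem_regularRing hdet hdet0) ?_
  refine IsRegular.pi fun i => IsRegular.pi fun j => fun l => ?_
  have hl : ∀ z : ℂ, l z = l 1 * z := fun z => by
    conv_lhs => rw [← mul_one z, ← smul_eq_mul, map_smul, smul_eq_mul, mul_comm]
  rw [funext fun x => hl _]
  exact (regularRing S).mul_mem ((regularRing S).algebraMap_mem (l 1)) (hadj i j)

theorem mem_regularRing_of_mem_polynomialFunctions {f : S → F} (hf : IsRegular f) {p : F → ℂ}
    (hp : p ∈ polynomialFunctions F) : (fun x => p (f x)) ∈ regularRing S := by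
  induction hp using Algebra.adjoin_induction with
  | mem p hp =>
    obtain ⟨l, rfl⟩ := hp
    exact hf l
  | algebraMap r => exact (regularRing S).algebraMap_mem r
  | add p q _ _ hp hq => exact (regularRing S).add_mem hp hq
  | mul p q _ _ hp hq => exact (regularRing S).mul_mem hp hq

theorem IsRegular.comp_mem {f : S → F} (hf : IsRegular f) {T : Set F} (hT : ∀ x, f x ∈ T)
    {r : T → ℂ} (hr : r ∈ regularRing T) : (fun x => r ⟨f x, hT x⟩) ∈ regularRing S := by
  obtain ⟨p, hp, q, hq, h⟩ := hr
  have hp' := mem_regularRing_of_mem_polynomialFunctions hf hp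
  have hq' := mem_regularRing_of_mem_polynomialFunctions hf hq
  convert (regularRing S).mul_mem hp' (inv_mem_regularRing hq' fun x => (h ⟨f x, hT x⟩).1) using 1
  ext x
  obtain ⟨h0, h1⟩ := h ⟨f x, hT x⟩
  exact (eq_mul_inv_iff_mul_eq₀ h0).2 h1

/-- The regular image of an irreducible set is irreducible. -/
theorem ZariskiIrreducible.range {f : S → F} (hS : ZariskiIrreducible S) (hf : IsRegular f) :
    ZariskiIrreducible (Set.range f) := by
  have := hS.isDomain_regularRing
  refine ⟨let ⟨x, hx⟩ := hS.1; ⟨_, ⟨x, hx⟩, rfl⟩, ?_⟩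
  rintro p hp q hq ⟨_, ⟨x, rfl⟩, hx⟩ ⟨_, ⟨y, rfl⟩, hy⟩
  let P : regularRing S := ⟨_, mem_regularRing_of_mem_polynomialFunctions hf hp⟩
  let Q : regularRing S := ⟨_, mem_regularRing_of_mem_polynomialFunctions hf hq⟩
  have hPQ : P * Q ≠ 0 := mul_ne_zero (fun h => hx (congrFun (congrArg Subtype.val h) x))
    (fun h => hy (congrFun (congrArg Subtype.val h) y))
  have hPQ' : (P * Q).1 ≠ 0 := fun h => hPQ (Subtype.ext h)
  obtain ⟨z, hz⟩ := Function.ne_iff.1 hPQ'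
  exact ⟨f z, ⟨z, rfl⟩, left_ne_zero_of_mul hz, right_ne_zero_of_mul hz⟩

/-- Biregular sets have the same dimension. -/
theorem HasDim.of_biregular {T : Set F} (hS : ZariskiIrreducible S) (hT : ZariskiIrreducible T)
    (e : S ≃ T) (he : IsRegular fun x => (e x : F)) (he' : IsRegular fun y => (e.symm y : E))
    {n : ℕ} : HasDim S n ↔ HasDim T n := by
  rw [hasDim_iff_trdeg_regularRing hS, hasDim_iff_trdeg_regularRing hT]
  let φ : regularRing S →ₐ[ℂ] regularRing T :=
    { toFun := fun r => ⟨fun y => r.1 (e.symm y), he'.comp_mem (fun y => (e.symm y).2) r.2⟩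
      map_one' := rfl
      map_mul' := fun _ _ => rfl
      map_zero' := rfl
      map_add' := fun _ _ => rfl
      commutes' := fun _ => rfl }
  have hφ : Function.Bijective φ := by
    constructor
    · intro a b h
      ext x
      have h' : a.1 (e.symm (e x)) = b.1 (e.symm (e x)) :=
        congrFun (congrArg Subtype.val h) (e x)
      simpa using h'
    · intro b
      refine ⟨⟨fun x => b.1 (e x), he.comp_mem (fun x => (e x).2) b.2⟩, ?_⟩
      ext y
      exact congrArg b.1 (e.apply_symm_apply y)
  have h := (AlgEquiv.ofBijective φ hφ).lift_trdeg_eq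
  rw [← Cardinal.lift_eq_nat_iff, h, Cardinal.lift_eq_nat_iff]

/-- The product of an irreducible set with a vector space is irreducible, and the dimensions add
up: its coordinate ring is a polynomial ring over that of the given set. -/
theorem irreducible_and_hasDim_prod_univ [FiniteDimensional ℂ F] (hS : ZariskiIrreducible S) {n : ℕ}
    (hn : HasDim S n) : ZariskiIrreducible (S ×ˢ (univ : Set F)) ∧
      HasDim (S ×ˢ (univ : Set F)) (n + Module.finrank ℂ F) := by
  have := hS.isDomain_coordRing
  let k := Module.finrank ℂ F
  let b := Module.finBasis ℂ F
  let T : Set (E × F) := S ×ˢ univ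
  let pb : (S → ℂ) →ₐ[ℂ] (T → ℂ) :=
    AlgHom.pi fun x : T => Pi.evalAlgHom ℂ (fun _ : S => ℂ) ⟨x.1.1, x.2.1⟩
  let X : Fin k → T → ℂ := fun i x => b.coord i x.1.2
  let Θ : MvPolynomial (Fin k) (coordRing S) →ₐ[ℂ] (T → ℂ) :=
    { MvPolynomial.eval₂Hom ((pb.comp (coordRing S).val).toRingHom) X with
      commutes' := fun r => by
        have h : algebraMap ℂ (MvPolynomial (Fin k) (coordRing S)) r =
          MvPolynomial.C (algebraMap ℂ (coordRing S) r) := rfl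
        simp only [h]
        simp }
  have hΘC : ∀ a, Θ (MvPolynomial.C a) = pb a.1 := fun a => MvPolynomial.eval₂_C _ _ _
  have hΘX : ∀ i, Θ (MvPolynomial.X i) = X i := fun i => MvPolynomial.eval₂_X _ _ _
  have hΘ : ∀ P (x : S) (y : F), Θ P ⟨(x.1, y), x.2, mem_univ _⟩ =
      MvPolynomial.eval (fun i => b.coord i y) (P.map
        ((Pi.evalRingHom (fun _ : S => ℂ) x).comp (coordRing S).val.toRingHom)) := by
    intro P x y
    induction P using MvPolynomial.induction_on with
    | C a => rw [hΘC]; simp; rfl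
    | add p q hp hq => simp only [map_add, Pi.add_apply, hp, hq]
    | mul_X p i hp =>
      simp only [map_mul, Pi.mul_apply, hp, hΘX, MvPolynomial.map_X, MvPolynomial.eval_X]
      rfl
  have hinj : Function.Injective Θ := by
    rw [injective_iff_map_eq_zero]
    intro P hP
    ext m x
    have hx : P.map ((Pi.evalRingHom (fun _ : S => ℂ) x).comp (coordRing S).val.toRingHom) = 0 := by
      refine MvPolynomial.funext fun z => ?_
      have h1 := hΘ P x (b.equivFun.symm z)
      rw [hP] at h1
      have h2 : (fun i => b.coord i (b.equivFun.symm z)) = z := by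
        ext i
        have := congrFun (b.equivFun.apply_symm_apply z) i
        simpa using this
      rw [h2] at h1
      rw [← h1]; simp
    have h3 := congrArg (MvPolynomial.coeff m) hx
    rw [MvPolynomial.coeff_map] at h3
    simpa using h3
  have hrange : Θ.range = coordRing T := by
    apply le_antisymm
    · rintro _ ⟨P, rfl⟩
      change Θ P ∈ _
      induction P using MvPolynomial.induction_on with
      | C a =>
        rw [hΘC]
        obtain ⟨p, hp, h⟩ := mem_coordRing.1 a.2
        exact mem_coordRing.2 ⟨_, polynomialFunctions_comp (LinearMap.fst ℂ E F) hp,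
          fun x => h ⟨x.1.1, x.2.1⟩⟩
      | add p q hp hq => rw [map_add]; exact add_mem hp hq
      | mul_X p i hp =>
        rw [map_mul, hΘX]
        exact mul_mem hp (mem_coordRing.2 ⟨_, dual_mem_polynomialFunctions
          (b.coord i ∘ₗ LinearMap.snd ℂ E F), fun x => rfl⟩)
    · rw [coordRing, polynomialFunctions, AlgHom.map_adjoin, Algebra.adjoin_le_iff]
      rintro _ ⟨_, ⟨l, rfl⟩, rfl⟩
      have hl : restrictHom T (l : E × F → ℂ) = Θ (MvPolynomial.C ⟨restrictHom S
          (l ∘ₗ LinearMap.inl ℂ E F : Module.Dual ℂ E), _, dual_mem_polynomialFunctions _, rfl⟩ +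
          ∑ i, algebraMap ℂ (MvPolynomial (Fin k) (coordRing S)) (l (0, b i)) *
            MvPolynomial.X i) := by
        rw [map_add, hΘC, map_sum]
        ext x
        obtain ⟨⟨x, y⟩, hx, -⟩ := x
        have hy : l (x, y) = l (x, 0) + ∑ i, l (0, b i) * b.coord i y := by
          have h1 : ∑ i, l (0, b i) * b.coord i y = l (LinearMap.inr ℂ E F y) := by
            conv_rhs => rw [← b.sum_repr y]
            simp only [map_sum, map_smul, smul_eq_mul]
            exact Finset.sum_congr rfl fun i _ => mul_comm _ _
          rw [h1, ← map_add]
          simp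
        simp only [map_mul, AlgHom.commutes, hΘX]
        simp only [Pi.add_apply, Finset.sum_apply, Pi.mul_apply]
        exact hy
      rw [hl]
      exact ⟨_, rfl⟩
  let e : MvPolynomial (Fin k) (coordRing S) ≃ₐ[ℂ] coordRing T :=
    (AlgEquiv.ofInjective Θ hinj).trans (Subalgebra.equivOfEq _ _ hrange)
  have hdom : IsDomain (coordRing T) := e.symm.toMulEquiv.isDomain _
  refine ⟨⟨?_, ?_⟩, ?_⟩
  · obtain ⟨x, hx⟩ := hS.1
    exact ⟨(x, 0), hx, mem_univ _⟩
  · rintro p hp q hq ⟨x, hx, hpx⟩ ⟨y, hy, hqy⟩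
    let P : coordRing T := ⟨restrictHom T p, p, hp, rfl⟩
    let Q : coordRing T := ⟨restrictHom T q, q, hq, rfl⟩
    have hPQ : P * Q ≠ 0 := mul_ne_zero
      (fun h => hpx (congrFun (congrArg Subtype.val h) ⟨x, hx⟩))
      (fun h => hqy (congrFun (congrArg Subtype.val h) ⟨y, hy⟩))
    have hPQ' : (P * Q).1 ≠ 0 := fun h => hPQ (Subtype.ext h)
    obtain ⟨z, hz⟩ := Function.ne_iff.1 hPQ'
    exact ⟨z, z.2, left_ne_zero_of_mul hz, right_ne_zero_of_mul hz⟩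
  · have h1 := AlgEquiv.lift_trdeg_eq (R := ℂ) (A := MvPolynomial (Fin k) (coordRing S))
      (A' := coordRing T) e
    have : FaithfulSMul ℂ (coordRing S) := (faithfulSMul_iff_algebraMap_injective _ _).2
      (algebraMap ℂ (coordRing S)).injective
    have h2 := lift_trdeg_add_eq ℂ (coordRing S) (MvPolynomial (Fin k) (coordRing S))
    rw [HasDim] at hn
    rw [MvPolynomial.trdeg_of_isDomain, hn] at h2
    unfold HasDim
    rw [← Cardinal.lift_eq_nat_iff, ← h1]
    simp only [Cardinal.lift_natCast, Cardinal.mk_fin, Cardinal.lift_id] at h2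
    have h3 : Algebra.trdeg ℂ (MvPolynomial (Fin k) (coordRing S)) = ((n + k : ℕ) : Cardinal) := by
      rw [← h2, Nat.cast_add]
    rw [h3, Cardinal.lift_natCast]

end RegularMaps

/-! ### The Zariski topology -/

/-- The topology of the vector space `E` is its Zariski topology. -/
class IsZariski (E : Type*) [AddCommGroup E] [Module ℂ E] [τ : TopologicalSpace E] : Prop where
  eq_zariski : τ = zariskiTopology E

section Zariski

variable {E F V U : Type*} [AddCommGroup E] [Module ℂ E] [AddCommGroup F] [Module ℂ F]
  [AddCommGroup V] [Module ℂ V] [AddCommGroup U] [Module ℂ U]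
  [TopologicalSpace E] [IsZariski E] [TopologicalSpace F] [IsZariski F]

theorem isOpen_ne_zero {f : E → ℂ} (hf : f ∈ polynomialFunctions E) : IsOpen {x | f x ≠ 0} := by
  rw [IsZariski.eq_zariski (E := E)]
  exact TopologicalSpace.isOpen_generateFrom_of_mem ⟨f, hf, rfl⟩

theorem exists_ne_zero_subset {O : Set E} (hO : IsOpen O) {x : E} (hx : x ∈ O) :
    ∃ f ∈ polynomialFunctions E, f x ≠ 0 ∧ ∀ y, f y ≠ 0 → y ∈ O := by
  rw [IsZariski.eq_zariski (E := E)] at hO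
  induction hO with
  | basic s hs =>
    obtain ⟨f, hf, rfl⟩ := hs
    exact ⟨f, hf, hx, fun _ h => h⟩
  | univ => exact ⟨1, one_mem _, by simp, fun _ _ => mem_univ _⟩
  | inter s t _ _ hs ht =>
    obtain ⟨f, hf, hfx, hfs⟩ := hs hx.1
    obtain ⟨g, hg, hgx, hgt⟩ := ht hx.2
    exact ⟨_, mul_mem hf hg, mul_ne_zero hfx hgx, fun y hy =>
      ⟨hfs y (left_ne_zero_of_mul hy), hgt y (right_ne_zero_of_mul hy)⟩⟩
  | sUnion S _ ih =>
    obtain ⟨s, hs, hxs⟩ := hx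
    obtain ⟨f, hf, hfx, h⟩ := ih s hs hxs
    exact ⟨f, hf, hfx, fun y hy => ⟨s, hs, h y hy⟩⟩

theorem isIrreducible_iff_zariskiIrreducible {S : Set E} :
    IsIrreducible S ↔ ZariskiIrreducible S := by
  refine and_congr_right fun _ => ⟨fun h f hf g hg hx hy => ?_, fun h O O' hO hO' hx hy => ?_⟩
  · exact h _ _ (isOpen_ne_zero hf) (isOpen_ne_zero hg) hx hy
  · obtain ⟨x, hxS, hx⟩ := hx
    obtain ⟨y, hyS, hy⟩ := hy
    obtain ⟨f, hf, hfx, hfO⟩ := exists_ne_zero_subset hO hx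
    obtain ⟨g, hg, hgy, hgO⟩ := exists_ne_zero_subset hO' hy
    obtain ⟨z, hz, h1, h2⟩ := h f hf g hg ⟨x, hxS, hfx⟩ ⟨y, hyS, hgy⟩
    exact ⟨z, hz, hfO z h1, hgO z h2⟩

theorem eq_zero_of_mem_closure {S : Set E} {f : E → ℂ} (hf : f ∈ polynomialFunctions E)
    (h : ∀ x ∈ S, f x = 0) : ∀ x ∈ closure S, f x = 0 := by
  intro x hx
  by_contra h0
  obtain ⟨y, hy, hyS⟩ := mem_closure_iff.1 hx _ (isOpen_ne_zero hf) h0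
  exact hy (h y hyS)

theorem exists_separating_of_notMem_closure {S : Set E} {x : E} (hx : x ∉ closure S) :
    ∃ f ∈ polynomialFunctions E, (∀ y ∈ S, f y = 0) ∧ f x ≠ 0 := by
  obtain ⟨f, hf, hfx, h⟩ := exists_ne_zero_subset isClosed_closure.isOpen_compl hx
  exact ⟨f, hf, fun y hy => by_contra fun h0 => h y h0 (subset_closure hy), hfx⟩

theorem IsRegular.continuous {S : Set E} {f : S → F} (hf : IsRegular f) : Continuous f := by
  rw [IsZariski.eq_zariski (E := F), continuous_generateFrom_iff]
  rintro _ ⟨p, hp, rfl⟩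
  obtain ⟨a, ha, b, hb, h⟩ := mem_regularRing_of_mem_polynomialFunctions hf hp
  have : (f ⁻¹' {x | p x ≠ 0}) = (fun x : S => (x : E)) ⁻¹' {x | a x ≠ 0} := by
    ext x
    simp only [mem_preimage, mem_ofPred_eq, ← (h x).2]
    exact ⟨fun h0 => mul_ne_zero h0 (h x).1, fun h0 => left_ne_zero_of_mul h0⟩
  rw [this]
  exact (isOpen_ne_zero ha).preimage continuous_subtype_val

theorem continuous_linearMap (L : E →ₗ[ℂ] F) : Continuous L := by
  rw [← continuousOn_univ, continuousOn_iff_continuous_domRestrict]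
  exact (isRegular_val.linear L).continuous

end Zariski

section Rank

variable {E V U : Type*} [AddCommGroup E] [Module ℂ E]
  [AddCommGroup V] [Module ℂ V] [AddCommGroup U] [Module ℂ U] [FiniteDimensional ℂ V]

/-- The rank of a linear map depending linearly on a parameter is lower semicontinuous. -/
theorem exists_polynomial_le_finrank_range (L : E →ₗ[ℂ] V →ₗ[ℂ] U) {x₀ : E} {r : ℕ}
    (hr : r ≤ Module.finrank ℂ (LinearMap.range (L x₀))) :
    ∃ q ∈ polynomialFunctions E, q x₀ ≠ 0 ∧
      ∀ x, q x ≠ 0 → r ≤ Module.finrank ℂ (LinearMap.range (L x)) := by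
  obtain ⟨w, hw⟩ := exists_linearIndependent_of_le_finrank hr
  choose u hu using fun i => (w i).2
  have hw' : LinearIndependent ℂ fun i => L x₀ (u i) := by
    have := hw.map' (LinearMap.range (L x₀)).subtype (Submodule.ker_subtype _)
    rw [show (fun i => L x₀ (u i)) = (LinearMap.range (L x₀)).subtype ∘ w from funext hu]
    exact this
  let α : (Fin r → ℂ) →ₗ[ℂ] V := Fintype.linearCombination ℂ u
  have hα : ∀ x, L x ∘ₗ α = Fintype.linearCombination ℂ fun i => L x (u i) := by
    intro x
    refine LinearMap.ext fun c => ?_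
    simp [α, Fintype.linearCombination_apply]
  have hker : LinearMap.ker (L x₀ ∘ₗ α) = ⊥ := by
    rw [hα]
    exact LinearMap.ker_eq_bot.2 (linearIndependent_iff_injective_fintypeLinearCombination.1 hw')
  obtain ⟨β, hβ⟩ := LinearMap.exists_leftInverse_of_injective _ hker
  let M : E → Matrix (Fin r) (Fin r) ℂ := fun x => LinearMap.toMatrix' (β ∘ₗ L x ∘ₗ α)
  have hM : ∀ i j, (fun x => M x i j) ∈ polynomialFunctions E := by
    intro i j
    let l : Module.Dual ℂ E := LinearMap.proj i ∘ₗ β ∘ₗ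
      LinearMap.applyₗ (α (Pi.single j 1)) ∘ₗ L
    exact (dual_mem_polynomialFunctions l)
  refine ⟨_, (det_mem_of_forall_mem _ hM).1, ?_, fun x hx => ?_⟩
  · simp only [M]
    rw [hβ, LinearMap.toMatrix'_id, Matrix.det_one]
    exact one_ne_zero
  · have hinj : Function.Injective (L x ∘ₗ α) := by
      have h1 : Function.Injective (M x).mulVec := by
        rw [Matrix.mulVec_injective_iff_isUnit, Matrix.isUnit_iff_isUnit_det]
        exact isUnit_iff_ne_zero.2 hx
      have h2 : (M x).mulVec = β ∘ (L x ∘ₗ α) := by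
        funext c
        rw [← Matrix.toLin'_apply, Matrix.toLin'_toMatrix']
        rfl
      rw [h2] at h1
      exact h1.of_comp
    have h3 := LinearMap.finrank_range_of_inj hinj
    rw [Module.finrank_fin_fun] at h3
    rw [← h3]
    exact Submodule.finrank_mono (LinearMap.range_comp_le_range _ _)

theorem isOpen_le_finrank_range [TopologicalSpace E] [IsZariski E]
    (L : E →ₗ[ℂ] V →ₗ[ℂ] U) (r : ℕ) :
    IsOpen {x | r ≤ Module.finrank ℂ (LinearMap.range (L x))} := by
  rw [isOpen_iff_forall_mem_open]
  intro x hx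
  obtain ⟨q, hq, hqx, h⟩ := exists_polynomial_le_finrank_range L hx
  exact ⟨_, h, isOpen_ne_zero hq, hqx⟩

theorem injective_iff_le_finrank_range (f : V →ₗ[ℂ] U) : Function.Injective f ↔
    Module.finrank ℂ V ≤ Module.finrank ℂ (LinearMap.range f) := by
  rw [← LinearMap.ker_eq_bot, ← Submodule.finrank_eq_zero]
  have := f.finrank_range_add_finrank_ker
  omega

theorem surjective_iff_le_finrank_range [FiniteDimensional ℂ U] (f : V →ₗ[ℂ] U) :
    Function.Surjective f ↔ Module.finrank ℂ U ≤ Module.finrank ℂ (LinearMap.range f) := by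
  rw [← LinearMap.range_eq_top]
  exact ⟨fun h => by rw [h, finrank_top], fun h =>
    Submodule.eq_top_of_finrank_eq (le_antisymm (Submodule.finrank_le _) h)⟩

end Rank

/-! ### Linear algebra of representations -/

section Rep

variable {I : Type*} [Quiver I] {W : I → Type*} [∀ i, AddCommGroup (W i)] [∀ i, Module ℂ (W i)]
  {v : I → ℕ}

instance : IsZariski (RepSpace W v) := ⟨rfl⟩

namespace RepSpace

/-- The point `(B, t, s)`. -/
def of (B : (i j : I) → (i ⟶ j) → (VSp v i →ₗ[ℂ] VSp v j)) (t : (i : I) → (VSp v i →ₗ[ℂ] W i))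
    (s : (i : I) → (W i →ₗ[ℂ] VSp v i)) : RepSpace W v := (B, t, s)

theorem ext {x y : RepSpace W v} (hB : ∀ (i j : I) (τ : i ⟶ j), x.B τ = y.B τ)
    (ht : ∀ i, x.t i = y.t i) (hs : ∀ i, x.s i = y.s i) : x = y :=
  Prod.ext (funext fun i => funext fun j => funext fun τ => hB i j τ)
    (Prod.ext (funext ht) (funext hs))

/-- The component `B τ` as a linear function of the point. -/
def linB {i j : I} (τ : i ⟶ j) : RepSpace W v →ₗ[ℂ] (VSp v i →ₗ[ℂ] VSp v j) where
  toFun x := x.B τ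
  map_add' _ _ := rfl
  map_smul' _ _ := rfl

/-- The component `t i` as a linear function of the point. -/
def linT (i : I) : RepSpace W v →ₗ[ℂ] (VSp v i →ₗ[ℂ] W i) where
  toFun x := x.t i
  map_add' _ _ := rfl
  map_smul' _ _ := rfl

/-- The component `s i` as a linear function of the point. -/
def linS (i : I) : RepSpace W v →ₗ[ℂ] (W i →ₗ[ℂ] VSp v i) where
  toFun x := x.s i
  map_add' _ _ := rfl
  map_smul' _ _ := rfl

theorem isRegular_of_components [Finite I] [∀ i j : I, Finite (i ⟶ j)] {E : Type*}
    [AddCommGroup E] [Module ℂ E] {S : Set E} {f : S → RepSpace W v}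
    (hB : ∀ (i j : I) (τ : i ⟶ j), IsRegular fun x => (f x).B τ)
    (ht : ∀ i, IsRegular fun x => (f x).t i) (hs : ∀ i, IsRegular fun x => (f x).s i) :
    IsRegular f :=
  (IsRegular.prodMk (IsRegular.pi fun i => IsRegular.pi fun j => IsRegular.pi fun τ => hB i j τ)
    (IsRegular.prodMk (IsRegular.pi ht) (IsRegular.pi hs)) :
      IsRegular (F := ((i j : I) → (i ⟶ j) → (VSp v i →ₗ[ℂ] VSp v j)) ×
        ((i : I) → (VSp v i →ₗ[ℂ] W i)) × ((i : I) → (W i →ₗ[ℂ] VSp v i))) f)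

theorem smul_B (g : GaugeGroup v) (x : RepSpace W v) {i j : I} (τ : i ⟶ j) :
    (g • x).B τ = (g j).toLinearMap ∘ₗ x.B τ ∘ₗ (g i).symm.toLinearMap := rfl

theorem smul_t (g : GaugeGroup v) (x : RepSpace W v) (i : I) :
    (g • x).t i = x.t i ∘ₗ (g i).symm.toLinearMap := rfl

theorem smul_s (g : GaugeGroup v) (x : RepSpace W v) (i : I) :
    (g • x).s i = (g i).toLinearMap ∘ₗ x.s i := rfl

end RepSpace

/-- A family of linear maps is a morphism from `x'` to `x` if it intertwines all components. -/
structure IsMor {v' : I → ℕ} (φ : (i : I) → (VSp v' i →ₗ[ℂ] VSp v i)) (x' : RepSpace W v')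
    (x : RepSpace W v) : Prop where
  B : ∀ (i j : I) (τ : i ⟶ j), φ j ∘ₗ x'.B τ = x.B τ ∘ₗ φ i
  t : ∀ i, x'.t i = x.t i ∘ₗ φ i
  s : ∀ i, φ i ∘ₗ x'.s i = x.s i

namespace IsMor

variable {v' v'' : I → ℕ} {φ : (i : I) → (VSp v' i →ₗ[ℂ] VSp v i)} {x' : RepSpace W v'}
  {x : RepSpace W v}

theorem B_apply (h : IsMor φ x' x) {i j : I} (τ : i ⟶ j) (u : VSp v' i) :
    φ j (x'.B τ u) = x.B τ (φ i u) := LinearMap.congr_fun (h.B i j τ) u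

theorem s_apply (h : IsMor φ x' x) (i : I) (w : W i) : φ i (x'.s i w) = x.s i w :=
  LinearMap.congr_fun (h.s i) w

theorem t_apply (h : IsMor φ x' x) (i : I) (u : VSp v' i) : x'.t i u = x.t i (φ i u) :=
  LinearMap.congr_fun (h.t i) u

theorem smul_right (h : IsMor φ x' x) (g : GaugeGroup v) :
    IsMor (fun i => (g i).toLinearMap ∘ₗ φ i) x' (g • x) where
  B i j τ := by
    refine LinearMap.ext fun u => ?_
    simp [RepSpace.smul_B, h.B_apply]
  t i := by
    refine LinearMap.ext fun u => ?_
    simp [RepSpace.smul_t, h.t_apply]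
  s i := by
    refine LinearMap.ext fun u => ?_
    simp [RepSpace.smul_s, h.s_apply]

theorem smul_left (h : IsMor φ x' x) (g : GaugeGroup v') :
    IsMor (fun i => φ i ∘ₗ (g i).symm.toLinearMap) (g • x') x where
  B i j τ := by
    refine LinearMap.ext fun u => ?_
    simp [RepSpace.smul_B, h.B_apply]
  t i := by
    refine LinearMap.ext fun u => ?_
    simp [RepSpace.smul_t, h.t_apply]
  s i := by
    refine LinearMap.ext fun u => ?_
    simp [RepSpace.smul_s, h.s_apply]

theorem isStable (h : IsMor φ x' x) (hφ : ∀ i, Function.Injective (φ i)) (hx : x.IsStable) :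
    x'.IsStable := by
  intro S hS hSt i
  have := hx (fun i => (S i).map (φ i)) ?_ ?_ i
  · exact Submodule.map_injective_of_injective (hφ i) (by rw [this, Submodule.map_bot])
  · rintro i j τ _ ⟨_, ⟨u, hu, rfl⟩, rfl⟩
    exact ⟨x'.B τ u, hS i j τ ⟨u, hu, rfl⟩, h.B_apply τ u⟩
  · rintro i _ ⟨u, hu, rfl⟩
    rw [LinearMap.mem_ker, ← h.t_apply]
    exact hSt i hu

theorem s_eq_zero_iff (h : IsMor φ x' x) (hφ : ∀ i, Function.Injective (φ i)) (i : I) :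
    x'.s i = 0 ↔ x.s i = 0 := by
  rw [← h.s i]
  refine ⟨fun h => by rw [h, LinearMap.comp_zero], fun h0 => ?_⟩
  refine LinearMap.ext fun w => ?_
  exact hφ i (by simpa using LinearMap.congr_fun h0 w)

theorem pathComp_apply (h : IsMor φ x' x) {i j : I} (p : Quiver.Path i j) (u : VSp v' i) :
    φ j (x'.pathComp p u) = x.pathComp p (φ i u) := by
  induction p with
  | nil => rfl
  | cons p τ ih => simp [RepSpace.pathComp, h.B_apply, ih]

theorem isNilpotent (h : IsMor φ x' x) (hφ : ∀ i, Function.Injective (φ i))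
    (hx : x.IsNilpotent) : x'.IsNilpotent := by
  obtain ⟨n, hn, h0⟩ := hx
  refine ⟨n, hn, fun i j p hp => ?_⟩
  refine LinearMap.ext fun u => ?_
  exact hφ j (by rw [h.pathComp_apply, h0 i j p hp]; simp)

end IsMor

theorem RepSpace.pathComp_comp (x : RepSpace W v) {i j k : I} (p : Quiver.Path i j)
    (p' : Quiver.Path j k) (u : VSp v i) :
    x.pathComp (p.comp p') u = x.pathComp p' (x.pathComp p u) := by
  induction p' with
  | nil => rfl
  | cons p' τ ih => simp [Quiver.Path.comp_cons, RepSpace.pathComp, ih]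

theorem exists_eq_toPath_comp {i j : I} (p : Quiver.Path i j) {n : ℕ} (hp : p.length = n + 1) :
    ∃ (k : I) (τ : i ⟶ k) (p' : Quiver.Path k j), p = τ.toPath.comp p' ∧ p'.length = n := by
  induction p generalizing n with
  | nil => simp at hp
  | @cons a b p τ ih =>
    rw [Quiver.Path.length_cons] at hp
    obtain _ | m := n
    · have h0 : p.length = 0 := by omega
      obtain rfl := Quiver.Path.eq_of_length_zero p h0
      obtain rfl := Quiver.Path.eq_nil_of_length_zero p h0
      exact ⟨_, τ, .nil, rfl, rfl⟩
    · obtain ⟨k, σ, p', rfl, hp'⟩ := ih (n := m) (by omega)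
      exact ⟨k, σ, p'.cons τ, rfl, by rw [Quiver.Path.length_cons, hp']⟩

/-- An extension of a nilpotent representation by one on which all arrows vanish is nilpotent. -/
theorem IsMor.isNilpotent_of_range {v' : I → ℕ} {φ : (i : I) → (VSp v' i →ₗ[ℂ] VSp v i)}
    {x' : RepSpace W v'} {x : RepSpace W v} (h : IsMor φ x' x)
    (hr : ∀ (i j : I) (τ : i ⟶ j) (u : VSp v i), x.B τ u ∈ LinearMap.range (φ j))
    (hx : x'.IsNilpotent) : x.IsNilpotent := by
  obtain ⟨n, hn, h0⟩ := hx
  refine ⟨n + 1, by omega, fun i j p hp => ?_⟩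
  obtain ⟨k, τ, p', rfl, hp'⟩ := exists_eq_toPath_comp p hp
  refine LinearMap.ext fun u => ?_
  rw [RepSpace.pathComp_comp]
  obtain ⟨y, hy⟩ := hr i k τ u
  change x.pathComp p' (x.B τ u) = 0
  rw [← hy, ← h.pathComp_apply, h0 k j p' hp']
  simp

end Rep

section Moment

variable {I : Type*} [Fintype I] [Quiver I] [Quiver.HasInvolutiveReverse I]
  [∀ i j : I, Fintype (i ⟶ j)] (sgn : (i j : I) → (i ⟶ j) → ℂˣ)
  (W : I → Type*) [∀ i, AddCommGroup (W i)] [∀ i, Module ℂ (W i)] (v : I → ℕ)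

/-- The space `(⨁_{out τ = j} V_{in τ}) ⊕ W_j`. -/
abbrev OutSp (j : I) : Type _ := ((p : Σ k : I, (j ⟶ k)) → VSp v p.1) × W j

theorem finrank_outSp [∀ i, FiniteDimensional ℂ (W i)] (j : I) :
    Module.finrank ℂ (OutSp W v j) =
      ∑ k, Fintype.card (j ⟶ k) * v k + Module.finrank ℂ (W j) := by
  rw [Module.finrank_prod, Module.finrank_pi_fintype]
  simp only [Module.finrank_fin_fun]
  rw [Fintype.sum_sigma]
  simp

variable {W v}

/-- The map `(B_τ, t_j) : V_j → (⨁_{out τ = j} V_{in τ}) ⊕ W_j`. -/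
def outMap (x : RepSpace W v) (j : I) : VSp v j →ₗ[ℂ] OutSp W v j :=
  LinearMap.prod (LinearMap.pi fun p => x.B p.2) (x.t j)

/-- The map `(ε(τ) B_{τ̄}, s_j) : (⨁_{out τ = j} V_{in τ}) ⊕ W_j → V_j`. -/
def retMap (x : RepSpace W v) (j : I) : OutSp W v j →ₗ[ℂ] VSp v j :=
  (∑ p : Σ k : I, (j ⟶ k), (sgn j p.1 p.2 : ℂ) • (x.B (Quiver.reverse p.2) ∘ₗ LinearMap.proj p))
    ∘ₗ LinearMap.fst ℂ _ _ + x.s j ∘ₗ LinearMap.snd ℂ _ _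

theorem retMap_apply (x : RepSpace W v) (j : I) (u : OutSp W v j) :
    retMap sgn x j u = ∑ p : Σ k : I, (j ⟶ k),
      (sgn j p.1 p.2 : ℂ) • x.B (Quiver.reverse p.2) (u.1 p) + x.s j u.2 := by
  simp [retMap]

theorem inMap_apply (x : RepSpace W v) (j : I)
    (u : ((p : Σ k : I, (k ⟶ j)) → VSp v p.1) × W j) :
    x.inMap j u = ∑ p : Σ k : I, (k ⟶ j), x.B p.2 (u.1 p) + x.s j u.2 := by
  simp [RepSpace.inMap]

theorem moment_eq_retMap_comp_outMap (x : RepSpace W v) (j : I) :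
    x.moment sgn j = retMap sgn x j ∘ₗ outMap x j := by
  refine LinearMap.ext fun u => ?_
  rw [LinearMap.comp_apply, retMap_apply, Fintype.sum_sigma]
  simp [RepSpace.moment, outMap]

theorem B_mem_range_inMap (x : RepSpace W v) {k j : I} (τ : k ⟶ j) (u : VSp v k) :
    x.B τ u ∈ LinearMap.range (x.inMap j) := by
  classical
  refine ⟨(Pi.single ⟨k, τ⟩ u, 0), ?_⟩
  rw [inMap_apply, Finset.sum_eq_single ⟨k, τ⟩]
  · simp
  · intro p _ hp
    simp [Pi.single, Function.update_of_ne hp]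
  · simp

theorem s_mem_range_inMap (x : RepSpace W v) (j : I) (w : W j) :
    x.s j w ∈ LinearMap.range (x.inMap j) :=
  ⟨(0, w), by rw [inMap_apply]; simp⟩

theorem range_inMap_le_iff (x : RepSpace W v) (j : I) (M : Submodule ℂ (VSp v j)) :
    LinearMap.range (x.inMap j) ≤ M ↔
      (∀ (k : I) (τ : k ⟶ j) (u : VSp v k), x.B τ u ∈ M) ∧ ∀ w, x.s j w ∈ M := by
  refine ⟨fun h => ⟨fun k τ u => h (B_mem_range_inMap x τ u), fun w => h (s_mem_range_inMap x j w)⟩,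
    ?_⟩
  rintro ⟨h1, h2⟩ _ ⟨u, rfl⟩
  rw [inMap_apply]
  exact M.add_mem (M.sum_mem fun p _ => h1 _ _ _) (h2 _)

theorem range_retMap (x : RepSpace W v) (j : I) :
    LinearMap.range (retMap sgn x j) = LinearMap.range (x.inMap j) := by
  classical
  apply le_antisymm
  · rintro _ ⟨u, rfl⟩
    rw [retMap_apply]
    exact add_mem (sum_mem fun p _ => Submodule.smul_mem _ _ (B_mem_range_inMap x _ _))
      (s_mem_range_inMap x j _)
  · rw [range_inMap_le_iff]
    refine ⟨fun k τ u => ?_, fun w => ⟨(0, w), by rw [retMap_apply]; simp⟩⟩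
    have h : x.B τ u = retMap sgn x j (Pi.single ⟨k, Quiver.reverse τ⟩
        ((sgn j k (Quiver.reverse τ) : ℂ)⁻¹ • u), 0) := by
      rw [retMap_apply, Finset.sum_eq_single ⟨k, Quiver.reverse τ⟩]
      · simp [Quiver.reverse_reverse]
      · intro p _ hp
        simp [Pi.single, Function.update_of_ne hp]
      · simp
    exact ⟨_, h.symm⟩

theorem eps_add_finrank_range_inMap (x : RepSpace W v) (j : I) :
    x.eps j + Module.finrank ℂ (LinearMap.range (x.inMap j)) = v j := by
  rw [RepSpace.eps, Submodule.finrank_quotient_add_finrank, Module.finrank_fin_fun]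

/-- The kernel of `(B_τ, t_j)`, placed at the vertex `j`, is a `B`-invariant family in the kernel
of `t`, so it vanishes at stable points. -/
theorem outMap_injective {x : RepSpace W v} (hx : x.IsStable) (j : I) :
    Function.Injective (outMap x j) := by
  classical
  rw [← LinearMap.ker_eq_bot]
  have h := hx (Pi.single j (LinearMap.ker (outMap x j))) ?_ ?_ j
  · simpa using h
  · rintro i k τ
    by_cases hi : i = j
    · subst hi
      rw [Pi.single_eq_same]
      rintro _ ⟨u, hu, rfl⟩
      have : x.B τ u = 0 := congrFun (congrArg Prod.fst hu) ⟨k, τ⟩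
      rw [this]
      exact zero_mem _
    · rw [Pi.single_eq_of_ne hi]; simp
  · intro i
    by_cases hi : i = j
    · subst hi
      rw [Pi.single_eq_same]
      intro u hu
      exact congrArg Prod.snd hu
    · rw [Pi.single_eq_of_ne hi]; exact bot_le

/-- An extension of a stable point is stable if the outgoing maps are injective. -/
theorem IsMor.isStable_of_range {v' : I → ℕ} {φ : (i : I) → (VSp v' i →ₗ[ℂ] VSp v i)}
    {x' : RepSpace W v'} {x : RepSpace W v} (h : IsMor φ x' x)
    (hr : ∀ (i j : I) (τ : i ⟶ j) (u : VSp v i), x.B τ u ∈ LinearMap.range (φ j))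
    (ho : ∀ j, Function.Injective (outMap x j)) (hx : x'.IsStable) : x.IsStable := by
  intro S hS hSt i
  have h0 := hx (fun i => (S i).comap (φ i)) (by
    rintro i j τ _ ⟨u, hu, rfl⟩
    rw [Submodule.mem_comap, h.B_apply]
    exact hS i j τ ⟨_, hu, rfl⟩) (by
    intro i u hu
    rw [LinearMap.mem_ker, h.t_apply]
    exact hSt i hu)
  rw [eq_bot_iff]
  intro u hu
  refine ho i ?_
  rw [map_zero]
  refine Prod.ext (funext fun p => ?_) (hSt i hu)
  obtain ⟨y, hy⟩ := hr i p.1 p.2 u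
  have hy0 : y ∈ (S p.1).comap (φ p.1) := by
    rw [Submodule.mem_comap, hy]
    exact hS i p.1 p.2 ⟨u, hu, rfl⟩
  rw [h0, Submodule.mem_bot] at hy0
  change x.B p.2 u = 0
  rw [← hy, hy0, map_zero]

theorem IsMor.moment_apply {v' : I → ℕ} {φ : (i : I) → (VSp v' i →ₗ[ℂ] VSp v i)}
    {x' : RepSpace W v'} {x : RepSpace W v} (h : IsMor φ x' x) (i : I) (u : VSp v' i) :
    φ i (x'.moment sgn i u) = x.moment sgn i (φ i u) := by
  simp [RepSpace.moment, h.B_apply, h.s_apply, h.t_apply]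

theorem IsMor.moment_eq_zero {v' : I → ℕ} {φ : (i : I) → (VSp v' i →ₗ[ℂ] VSp v i)}
    {x' : RepSpace W v'} {x : RepSpace W v} (h : IsMor φ x' x)
    (hφ : ∀ i, Function.Injective (φ i)) {i : I} (hx : x.moment sgn i = 0) :
    x'.moment sgn i = 0 := by
  refine LinearMap.ext fun u => ?_
  exact hφ i (by rw [h.moment_apply, hx]; simp)

/-- If the incoming maps at all vertices are surjective and `B` is nilpotent, then `V = 0`. -/
theorem eq_zero_of_isNilpotent {x : RepSpace W v} (hx : x.IsNilpotent) (hs : ∀ i, x.s i = 0)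
    (he : ∀ i, x.eps i = 0) : v = 0 := by
  obtain ⟨n, -, h0⟩ := hx
  have htop : ∀ j, LinearMap.range (x.inMap j) = ⊤ := fun j => by
    apply Submodule.eq_top_of_finrank_eq
    have := eps_add_finrank_range_inMap x j
    rw [he, zero_add] at this
    rw [this, Module.finrank_fin_fun]
  -- Since `s = 0`, compositions along paths of length `n` have images spanning `V_j`.
  have key : ∀ (n : ℕ) (j : I) (M : Submodule ℂ (VSp v j)),
      (∀ (i : I) (p : Quiver.Path i j), p.length = n → ∀ u, x.pathComp p u ∈ M) → M = ⊤ := by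
    intro n
    induction n with
    | zero =>
      intro j M hM
      exact eq_top_iff.2 fun u _ => hM j .nil rfl u
    | succ n ih =>
      intro j M hM
      rw [← top_le_iff, ← htop j, range_inMap_le_iff]
      refine ⟨fun k τ u => ?_, fun w => by rw [hs]; simp⟩
      have hk := ih k (M.comap (x.B τ)) fun i p hp u => hM i (p.cons τ) (by
        rw [Quiver.Path.length_cons, hp]) u
      have hu : u ∈ (⊤ : Submodule ℂ (VSp v k)) := trivial
      rw [← hk] at hu
      exact hu
  funext j
  have hj := key n j ⊥ fun i p hp u => by rw [h0 i j p hp]; simp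
  have h1 : Module.finrank ℂ (VSp v j) = 0 := by
    rw [← finrank_top ℂ (VSp v j), ← hj, finrank_bot]
  rwa [Module.finrank_fin_fun] at h1

end Moment

/-! ### Extensions of representations -/

section Split

variable {I : Type*} (v' d : I → ℕ) (j : I)

/-- The standard decomposition `V_j = V'_j ⊕ C_j` for a sum of dimension vectors. -/
def splitEquiv : VSp (v' + d) j ≃ₗ[ℂ] VSp v' j × VSp d j :=
  (LinearEquiv.funCongrLeft ℂ ℂ (finSumFinEquiv (m := v' j) (n := d j))).trans
    (LinearEquiv.sumArrowLequivProdArrow (Fin (v' j)) (Fin (d j)) ℂ ℂ)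

/-- The inclusion `V'_j → V_j`. -/
def incl : VSp v' j →ₗ[ℂ] VSp (v' + d) j :=
  (splitEquiv v' d j).symm.toLinearMap ∘ₗ LinearMap.inl ℂ _ _

/-- The inclusion `C_j → V_j`. -/
def incr : VSp d j →ₗ[ℂ] VSp (v' + d) j :=
  (splitEquiv v' d j).symm.toLinearMap ∘ₗ LinearMap.inr ℂ _ _

/-- The projection `V_j → V'_j`. -/
def prl : VSp (v' + d) j →ₗ[ℂ] VSp v' j :=
  LinearMap.fst ℂ _ _ ∘ₗ (splitEquiv v' d j).toLinearMap

/-- The projection `V_j → C_j`. -/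
def prr : VSp (v' + d) j →ₗ[ℂ] VSp d j :=
  LinearMap.snd ℂ _ _ ∘ₗ (splitEquiv v' d j).toLinearMap

variable {v' d j}

@[simp] theorem prl_incl (u : VSp v' j) : prl v' d j (incl v' d j u) = u := by simp [prl, incl]
@[simp] theorem prr_incl (u : VSp v' j) : prr v' d j (incl v' d j u) = 0 := by simp [prr, incl]
@[simp] theorem prl_incr (u : VSp d j) : prl v' d j (incr v' d j u) = 0 := by simp [prl, incr]
@[simp] theorem prr_incr (u : VSp d j) : prr v' d j (incr v' d j u) = u := by simp [prr, incr]

theorem incl_prl_add_incr_prr (u : VSp (v' + d) j) :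
    incl v' d j (prl v' d j u) + incr v' d j (prr v' d j u) = u := by
  apply (splitEquiv v' d j).injective
  simp [prl, prr, incl, incr]

theorem split_ext {u w : VSp (v' + d) j} (h1 : prl v' d j u = prl v' d j w)
    (h2 : prr v' d j u = prr v' d j w) : u = w := by
  rw [← incl_prl_add_incr_prr u, h1, h2, incl_prl_add_incr_prr]

/-- The embedding of `V'_j` into `V_j` as the graph of a linear map `V'_j → C_j`. -/
def graphEmb (n : (j : I) → VSp v' j →ₗ[ℂ] VSp d j) (j : I) : VSp v' j →ₗ[ℂ] VSp (v' + d) j :=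
  incl v' d j + incr v' d j ∘ₗ n j

/-- The linear map `V_j → C_j` whose kernel is the graph of a linear map `V'_j → C_j`. -/
def graphQuot (n : (j : I) → VSp v' j →ₗ[ℂ] VSp d j) (j : I) : VSp (v' + d) j →ₗ[ℂ] VSp d j :=
  prr v' d j - n j ∘ₗ prl v' d j

variable (n : (j : I) → VSp v' j →ₗ[ℂ] VSp d j)

@[simp] theorem prl_graphEmb (u : VSp v' j) : prl v' d j (graphEmb n j u) = u := by
  simp [graphEmb]

@[simp] theorem prr_graphEmb (u : VSp v' j) : prr v' d j (graphEmb n j u) = n j u := by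
  simp [graphEmb]

@[simp] theorem graphQuot_graphEmb (u : VSp v' j) : graphQuot n j (graphEmb n j u) = 0 := by
  simp [graphQuot]

@[simp] theorem graphQuot_incr (u : VSp d j) : graphQuot n j (incr v' d j u) = u := by
  simp [graphQuot]

theorem graphEmb_injective (j : I) : Function.Injective (graphEmb n j) :=
  Function.LeftInverse.injective (g := prl v' d j) fun u => prl_graphEmb n u

theorem graphEmb_prl {u : VSp (v' + d) j} (h : graphQuot n j u = 0) :
    graphEmb n j (prl v' d j u) = u := by
  apply split_ext
  · simp
  · rw [prr_graphEmb]
    exact (sub_eq_zero.1 h).symm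

theorem graphEmb_prl_add (u : VSp (v' + d) j) :
    graphEmb n j (prl v' d j u) + incr v' d j (graphQuot n j u) = u := by
  apply split_ext <;> simp [graphQuot]

end Split

section Glue

variable {I : Type*} [Fintype I] [Quiver I] [Quiver.HasInvolutiveReverse I]
  [∀ i j : I, Fintype (i ⟶ j)] (sgn : (i j : I) → (i ⟶ j) → ℂˣ)
  (W : I → Type*) [∀ i, AddCommGroup (W i)] [∀ i, Module ℂ (W i)] (v' d : I → ℕ)

/-- The outgoing components of an extension on the complement `C` of `V'`. -/
abbrev ExtSp : Type _ := (j : I) → (VSp d j →ₗ[ℂ] OutSp W v' j)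

variable {W v' d}

/-- The map induced on `(⨁_{out τ = j} V_{in τ}) ⊕ W_j`. -/
def outSpMap {v : I → ℕ} (φ : (i : I) → (VSp v' i →ₗ[ℂ] VSp v i)) (j : I) :
    OutSp W v' j →ₗ[ℂ] OutSp W v j :=
  LinearMap.prodMap (LinearMap.pi fun p => φ p.1 ∘ₗ LinearMap.proj p) LinearMap.id

theorem outSpMap_apply {v : I → ℕ} (φ : (i : I) → (VSp v' i →ₗ[ℂ] VSp v i)) (j : I)
    (y : OutSp W v' j) : outSpMap φ j y = (fun p => φ p.1 (y.1 p), y.2) := rfl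

theorem outSpMap_injective {v : I → ℕ} {φ : (i : I) → (VSp v' i →ₗ[ℂ] VSp v i)}
    (hφ : ∀ i, Function.Injective (φ i)) (j : I) :
    Function.Injective (outSpMap (W := W) φ j) := by
  intro y z h
  rw [outSpMap_apply, outSpMap_apply, Prod.mk.injEq] at h
  exact Prod.ext (funext fun p => hφ _ (congrFun h.1 p)) h.2

theorem IsMor.retMap_apply {v : I → ℕ} {φ : (i : I) → (VSp v' i →ₗ[ℂ] VSp v i)}
    {x' : RepSpace W v'} {x : RepSpace W v} (h : IsMor φ x' x) (j : I) (y : OutSp W v' j) :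
    φ j (retMap sgn x' j y) = retMap sgn x j (outSpMap φ j y) := by
  rw [QuiverCrystal.retMap_apply, QuiverCrystal.retMap_apply, outSpMap_apply]
  simp [h.B_apply, h.s_apply]

/-- The map `V_j → (⨁_{out τ = j} V'_{in τ}) ⊕ W_j` which is `(B'_τ, t'_j)` on the graph of `n`
and `f` on `C_j`. -/
def glueOut (x' : RepSpace W v') (n : (j : I) → VSp v' j →ₗ[ℂ] VSp d j) (f : ExtSp W v' d) (j : I) :
    VSp (v' + d) j →ₗ[ℂ] OutSp W v' j :=
  outMap x' j ∘ₗ prl v' d j + f j ∘ₗ graphQuot n j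

/-- The extension of `x'` on `V' ⊕ C` in which `x'` is embedded as the graph of `n` and the
outgoing components on `C` are given by `f`. -/
def glue (x' : RepSpace W v') (n : (j : I) → VSp v' j →ₗ[ℂ] VSp d j) (f : ExtSp W v' d) :
    RepSpace W (v' + d) :=
  .of (fun i j τ => graphEmb n j ∘ₗ LinearMap.proj (⟨j, τ⟩ : Σ k : I, (i ⟶ k)) ∘ₗ
      LinearMap.fst ℂ _ _ ∘ₗ glueOut x' n f i)
    (fun i => LinearMap.snd ℂ _ _ ∘ₗ glueOut x' n f i) (fun i => graphEmb n i ∘ₗ x'.s i)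

/-- The restriction of `x` to the graph of `n`, identified with `V'`. -/
def res (n : (j : I) → VSp v' j →ₗ[ℂ] VSp d j) (x : RepSpace W (v' + d)) : RepSpace W v' :=
  .of (fun i j τ => prl v' d j ∘ₗ x.B τ ∘ₗ graphEmb n i) (fun i => x.t i ∘ₗ graphEmb n i)
    (fun i => prl v' d i ∘ₗ x.s i)

/-- The outgoing components of `x` on `C`. -/
def extPart (x : RepSpace W (v' + d)) : ExtSp W v' d := fun j =>
  LinearMap.prod (LinearMap.pi fun p => prl v' d p.1 ∘ₗ x.B p.2 ∘ₗ incr v' d j)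
    (x.t j ∘ₗ incr v' d j)

/-- All incoming maps of `x` have their images in the graph of `n`. -/
structure IsAdapted (n : (j : I) → VSp v' j →ₗ[ℂ] VSp d j) (x : RepSpace W (v' + d)) : Prop where
  B : ∀ (i j : I) (τ : i ⟶ j) (u : VSp (v' + d) i), graphQuot n j (x.B τ u) = 0
  s : ∀ (i : I) (w : W i), graphQuot n i (x.s i w) = 0

variable {n : (j : I) → VSp v' j →ₗ[ℂ] VSp d j}

theorem IsAdapted.isMor {x : RepSpace W (v' + d)} (h : IsAdapted n x) :
    IsMor (graphEmb n) (res n x) x where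
  B i j τ := LinearMap.ext fun _ => graphEmb_prl n (h.B i j τ _)
  t _ := rfl
  s i := LinearMap.ext fun w => graphEmb_prl n (h.s i w)

theorem IsAdapted.glue_res {x : RepSpace W (v' + d)} (h : IsAdapted n x) :
    glue (res n x) n (extPart x) = x := by
  refine RepSpace.ext (fun i j τ => LinearMap.ext fun u => ?_) (fun i => LinearMap.ext fun u => ?_)
    (fun i => LinearMap.ext fun w => graphEmb_prl n (h.s i w))
  · have h1 : x.B τ u = x.B τ (graphEmb n i (prl v' d i u)) +
        x.B τ (incr v' d i (graphQuot n i u)) := by rw [← map_add, graphEmb_prl_add]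
    rw [h1]
    have h2 := graphEmb_prl n (h.B i j τ (graphEmb n i (prl v' d i u)))
    have h3 := graphEmb_prl n (h.B i j τ (incr v' d i (graphQuot n i u)))
    rw [← h2, ← h3, ← map_add]
    rfl
  · have h1 : x.t i u = x.t i (graphEmb n i (prl v' d i u)) +
        x.t i (incr v' d i (graphQuot n i u)) := by rw [← map_add, graphEmb_prl_add]
    rw [h1]
    rfl

variable (x' : RepSpace W v') (n) (f : ExtSp W v' d)

theorem glue_B_apply {i j : I} (τ : i ⟶ j) (u : VSp (v' + d) i) :
    (glue x' n f).B τ u = graphEmb n j ((glueOut x' n f i u).1 ⟨j, τ⟩) := rfl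

theorem glue_t_apply (i : I) (u : VSp (v' + d) i) :
    (glue x' n f).t i u = (glueOut x' n f i u).2 := rfl

theorem glue_s_apply (i : I) (w : W i) : (glue x' n f).s i w = graphEmb n i (x'.s i w) := rfl

theorem glueOut_graphEmb (j : I) (u : VSp v' j) :
    glueOut x' n f j (graphEmb n j u) = outMap x' j u := by
  simp [glueOut]

theorem glueOut_incr (j : I) (u : VSp d j) : glueOut x' n f j (incr v' d j u) = f j u := by
  simp [glueOut]

theorem glue_isMor : IsMor (graphEmb n) x' (glue x' n f) where
  B i j τ := LinearMap.ext fun u => by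
    rw [LinearMap.comp_apply, LinearMap.comp_apply, glue_B_apply, glueOut_graphEmb]
    rfl
  t i := LinearMap.ext fun u => by
    rw [LinearMap.comp_apply, glue_t_apply, glueOut_graphEmb]
    rfl
  s i := rfl

theorem res_glue : res n (glue x' n f) = x' := by
  refine RepSpace.ext (fun i j τ => LinearMap.ext fun u => ?_) (fun i => LinearMap.ext fun u => ?_)
    (fun i => LinearMap.ext fun w => ?_)
  · change prl v' d j ((glue x' n f).B τ (graphEmb n i u)) = _
    rw [glue_B_apply, glueOut_graphEmb, prl_graphEmb]
    rfl
  · change (glue x' n f).t i (graphEmb n i u) = _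
    rw [glue_t_apply, glueOut_graphEmb]
    rfl
  · change prl v' d i ((glue x' n f).s i w) = _
    rw [glue_s_apply, prl_graphEmb]

theorem extPart_glue : extPart (glue x' n f) = f := by
  refine funext fun j => LinearMap.ext fun u => Prod.ext (funext fun p => ?_) ?_
  · change prl v' d p.1 ((glue x' n f).B p.2 (incr v' d j u)) = _
    rw [glue_B_apply, glueOut_incr, prl_graphEmb]
  · change (glue x' n f).t j (incr v' d j u) = _
    rw [glue_t_apply, glueOut_incr]

theorem outMap_glue (j : I) (u : VSp (v' + d) j) :
    outMap (glue x' n f) j u = outSpMap (graphEmb n) j (glueOut x' n f j u) := rfl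

variable {x' f}

theorem moment_glue {j : I} (hm : x'.moment sgn j = 0) (hf : ∀ u, retMap sgn x' j (f j u) = 0) :
    (glue x' n f).moment sgn j = 0 := by
  rw [moment_eq_retMap_comp_outMap] at hm
  rw [moment_eq_retMap_comp_outMap]
  refine LinearMap.ext fun u => ?_
  rw [LinearMap.comp_apply, outMap_glue, ← (glue_isMor n x' f).retMap_apply]
  have h : retMap sgn x' j (glueOut x' n f j u) = 0 := by
    have h1 := LinearMap.congr_fun hm (prl v' d j u)
    simp only [LinearMap.comp_apply, LinearMap.zero_apply] at h1
    simp [glueOut, h1, hf]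
  rw [h, map_zero]
  rfl

theorem retMap_extPart {x : RepSpace W (v' + d)} (h : IsAdapted n x) {j : I}
    (hm : x.moment sgn j = 0) (u : VSp d j) : retMap sgn (res n x) j (extPart x j u) = 0 := by
  apply graphEmb_injective n j
  rw [h.isMor.retMap_apply, map_zero]
  have h1 : outSpMap (graphEmb n) j (extPart x j u) = outMap x j (incr v' d j u) :=
    Prod.ext (funext fun p => graphEmb_prl n (h.B _ _ _ _)) rfl
  rw [h1]
  rw [moment_eq_retMap_comp_outMap] at hm
  exact LinearMap.congr_fun hm _

/-- A sufficiently large kernel allows to extend an injective map into it injectively. -/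
theorem exists_injective_coprod {V C K : Type*} [AddCommGroup V] [Module ℂ V] [AddCommGroup C]
    [Module ℂ C] [AddCommGroup K] [Module ℂ K] [FiniteDimensional ℂ V] [FiniteDimensional ℂ C]
    [FiniteDimensional ℂ K] {a : V →ₗ[ℂ] K} (ha : Function.Injective a)
    (h : Module.finrank ℂ V + Module.finrank ℂ C ≤ Module.finrank ℂ K) :
    ∃ f : C →ₗ[ℂ] K, Function.Injective (a.coprod f) := by
  obtain ⟨N, hN⟩ := (LinearMap.range a).exists_isCompl
  have h1 := Submodule.finrank_add_eq_of_isCompl hN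
  rw [LinearMap.finrank_range_of_inj ha] at h1
  obtain ⟨g, hg⟩ := (finrank_le_iff_exists_linearMap (R := ℂ) (M := C) (M' := N)).1 (by omega)
  have hg' : Function.Injective (N.subtype ∘ₗ g) := Subtype.val_injective.comp hg
  refine ⟨N.subtype ∘ₗ g, ?_⟩
  rw [← LinearMap.ker_eq_bot, LinearMap.ker_coprod_of_disjoint_range]
  · rw [LinearMap.ker_eq_bot.2 ha, LinearMap.ker_eq_bot.2 hg']
    simp
  · refine hN.disjoint.mono_right ?_
    rintro _ ⟨y, rfl⟩
    exact (g y).2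

/-- The extension problem at a vertex is solvable if the kernel of the map `(ε(τ) B_{τ̄}, s_j)` is
large enough. -/
theorem exists_extension [∀ i, FiniteDimensional ℂ (W i)] {j : I} (hm : x'.moment sgn j = 0)
    (hx : x'.IsStable)
    (h : v' j + d j ≤ Module.finrank ℂ (LinearMap.ker (retMap sgn x' j))) :
    ∃ g : VSp d j →ₗ[ℂ] OutSp W v' j, (∀ u, retMap sgn x' j (g u) = 0) ∧
      Function.Injective
        (outMap x' j ∘ₗ prl v' d j + g ∘ₗ prr v' d j : VSp (v' + d) j →ₗ[ℂ] OutSp W v' j) := by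
  have hk : ∀ u, outMap x' j u ∈ LinearMap.ker (retMap sgn x' j) := fun u => by
    rw [moment_eq_retMap_comp_outMap] at hm
    exact LinearMap.congr_fun hm u
  obtain ⟨g, hg⟩ := exists_injective_coprod (C := VSp d j) (a := (outMap x' j).codRestrict _ hk)
    (fun a b hab => outMap_injective hx j (congrArg Subtype.val hab))
    (by rwa [Module.finrank_fin_fun, Module.finrank_fin_fun])
  refine ⟨(LinearMap.ker (retMap sgn x' j)).subtype ∘ₗ g, fun u => (g u).2, fun a b hab => ?_⟩
  have h1 : (prl v' d j a, prr v' d j a) = (prl v' d j b, prr v' d j b) := hg (Subtype.ext hab)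
  exact split_ext (congrArg Prod.fst h1) (congrArg Prod.snd h1)

/-- A morphism which is bijective at the sources of the arrows into `i` maps the image of the
incoming map at `i` onto the image of the incoming map. -/
theorem IsMor.map_range_inMap {v : I → ℕ} {φ : (i : I) → (VSp v' i →ₗ[ℂ] VSp v i)}
    {x' : RepSpace W v'} {x : RepSpace W v} (h : IsMor φ x' x) {i : I} [IsEmpty (i ⟶ i)]
    (hs : ∀ k, k ≠ i → Function.Surjective (φ k)) :
    (LinearMap.range (x'.inMap i)).map (φ i) = LinearMap.range (x.inMap i) := by
  apply le_antisymm
  · rw [Submodule.map_le_iff_le_comap, range_inMap_le_iff]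
    refine ⟨fun k τ u => ?_, fun w => ?_⟩
    · rw [Submodule.mem_comap, h.B_apply]
      exact B_mem_range_inMap x τ _
    · rw [Submodule.mem_comap, h.s_apply]
      exact s_mem_range_inMap x i w
  · rw [range_inMap_le_iff]
    refine ⟨fun k τ u => ?_, fun w => ⟨_, s_mem_range_inMap x' i w, h.s_apply i w⟩⟩
    have hk : k ≠ i := by rintro rfl; exact isEmptyElim τ
    obtain ⟨y, rfl⟩ := hs k hk u
    exact ⟨_, B_mem_range_inMap x' τ y, h.B_apply τ y⟩

theorem IsMor.eps_add {v : I → ℕ} {φ : (i : I) → (VSp v' i →ₗ[ℂ] VSp v i)}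
    {x' : RepSpace W v'} {x : RepSpace W v} (h : IsMor φ x' x)
    (hφ : ∀ i, Function.Injective (φ i)) {i : I} [IsEmpty (i ⟶ i)]
    (hs : ∀ k, k ≠ i → Function.Surjective (φ k)) : x.eps i + v' i = x'.eps i + v i := by
  have h1 := eps_add_finrank_range_inMap x i
  have h2 := eps_add_finrank_range_inMap x' i
  rw [← h.map_range_inMap hs,
    (Submodule.equivMapOfInjective _ (hφ i) _).finrank_eq.symm] at h1
  omega

theorem surjective_of_injective_of_eq {v : I → ℕ} {k : I} {g : VSp v' k →ₗ[ℂ] VSp v k}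
    (hg : Function.Injective g) (hv : v' k = v k) : Function.Surjective g :=
  (LinearMap.injective_iff_surjective_of_finrank_eq_finrank (by simp [hv])).1 hg

/-- Two subrepresentations of the same point with equal images are isomorphic. -/
theorem IsMor.exists_smul_eq {v : I → ℕ} {φ₁ φ₂ : (i : I) → (VSp v' i →ₗ[ℂ] VSp v i)}
    {x₁ x₂ : RepSpace W v'} {x : RepSpace W v} (h₁ : IsMor φ₁ x₁ x) (h₂ : IsMor φ₂ x₂ x)
    (hφ₁ : ∀ i, Function.Injective (φ₁ i)) (hφ₂ : ∀ i, Function.Injective (φ₂ i))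
    (hr : ∀ i, LinearMap.range (φ₁ i) = LinearMap.range (φ₂ i)) :
    ∃ g : GaugeGroup v', g • x₁ = x₂ := by
  let g : GaugeGroup v' := fun i => (LinearEquiv.ofInjective (φ₁ i) (hφ₁ i)).trans
    ((LinearEquiv.ofEq _ _ (hr i)).trans (LinearEquiv.ofInjective (φ₂ i) (hφ₂ i)).symm)
  have hg : ∀ i u, φ₂ i (g i u) = φ₁ i u := fun i u => by
    have := congrArg Subtype.val ((LinearEquiv.ofInjective (φ₂ i) (hφ₂ i)).apply_symm_apply
      ((LinearEquiv.ofEq _ _ (hr i)) (LinearEquiv.ofInjective (φ₁ i) (hφ₁ i) u)))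
    exact this
  have hg' : ∀ i u, φ₁ i ((g i).symm u) = φ₂ i u := fun i u => by
    rw [← hg, LinearEquiv.apply_symm_apply]
  refine ⟨g, RepSpace.ext (fun i j τ => LinearMap.ext fun u => ?_)
    (fun i => LinearMap.ext fun u => ?_)
    (fun i => LinearMap.ext fun w => ?_)⟩
  · apply hφ₂ j
    change φ₂ j (g j (x₁.B τ ((g i).symm u))) = _
    rw [hg, h₁.B_apply, hg', h₂.B_apply]
  · change x₁.t i ((g i).symm u) = _
    rw [h₁.t_apply, hg', h₂.t_apply]
  · apply hφ₂ i
    change φ₂ i (g i (x₁.s i w)) = _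
    rw [hg, h₁.s_apply, h₂.s_apply]

end Glue

/-! ### The Lagrangian subvariety and its lift to the representation space -/

section Lag

variable {I : Type*} [Fintype I] [Quiver I] [Quiver.HasInvolutiveReverse I]
  [∀ i j : I, Fintype (i ⟶ j)] (sgn : (i j : I) → (i ⟶ j) → ℂˣ)
  (W : I → Type*) [∀ i, AddCommGroup (W i)] [∀ i, Module ℂ (W i)] (v : I → ℕ)

/-- The stable points `(B, t, 0)` of `μ⁻¹(0)` with `B` nilpotent. -/
def lagSet : Set (RepSpace W v) :=
  {x | ((∀ i, x.moment sgn i = 0) ∧ x.IsStable) ∧ (∀ i, x.s i = 0) ∧ x.IsNilpotent}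

variable {sgn W v}

theorem mem_lagSet_of_isMor {v' : I → ℕ} {φ : (i : I) → (VSp v' i →ₗ[ℂ] VSp v i)}
    {x' : RepSpace W v'} {x : RepSpace W v} (h : IsMor φ x' x)
    (hφ : ∀ i, Function.Injective (φ i)) (hx : x ∈ lagSet sgn W v) : x' ∈ lagSet sgn W v' :=
  ⟨⟨fun i => h.moment_eq_zero sgn hφ (hx.1.1 i), h.isStable hφ hx.1.2⟩,
    fun i => (h.s_eq_zero_iff hφ i).2 (hx.2.1 i), h.isNilpotent hφ hx.2.2⟩

theorem isMor_id (x : RepSpace W v) : IsMor (fun _ => LinearMap.id) x x :=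
  ⟨fun _ _ _ => rfl, fun _ => rfl, fun _ => rfl⟩

theorem smul_mem_lagSet (g : GaugeGroup v) {x : RepSpace W v} (hx : x ∈ lagSet sgn W v) :
    g • x ∈ lagSet sgn W v :=
  mem_lagSet_of_isMor ((isMor_id x).smul_left g) (fun i => (g i).symm.injective) hx

theorem mk_eq_mk_iff {x y : StableZero sgn W v} :
    QuiverVariety.mk x = QuiverVariety.mk y ↔ ∃ g : GaugeGroup v, g • x.1 = y.1 := by
  refine (Quotient.eq (r := orbitSetoid sgn W v)).trans ?_
  change x.1 ∈ MulAction.orbit (GaugeGroup v) y.1 ↔ _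
  rw [MulAction.mem_orbit_iff]
  exact ⟨fun ⟨g, hg⟩ => ⟨g⁻¹, by rw [← hg, inv_smul_smul]⟩,
    fun ⟨g, hg⟩ => ⟨g⁻¹, by rw [← hg, inv_smul_smul]⟩⟩

/-- The orbit of a point of `lagSet`, as a point of the Lagrangian subvariety. -/
def toLag (x : lagSet sgn W v) : Lagrangian sgn W v :=
  ⟨QuiverVariety.mk ⟨x.1, x.2.1⟩, ⟨x.1, x.2.1⟩, rfl, x.2.2⟩

theorem toLag_eq_iff {x y : lagSet sgn W v} :
    toLag x = toLag y ↔ ∃ g : GaugeGroup v, g • x.1 = y.1 :=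
  Subtype.ext_iff.trans mk_eq_mk_iff

theorem toLag_surjective : Function.Surjective (toLag (sgn := sgn) (W := W) (v := v)) := by
  rintro ⟨_, x, rfl, hx⟩
  exact ⟨⟨x.1, x.2, hx⟩, rfl⟩

theorem continuous_toLag : Continuous (toLag (sgn := sgn) (W := W) (v := v)) :=
  Continuous.subtype_mk (continuous_quotient_mk'.comp
    (Continuous.subtype_mk continuous_subtype_val _)) _

theorem continuous_smul_gauge (g : GaugeGroup v) :
    Continuous fun x : RepSpace W v => g • x := by
  let L : RepSpace W v →ₗ[ℂ] RepSpace W v :=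
    { toFun := fun x => g • x
      map_add' := fun x y => by
        refine RepSpace.ext (fun i j τ => LinearMap.ext fun u => ?_)
          (fun i => LinearMap.ext fun u => ?_) (fun i => LinearMap.ext fun w => ?_)
        · exact map_add (g j) (x.B τ ((g i).symm u)) (y.B τ ((g i).symm u))
        · rfl
        · exact map_add (g i) (x.s i w) (y.s i w)
      map_smul' := fun c x => by
        refine RepSpace.ext (fun i j τ => LinearMap.ext fun u => ?_)
          (fun i => LinearMap.ext fun u => ?_) (fun i => LinearMap.ext fun w => ?_)
        · exact map_smul (g j) c (x.B τ ((g i).symm u))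
        · rfl
        · exact map_smul (g i) c (x.s i w) }
  exact continuous_linearMap L

/-- The saturation of an open set under the gauge group is open. -/
theorem isOpenMap_toLag : IsOpenMap (toLag (sgn := sgn) (W := W) (v := v)) := by
  rintro _ ⟨O, hO, rfl⟩
  let O' : Set (StableZero sgn W v) := {y | ∃ g : GaugeGroup v, g • y.1 ∈ O}
  have hO' : IsOpen O' := by
    have : O' = ⋃ g : GaugeGroup v, (fun y : StableZero sgn W v => g • y.1) ⁻¹' O := by
      ext y; simp [O']
    rw [this]
    exact isOpen_iUnion fun g =>
      hO.preimage ((continuous_smul_gauge g).comp continuous_subtype_val)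
  refine ⟨QuiverVariety.mk '' O', ?_, ?_⟩
  · change IsOpen (Quotient.mk (orbitSetoid sgn W v) ⁻¹' (QuiverVariety.mk '' O'))
    convert hO' using 1
    ext y
    constructor
    · rintro ⟨z, ⟨g, hg⟩, hz⟩
      obtain ⟨k, hk⟩ := mk_eq_mk_iff.1 hz
      exact ⟨g * k⁻¹, by rw [← hk, mul_smul, inv_smul_smul]; exact hg⟩
    · exact fun hy => ⟨y, hy, rfl⟩
  · ext q
    constructor
    · rintro ⟨z, ⟨g, hg⟩, hz⟩
      obtain ⟨x, rfl⟩ := toLag_surjective q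
      obtain ⟨k, hk⟩ := mk_eq_mk_iff.1 hz
      refine ⟨⟨(g * k⁻¹) • x.1, smul_mem_lagSet _ x.2⟩, ?_, ?_⟩
      · change (g * k⁻¹) • x.1 ∈ O
        rw [show x.1 = k • z.1 from hk.symm, mul_smul, inv_smul_smul]
        exact hg
      · exact toLag_eq_iff.2 ⟨(g * k⁻¹)⁻¹, inv_smul_smul _ _⟩
    · rintro ⟨x, hx, rfl⟩
      exact ⟨⟨x.1, x.2.1⟩, ⟨1, by rw [one_smul]; exact hx⟩, rfl⟩

/-- Gauge orbits are irreducible: an orbit is the regular image of a principal open subset of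
`∏ End V_i`. -/
theorem zariskiIrreducible_orbit [∀ i, FiniteDimensional ℂ (W i)] (x : RepSpace W v) :
    ZariskiIrreducible (MulAction.orbit (GaugeGroup v) x) := by
  let M := (i : I) → (VSp v i →ₗ[ℂ] VSp v i)
  let dt : M → ℂ := fun h => ∏ i, LinearMap.det (h i)
  let S : Set M := {h ∈ univ | dt h ≠ 0}
  have hdt : dt ∈ polynomialFunctions M := by
    have : dt = ∏ i, fun h : M => LinearMap.det (h i) := by
      ext h; simp [dt]
    rw [this]
    refine prod_mem fun i _ => ?_
    have h1 : ∀ h : M, LinearMap.det (h i) = (LinearMap.toMatrix' (h i)).det := fun h =>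
      (LinearMap.det_toMatrix' (h i)).symm
    rw [funext h1]
    exact (det_mem_of_forall_mem _ fun a b => dual_mem_polynomialFunctions (E := M)
      (LinearMap.proj b ∘ₗ LinearMap.proj a ∘ₗ LinearMap.toMatrix'.toLinearMap ∘ₗ
        LinearMap.proj i)).1
  have hS : ZariskiIrreducible S := zariskiIrreducible_univ.inter_ne_zero hdt
    ⟨fun _ => LinearMap.id, mem_univ _, by simp [dt]⟩
  have hu : ∀ (h : S) (i : I), IsUnit (h.1 i) := fun h i => by
    rw [LinearMap.isUnit_iff_isUnit_det, isUnit_iff_ne_zero]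
    exact Finset.prod_ne_zero_iff.1 h.2.2 i (Finset.mem_univ i)
  have hval : ∀ i, IsRegular fun h : S => h.1 i := fun i =>
    isRegular_val.linear (LinearMap.proj i : M →ₗ[ℂ] _)
  have hinv : ∀ i, IsRegular fun h : S => Ring.inverse (h.1 i) := fun i =>
    (hval i).right_inverse fun h => Ring.mul_inverse_cancel _ (hu h i)
  let act : S → RepSpace W v := fun h => .of (fun i j τ => h.1 j ∘ₗ x.B τ ∘ₗ Ring.inverse (h.1 i))
    (fun i => x.t i ∘ₗ Ring.inverse (h.1 i)) (fun i => h.1 i ∘ₗ x.s i)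
  have hact : IsRegular act := RepSpace.isRegular_of_components
    (fun i j τ => (hval j).comp_linearMap ((isRegular_const _).comp_linearMap (hinv i)))
    (fun i => (isRegular_const _).comp_linearMap (hinv i))
    (fun i => (hval i).comp_linearMap (isRegular_const _))
  have key : ∀ (h : S) (g : GaugeGroup v), (∀ i, h.1 i = (g i).toLinearMap) → act h = g • x := by
    intro h g hg
    have hg' : ∀ i, Ring.inverse (h.1 i) = (g i).symm.toLinearMap := fun i => by
      have h1 : h.1 i * (g i).symm.toLinearMap = 1 := by
        rw [hg]
        exact LinearMap.ext fun u => (g i).apply_symm_apply u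
      have h2 := Ring.inverse_mul_cancel _ (hu h i)
      calc Ring.inverse (h.1 i) = Ring.inverse (h.1 i) * (h.1 i * (g i).symm.toLinearMap) := by
            rw [h1, mul_one]
        _ = _ := by rw [← mul_assoc, h2, one_mul]
    refine RepSpace.ext (fun i j τ => ?_) (fun i => ?_) (fun i => ?_)
    · change h.1 j ∘ₗ x.B τ ∘ₗ Ring.inverse (h.1 i) = _
      rw [hg' i, hg j]
      rfl
    · change x.t i ∘ₗ Ring.inverse (h.1 i) = _
      rw [hg' i]
      rfl
    · change h.1 i ∘ₗ x.s i = _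
      rw [hg i]
      rfl
  have hrange : Set.range act = MulAction.orbit (GaugeGroup v) x := by
    ext y
    constructor
    · rintro ⟨h, rfl⟩
      refine ⟨fun i => LinearMap.GeneralLinearGroup.toLinearEquiv (hu h i).unit, ?_⟩
      exact (key h _ fun i => rfl).symm
    · rintro ⟨g, rfl⟩
      refine ⟨⟨fun i => (g i).toLinearMap, mem_univ _, ?_⟩, key _ g fun i => rfl⟩
      exact Finset.prod_ne_zero_iff.2 fun i _ => ((g i).isUnit_det').ne_zero
  rw [← hrange]
  exact hS.range hact

/-- The union of the gauge orbits in a subset of the Lagrangian subvariety. -/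
def lift (S : Set (Lagrangian sgn W v)) : Set (RepSpace W v) := Subtype.val '' (toLag ⁻¹' S)

theorem mem_lift {S : Set (Lagrangian sgn W v)} {x : RepSpace W v} :
    x ∈ lift S ↔ ∃ h : x ∈ lagSet sgn W v, toLag ⟨x, h⟩ ∈ S := by
  simp [lift]

theorem isPreirreducible_fiber_toLag [∀ i, FiniteDimensional ℂ (W i)] (q : Lagrangian sgn W v) :
    IsPreirreducible (toLag ⁻¹' {q}) := by
  obtain ⟨x, rfl⟩ := toLag_surjective q
  have h : Subtype.val '' (toLag ⁻¹' {toLag x}) = MulAction.orbit (GaugeGroup v) x.1 := by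
    ext y
    constructor
    · rintro ⟨y, hy, rfl⟩
      obtain ⟨g, hg⟩ := toLag_eq_iff.1 (Eq.symm hy)
      exact ⟨g, hg⟩
    · rintro ⟨g, rfl⟩
      exact ⟨⟨g • x.1, smul_mem_lagSet g x.2⟩,
        toLag_eq_iff.2 ⟨g⁻¹, inv_smul_smul _ _⟩, rfl⟩
  have h1 := isIrreducible_iff_zariskiIrreducible.2 (zariskiIrreducible_orbit (W := W) x.1)
  rw [← h] at h1
  intro O O' hO hO' hx hy
  obtain ⟨o, ho, rfl⟩ := hO
  obtain ⟨o', ho', rfl⟩ := hO'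
  obtain ⟨a, ha, hao⟩ := hx
  obtain ⟨b, hb, hbo⟩ := hy
  obtain ⟨_, ⟨c, hc, rfl⟩, hco⟩ := h1.2 o o' ho ho' ⟨a, ⟨a, ha, rfl⟩, hao⟩ ⟨b, ⟨b, hb, rfl⟩, hbo⟩
  exact ⟨c, hc, hco⟩

theorem zariskiIrreducible_lift [∀ i, FiniteDimensional ℂ (W i)] {S : Set (Lagrangian sgn W v)}
    (hS : IsIrreducible S) : ZariskiIrreducible (lift S) := by
  rw [← isIrreducible_iff_zariskiIrreducible]
  refine IsIrreducible.image ?_ _ continuous_subtype_val.continuousOn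
  exact hS.preimage_of_isPreirreducible_fiber toLag isOpenMap_toLag
    (fun q => isPreirreducible_fiber_toLag q) (by
      obtain ⟨q, hq⟩ := hS.1
      exact ⟨q, hq, toLag_surjective q⟩)

theorem lift_mono {S S' : Set (Lagrangian sgn W v)} (h : S ⊆ S') : lift S ⊆ lift S' :=
  image_mono (preimage_mono h)

theorem lift_closure_subset (S : Set (Lagrangian sgn W v)) :
    lift (closure S) ⊆ closure (lift S) := by
  rintro _ ⟨x, hx, rfl⟩
  rw [mem_preimage] at hx
  have h1 : x ∈ closure (toLag ⁻¹' S) := by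
    rw [← isOpenMap_toLag.preimage_closure_eq_closure_preimage continuous_toLag]
    exact hx
  exact image_closure_subset_closure_image continuous_subtype_val ⟨x, h1, rfl⟩

theorem hasDim_lift_iff_of_subset_closure {S S' : Set (Lagrangian sgn W v)} (h : S ⊆ S')
    (h' : S' ⊆ closure S) {n : ℕ} : HasDim (lift S) n ↔ HasDim (lift S') n :=
  HasDim.of_dense (lift_mono h) fun _ hf h0 x hx =>
    eq_zero_of_mem_closure hf h0 x (lift_closure_subset S (lift_mono h' hx))

/-- A proper closed irreducible subset has smaller dimension. -/
theorem hasDim_lift_lt [∀ i, FiniteDimensional ℂ (W i)] {S S' : Set (Lagrangian sgn W v)}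
    (hS : IsIrreducible S) (hS' : IsIrreducible S') (hc : IsClosed S) (h : S ⊂ S') {m n : ℕ}
    (hn : HasDim (lift S) n) (hm : HasDim (lift S') m) : n < m := by
  obtain ⟨hss, q, hq, hqS⟩ := ssubset_iff_exists.1 h |>.imp id id
  obtain ⟨x, rfl⟩ := toLag_surjective q
  have hx : x.1 ∉ closure (lift S) := by
    intro hx
    obtain ⟨O, hO, hOS⟩ := hc.preimage continuous_toLag
    have h1 : lift S ⊆ Oᶜ := by
      rintro _ ⟨y, hy, rfl⟩ hyO
      have : y ∈ (toLag ⁻¹' S)ᶜ := hOS ▸ hyO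
      exact this hy
    have h2 := closure_minimal h1 hO.isClosed_compl hx
    have h3 : x ∉ (toLag ⁻¹' S)ᶜ := fun h => h2 (hOS ▸ h : x ∈ Subtype.val ⁻¹' O)
    exact hqS (not_not.1 h3)
  obtain ⟨f, hf, hf0, hfx⟩ := exists_separating_of_notMem_closure hx
  exact HasDim.lt (zariskiIrreducible_lift hS) (zariskiIrreducible_lift hS') (lift_mono hss) hf hf0
    ⟨x.1, ⟨x, hq, rfl⟩, hfx⟩ hn hm

/-! ### Semicontinuity and the generic value of `ε_i` -/

/-- The map `(B_τ, s_i)` as a linear function of the point. -/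
def linIn (i : I) : RepSpace W v →ₗ[ℂ]
    ((((p : Σ j : I, (j ⟶ i)) → VSp v p.1) × W i) →ₗ[ℂ] VSp v i) where
  toFun x := x.inMap i
  map_add' x y := LinearMap.ext fun u => by
    have hB : ∀ (j : I) (τ : j ⟶ i), (x + y).B τ = x.B τ + y.B τ := fun _ _ => rfl
    have hs : (x + y).s i = x.s i + y.s i := rfl
    simp only [LinearMap.add_apply, inMap_apply, hB, hs, Finset.sum_add_distrib]
    abel
  map_smul' c x := LinearMap.ext fun u => by
    have hB : ∀ (j : I) (τ : j ⟶ i), (c • x).B τ = c • x.B τ := fun _ _ => rfl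
    have hs : (c • x).s i = c • x.s i := rfl
    simp only [LinearMap.smul_apply, inMap_apply, hB, hs, Finset.smul_sum, smul_add,
      RingHom.id_apply]

/-- The map `(B_τ, t_j)` as a linear function of the point. -/
def linOut (j : I) : RepSpace W v →ₗ[ℂ] (VSp v j →ₗ[ℂ] OutSp W v j) where
  toFun x := outMap x j
  map_add' _ _ := rfl
  map_smul' _ _ := rfl

variable (sgn) in
/-- The map `(ε(τ) B_{τ̄}, s_j)` as a linear function of the point. -/
def linRet (j : I) : RepSpace W v →ₗ[ℂ] (OutSp W v j →ₗ[ℂ] VSp v j) where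
  toFun x := retMap sgn x j
  map_add' x y := LinearMap.ext fun u => by
    have hB : ∀ (k l : I) (τ : k ⟶ l), (x + y).B τ = x.B τ + y.B τ := fun _ _ _ => rfl
    have hs : (x + y).s j = x.s j + y.s j := rfl
    simp only [LinearMap.add_apply, retMap_apply, hB, hs, Finset.sum_add_distrib, smul_add]
    abel
  map_smul' c x := LinearMap.ext fun u => by
    have hB : ∀ (k l : I) (τ : k ⟶ l), (c • x).B τ = c • x.B τ := fun _ _ _ => rfl
    have hs : (c • x).s j = c • x.s j := rfl
    simp only [LinearMap.smul_apply, retMap_apply, hB, hs, Finset.smul_sum, smul_add,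
      RingHom.id_apply]
    congr 1
    exact Finset.sum_congr rfl fun p _ => smul_comm _ _ _

theorem eps_toLag (i : I) (x : lagSet sgn W v) : QuiverVariety.eps i (toLag x).1 = x.1.eps i := rfl

theorem isOpen_eps_le [∀ i, FiniteDimensional ℂ (W i)] (i : I) (c : ℕ) :
    IsOpen {q : Lagrangian sgn W v | QuiverVariety.eps i q.1 ≤ c} := by
  have hq : Topology.IsQuotientMap (toLag (sgn := sgn) (W := W) (v := v)) :=
    isOpenMap_toLag.isQuotientMap continuous_toLag toLag_surjective
  rw [← hq.isOpen_preimage]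
  have h : toLag ⁻¹' {q : Lagrangian sgn W v | QuiverVariety.eps i q.1 ≤ c} =
      Subtype.val ⁻¹' {x : RepSpace W v |
        v i - c ≤ Module.finrank ℂ (LinearMap.range (linIn i x))} := by
    ext x
    have h1 := eps_add_finrank_range_inMap x.1 i
    change x.1.eps i ≤ c ↔ v i - c ≤ Module.finrank ℂ (LinearMap.range (x.1.inMap i))
    omega
  rw [h]
  exact (isOpen_le_finrank_range _ _).preimage continuous_subtype_val

theorem isClosed_le_eps [∀ i, FiniteDimensional ℂ (W i)] (i : I) (c : ℕ) :
    IsClosed {q : Lagrangian sgn W v | c ≤ QuiverVariety.eps i q.1} := by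
  rw [← isOpen_compl_iff]
  obtain _ | c := c
  · simp
  · convert isOpen_eps_le (sgn := sgn) (W := W) (v := v) i c using 1
    ext q
    simp only [mem_compl_iff, mem_ofPred_eq]
    omega

theorem isIrreducible_comp (Z : Comp sgn W v) : IsIrreducible Z.1 := Z.2.1

theorem isClosed_comp (Z : Comp sgn W v) : IsClosed Z.1 :=
  isClosed_of_mem_irreducibleComponents _ Z.2

theorem comp_eq_of_subset {Z : Comp sgn W v} {S : Set (Lagrangian sgn W v)} (hS : IsIrreducible S)
    (h : Z.1 ⊆ S) : Z.1 = S := le_antisymm h (Z.2.2 hS h)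

/-- The generic value of `ε_i` on a component is its minimum there, by semicontinuity. -/
theorem hasGenericEps_iff [∀ i, FiniteDimensional ℂ (W i)] {i : I} {Z : Comp sgn W v} {c : ℕ} :
    Z.HasGenericEps i c ↔ (∀ q ∈ Z.1, c ≤ QuiverVariety.eps i q.1) ∧
      ∃ q ∈ Z.1, QuiverVariety.eps i q.1 = c := by
  constructor
  · rintro ⟨U, hU, ⟨p, hpZ, hpU⟩, h⟩
    refine ⟨fun q hq => ?_, p, hpZ, h p ⟨hpZ, hpU⟩⟩
    obtain ⟨r, hr, hrU, hrq⟩ := (isIrreducible_comp Z).2 _ _ hU (isOpen_eps_le i _) ⟨p, hpZ, hpU⟩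
      ⟨q, hq, le_refl (QuiverVariety.eps i q.1)⟩
    rw [← h r ⟨hr, hrU⟩]
    exact hrq
  · rintro ⟨h1, q, hq, hqc⟩
    refine ⟨{q | QuiverVariety.eps i q.1 ≤ c}, isOpen_eps_le i c, ⟨q, hq, hqc.le⟩, ?_⟩
    rintro r ⟨hr, hrc⟩
    exact le_antisymm hrc (h1 r hr)

theorem hasGenericEps_unique [∀ i, FiniteDimensional ℂ (W i)] {i : I} {Z : Comp sgn W v}
    {c c' : ℕ} (h : Z.HasGenericEps i c) (h' : Z.HasGenericEps i c') : c = c' := by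
  rw [hasGenericEps_iff] at h h'
  obtain ⟨h1, q, hq, rfl⟩ := h
  obtain ⟨h2, r, hr, rfl⟩ := h'
  exact le_antisymm (h1 r hr) (h2 q hq)

theorem existsUnique_hasGenericEps [∀ i, FiniteDimensional ℂ (W i)] (i : I) (Z : Comp sgn W v) :
    ∃! c : ℕ, Z.HasGenericEps i c := by
  have hne : ((fun q : Lagrangian sgn W v => QuiverVariety.eps i q.1) '' Z.1).Nonempty :=
    (isIrreducible_comp Z).1.image _
  obtain ⟨q, hq, hqc⟩ := Nat.sInf_mem hne
  have h : Z.HasGenericEps i (QuiverVariety.eps i q.1) :=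
    hasGenericEps_iff.2 ⟨fun r hr => hqc.trans_le (Nat.sInf_le ⟨r, hr, rfl⟩), q, hq, rfl⟩
  exact ⟨_, h, fun c hc => hasGenericEps_unique hc h⟩

end Lag

/-! ### Strata and the projection to the stratum `ε_i = 0` -/

theorem isPreirreducible_preimage_val {X : Type*} [TopologicalSpace X] {S T : Set X}
    (hS : IsPreirreducible S) (h : S ⊆ T) :
    IsPreirreducible (Subtype.val ⁻¹' S : Set T) := by
  rintro _ _ ⟨o, ho, rfl⟩ ⟨o', ho', rfl⟩ ⟨a, ha, hao⟩ ⟨b, hb, hbo⟩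
  obtain ⟨c, hc, hco⟩ := hS o o' ho ho' ⟨a.1, ha, hao⟩ ⟨b.1, hb, hbo⟩
  exact ⟨⟨c, h hc⟩, hc, hco⟩

/-- Two subspaces of the same dimension are exchanged by an automorphism. -/
theorem exists_linearEquiv_comp_eq {V U : Type*} [AddCommGroup V] [Module ℂ V] [AddCommGroup U]
    [Module ℂ U] [FiniteDimensional ℂ V] {φ ψ : U →ₗ[ℂ] V} (hφ : Function.Injective φ)
    (hψ : Function.Injective ψ) : ∃ g : V ≃ₗ[ℂ] V, ∀ u, g (φ u) = ψ u := by
  have : FiniteDimensional ℂ U := FiniteDimensional.of_injective φ hφ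
  obtain ⟨C, hC⟩ := (LinearMap.range φ).exists_isCompl
  obtain ⟨D, hD⟩ := (LinearMap.range ψ).exists_isCompl
  have h1 := Submodule.finrank_add_eq_of_isCompl hC
  have h2 := Submodule.finrank_add_eq_of_isCompl hD
  rw [LinearMap.finrank_range_of_inj hφ] at h1
  rw [LinearMap.finrank_range_of_inj hψ] at h2
  let e : C ≃ₗ[ℂ] D := LinearEquiv.ofFinrankEq _ _ (by omega)
  let a := (LinearEquiv.ofInjective φ hφ).symm.trans (LinearEquiv.ofInjective ψ hψ)
  refine ⟨(Submodule.prodEquivOfIsCompl _ _ hC).symm.trans ((a.prodCongr e).trans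
    (Submodule.prodEquivOfIsCompl _ _ hD)), fun u => ?_⟩
  have h3 : (Submodule.prodEquivOfIsCompl _ _ hC).symm (φ u) =
      (LinearEquiv.ofInjective φ hφ u, 0) := by
    rw [LinearEquiv.symm_apply_eq]
    simp
  simp only [LinearEquiv.trans_apply]
  rw [h3]
  simp [a]

section Strata

variable {I : Type*} [Fintype I] [DecidableEq I] [Quiver I] [Quiver.HasInvolutiveReverse I]
  [∀ i j : I, Fintype (i ⟶ j)] (sgn : (i j : I) → (i ⟶ j) → ℂˣ)
  (W : I → Type*) [∀ i, AddCommGroup (W i)] [∀ i, Module ℂ (W i)]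

/-- The stratum `ε_i = c` of the Lagrangian subvariety. -/
def stratum (i : I) (c : ℕ) (v : I → ℕ) : Set (Lagrangian sgn W v) :=
  {q | QuiverVariety.eps i q.1 = c}

/-- The union of the gauge orbits in the stratum `ε_i = c` of the Lagrangian subvariety. -/
def stratLift (i : I) (c : ℕ) (v : I → ℕ) : Set (RepSpace W v) :=
  {x | x ∈ lagSet sgn W v ∧ x.eps i = c}

variable {sgn W} {i : I} {c : ℕ} {v v' : I → ℕ}

/-- The orbit of a point in a stratum. -/
def toStrat (x : stratLift sgn W i c v) : stratum sgn W i c v := ⟨toLag ⟨x.1, x.2.1⟩, x.2.2⟩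

theorem continuous_toStrat :
    Continuous (toStrat (sgn := sgn) (W := W) (i := i) (c := c) (v := v)) :=
  Continuous.subtype_mk (continuous_toLag.comp (Continuous.subtype_mk continuous_subtype_val _)) _

theorem toStrat_surjective :
    Function.Surjective (toStrat (sgn := sgn) (W := W) (i := i) (c := c) (v := v)) := by
  rintro ⟨q, hq⟩
  obtain ⟨x, rfl⟩ := toLag_surjective q
  exact ⟨⟨x.1, x.2, hq⟩, rfl⟩

theorem isOpenMap_toStrat :
    IsOpenMap (toStrat (sgn := sgn) (W := W) (i := i) (c := c) (v := v)) := by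
  rintro _ ⟨O, hO, rfl⟩
  refine ⟨toLag '' (Subtype.val ⁻¹' O), isOpenMap_toLag _ ⟨O, hO, rfl⟩, ?_⟩
  ext q
  constructor
  · rintro ⟨x, hx, hq⟩
    refine ⟨⟨x.1, x.2, ?_⟩, hx, Subtype.ext hq⟩
    rw [← eps_toLag, hq]
    exact q.2
  · rintro ⟨x, hx, rfl⟩
    exact ⟨⟨x.1, x.2.1⟩, hx, rfl⟩

theorem subsingleton_single {j : I} (hj : j ≠ i) : Subsingleton (VSp (Pi.single i c) j) := by
  have : (Pi.single i c : I → ℕ) j = 0 := by simp [hj]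
  have : IsEmpty (Fin ((Pi.single i c : I → ℕ) j)) := by rw [this]; infer_instance
  infer_instance

theorem finrank_outSp_add_single [∀ i, FiniteDimensional ℂ (W i)] [hi : IsEmpty (i ⟶ i)] :
    Module.finrank ℂ (OutSp W (v' + Pi.single i c) i) = Module.finrank ℂ (OutSp W v' i) := by
  rw [finrank_outSp, finrank_outSp]
  congr 1
  refine Finset.sum_congr rfl fun k _ => ?_
  by_cases hk : k = i
  · subst hk
    simp
  · simp [Pi.single_eq_of_ne hk]

theorem heckeRel_iff {q' : QuiverVariety sgn W v'} {q : QuiverVariety sgn W v} :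
    HeckeRel q' q ↔ ∃ (x' : StableZero sgn W v') (x : StableZero sgn W v)
      (φ : (i : I) → (VSp v' i →ₗ[ℂ] VSp v i)), QuiverVariety.mk x' = q' ∧ QuiverVariety.mk x = q ∧
        (∀ i, Function.Injective (φ i)) ∧ IsMor φ x'.1 x.1 :=
  ⟨fun ⟨x', x, φ, h1, h2, h3, h4, h5, h6⟩ => ⟨x', x, φ, h1, h2, h3, h4, h5, h6⟩,
    fun ⟨x', x, φ, h1, h2, h3, h⟩ => ⟨x', x, φ, h1, h2, h3, h.B, h.t, h.s⟩⟩

/-- A Hecke correspondence can be realized with given representatives. -/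
theorem HeckeRel.exists_isMor {x' : StableZero sgn W v'} {x : StableZero sgn W v}
    (h : HeckeRel (QuiverVariety.mk x') (QuiverVariety.mk x)) :
    ∃ φ : (i : I) → (VSp v' i →ₗ[ℂ] VSp v i),
      (∀ i, Function.Injective (φ i)) ∧ IsMor φ x'.1 x.1 := by
  obtain ⟨y', y, φ, h1, h2, hφ, hm⟩ := heckeRel_iff.1 h
  obtain ⟨g, hg⟩ := mk_eq_mk_iff.1 h1
  obtain ⟨k, hk⟩ := mk_eq_mk_iff.1 h2
  refine ⟨_, fun i => ?_, hg ▸ hk ▸ (hm.smul_left g).smul_right k⟩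
  exact (k i).injective.comp ((hφ i).comp (g i).symm.injective)

theorem surjective_at_ne {φ : (j : I) → (VSp v' j →ₗ[ℂ] VSp (v' + Pi.single i c) j)}
    (hφ : ∀ j, Function.Injective (φ j)) (k : I) (hk : k ≠ i) : Function.Surjective (φ k) :=
  surjective_of_injective_of_eq (hφ k) (by simp [Pi.single_eq_of_ne hk])

theorem HeckeRel.eps_eq [IsEmpty (i ⟶ i)] {q' : QuiverVariety sgn W v'}
    {q : QuiverVariety sgn W (v' + Pi.single i c)} (h : HeckeRel q' q) :
    QuiverVariety.eps i q = QuiverVariety.eps i q' + c := by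
  obtain ⟨x', x, φ, rfl, rfl, hφ, hm⟩ := heckeRel_iff.1 h
  have h1 := hm.eps_add hφ (surjective_at_ne hφ)
  rw [Pi.add_apply, Pi.single_eq_same] at h1
  change x.1.eps i = x'.1.eps i + c
  omega

theorem finrank_range_inMap {x : RepSpace W (v' + Pi.single i c)} (hx : x.eps i = c) :
    Module.finrank ℂ (LinearMap.range (x.inMap i)) = v' i := by
  have h1 := eps_add_finrank_range_inMap x i
  have h2 : (v' + Pi.single i c : I → ℕ) i = v' i + c := by simp
  omega

theorem IsMor.range_eq [IsEmpty (i ⟶ i)]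
    {φ : (j : I) → (VSp v' j →ₗ[ℂ] VSp (v' + Pi.single i c) j)}
    (hφ : ∀ j, Function.Injective (φ j)) {x' : RepSpace W v'}
    {x : RepSpace W (v' + Pi.single i c)} (h : IsMor φ x' x) (hx : x.eps i = c) :
    LinearMap.range (φ i) = LinearMap.range (x.inMap i) := by
  symm
  apply Submodule.eq_of_le_of_finrank_le
  · rw [← h.map_range_inMap (surjective_at_ne hφ)]
    exact LinearMap.map_le_range
  · rw [LinearMap.finrank_range_of_inj (hφ i), Module.finrank_fin_fun, finrank_range_inMap hx]

theorem IsMor.range_le [IsEmpty (i ⟶ i)]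
    {φ : (j : I) → (VSp v' j →ₗ[ℂ] VSp (v' + Pi.single i c) j)}
    (hφ : ∀ j, Function.Injective (φ j)) {x' : RepSpace W v'}
    {x : RepSpace W (v' + Pi.single i c)} (h : IsMor φ x' x) (hx : x.eps i = c) (j : I) :
    LinearMap.range (x.inMap j) ≤ LinearMap.range (φ j) := by
  by_cases hj : j = i
  · subst hj
    exact (h.range_eq hφ hx).ge
  · rw [LinearMap.range_eq_top.2 (surjective_at_ne hφ j hj)]
    exact le_top

/-- A point with `ε_i = c` is related to at most one point. -/
theorem HeckeRel.unique [IsEmpty (i ⟶ i)] {q₁ q₂ : QuiverVariety sgn W v'}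
    {q : QuiverVariety sgn W (v' + Pi.single i c)} (h₁ : HeckeRel q₁ q) (h₂ : HeckeRel q₂ q)
    (hq : QuiverVariety.eps i q = c) : q₁ = q₂ := by
  obtain ⟨x₁, x, φ₁, rfl, rfl, hφ₁, hm₁⟩ := heckeRel_iff.1 h₁
  obtain ⟨x₂, y, φ₂, rfl, hy, -, -⟩ := heckeRel_iff.1 h₂
  obtain ⟨φ₂, hφ₂, hm₂⟩ := h₂.exists_isMor
  refine mk_eq_mk_iff.2 (hm₁.exists_smul_eq hm₂ hφ₁ hφ₂ fun j => ?_)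
  by_cases hj : j = i
  · subst hj
    rw [hm₁.range_eq hφ₁ hq, hm₂.range_eq hφ₂ hq]
  · rw [LinearMap.range_eq_top.2 (surjective_at_ne hφ₁ j hj),
      LinearMap.range_eq_top.2 (surjective_at_ne hφ₂ j hj)]

/-! ### Charts -/

variable (sgn)

/-- The endomorphism of `V'_j` whose invertibility defines the domain of a chart around points for
which the image of `(ε(τ) B_{τ̄}, s_j)` projects isomorphically to `V'_j`. -/
def chartMat {d : I → ℕ} (κ : (j : I) → (VSp v' j →ₗ[ℂ] OutSp W (v' + d) j)) (j : I) :
    RepSpace W (v' + d) →ₗ[ℂ] (VSp v' j →ₗ[ℂ] VSp v' j) where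
  toFun x := prl v' d j ∘ₗ retMap sgn x j ∘ₗ κ j
  map_add' x y := LinearMap.ext fun u => by
    have h := LinearMap.congr_fun ((linRet sgn j).map_add x y) (κ j u)
    change prl v' d j (linRet sgn j (x + y) (κ j u)) = _
    rw [h, LinearMap.add_apply, map_add]
    rfl
  map_smul' a x := LinearMap.ext fun u => by
    have h := LinearMap.congr_fun ((linRet sgn j).map_smul a x) (κ j u)
    change prl v' d j (linRet sgn j (a • x) (κ j u)) = _
    rw [h, LinearMap.smul_apply, map_smul]
    rfl

/-- The linear map `V'_j → C_j` whose graph is the image of `(ε(τ) B_{τ̄}, s_j)`, in the domain of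
the chart; elsewhere `Ring.inverse` takes the value `0`. -/
def chartGraph {d : I → ℕ} (κ : (j : I) → (VSp v' j →ₗ[ℂ] OutSp W (v' + d) j))
    (x : RepSpace W (v' + d)) (j : I) : VSp v' j →ₗ[ℂ] VSp d j :=
  prr v' d j ∘ₗ retMap sgn x j ∘ₗ κ j ∘ₗ Ring.inverse (chartMat sgn κ j x)

variable {sgn}

theorem isUnit_iff_le_finrank_range {V : Type*} [AddCommGroup V] [Module ℂ V]
    [FiniteDimensional ℂ V] (f : V →ₗ[ℂ] V) :
    IsUnit f ↔ Module.finrank ℂ V ≤ Module.finrank ℂ (LinearMap.range f) := by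
  rw [← surjective_iff_le_finrank_range, LinearMap.isUnit_iff_range_eq_top, LinearMap.range_eq_top]

/-- On a chart, points with `ε_i = c` are adapted to the graph. -/
theorem isAdapted_chartGraph {κ : (j : I) → (VSp v' j →ₗ[ℂ] OutSp W (v' + Pi.single i c) j)}
    {x : RepSpace W (v' + Pi.single i c)} (hx : x.eps i = c) (hκ : IsUnit (chartMat sgn κ i x)) :
    IsAdapted (chartGraph sgn κ x) x := by
  set n := chartGraph sgn κ x
  have key : ∀ j, ∀ y ∈ LinearMap.range (x.inMap j), graphQuot n j y = 0 := by
    intro j y hy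
    by_cases hj : j = i
    · subst hj
      rw [← range_retMap sgn] at hy
      have hinv := Ring.inverse_mul_cancel _ hκ
      have hinj : Function.Injective (retMap sgn x j ∘ₗ κ j) := by
        have h1 : Function.Injective (chartMat sgn κ j x) :=
          Function.LeftInverse.injective
            (g := (Ring.inverse (chartMat sgn κ j x) : VSp v' j →ₗ[ℂ] VSp v' j))
            fun u => LinearMap.congr_fun hinv u
        exact Function.Injective.of_comp (f := prl v' _ j) h1
      have hrange : LinearMap.range (retMap sgn x j ∘ₗ κ j) = LinearMap.range (retMap sgn x j) := by
        apply Submodule.eq_of_le_of_finrank_le (LinearMap.range_comp_le_range _ _)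
        rw [LinearMap.finrank_range_of_inj hinj, range_retMap, Module.finrank_fin_fun,
          finrank_range_inMap hx]
      rw [← hrange] at hy
      obtain ⟨z, rfl⟩ := hy
      have h2 : Ring.inverse (chartMat sgn κ j x) (prl v' _ j ((retMap sgn x j ∘ₗ κ j) z)) = z :=
        LinearMap.congr_fun hinv z
      simp only [graphQuot, n, chartGraph, LinearMap.sub_apply, LinearMap.comp_apply] at h2 ⊢
      rw [h2, sub_self]
    · have := subsingleton_single (c := c) hj
      exact Subsingleton.elim _ _
  exact ⟨fun k j τ u => key j _ (B_mem_range_inMap x τ u),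
    fun j w => key j _ (s_mem_range_inMap x j w)⟩

/-- After a gauge transformation, every point with `ε_i = c` lies in a chart. -/
theorem exists_chart {x : RepSpace W (v' + Pi.single i c)} (hx : x.eps i = c) :
    ∃ (g : GaugeGroup (v' + Pi.single i c))
      (κ : (j : I) → (VSp v' j →ₗ[ℂ] OutSp W (v' + Pi.single i c) j)),
      IsUnit (chartMat sgn κ i (g • x)) := by
  let e : VSp v' i ≃ₗ[ℂ] LinearMap.range (x.inMap i) :=
    LinearEquiv.ofFinrankEq _ _ (by
      rw [Module.finrank_fin_fun, finrank_range_inMap hx])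
  obtain ⟨k, hk⟩ := exists_linearEquiv_comp_eq
    (φ := (LinearMap.range (x.inMap i)).subtype ∘ₗ e.toLinearMap)
    (ψ := incl v' (Pi.single i c) i) (Subtype.val_injective.comp e.injective)
    (Function.LeftInverse.injective (g := prl v' _ i) prl_incl)
  let g : GaugeGroup (v' + Pi.single i c) := Function.update (fun j => LinearEquiv.refl ℂ _) i k
  have hgi : g i = k := Function.update_self _ _ _
  have hsurj : Function.Surjective (prl v' (Pi.single i c) i ∘ₗ retMap sgn (g • x) i) := by
    intro u
    obtain ⟨⟨y, w⟩, hy⟩ := (e u).2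
    have h2 : g i (x.inMap i (y, w)) ∈ LinearMap.range (retMap sgn (g • x) i) := by
      rw [range_retMap]
      refine ⟨(fun p => g p.1 (y p), w), ?_⟩
      rw [RepSpace.inMap_smul]
      simp
    obtain ⟨z, hz⟩ := h2
    refine ⟨z, ?_⟩
    rw [LinearMap.comp_apply, hz, hy, hgi]
    have h3 := hk u
    simp only [LinearMap.comp_apply] at h3
    change prl v' _ i (k ((LinearMap.range (x.inMap i)).subtype (e u))) = u
    rw [show k ((LinearMap.range (x.inMap i)).subtype (e u)) = _ from h3, prl_incl]
  have hκ : ∀ j, ∃ κ : VSp v' j →ₗ[ℂ] OutSp W (v' + Pi.single i c) j, j = i →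
      prl v' (Pi.single i c) j ∘ₗ retMap sgn (g • x) j ∘ₗ κ = LinearMap.id := by
    intro j
    by_cases hj : j = i
    · subst hj
      obtain ⟨κ, hκ⟩ := LinearMap.exists_rightInverse_of_surjective _
        (LinearMap.range_eq_top.2 hsurj)
      exact ⟨κ, fun _ => hκ⟩
    · exact ⟨0, fun h => absurd h hj⟩
  choose κ hκ using hκ
  refine ⟨g, κ, ?_⟩
  have h4 : chartMat sgn κ i (g • x) = 1 := hκ i rfl
  rw [h4]
  exact isUnit_one

theorem isRegular_chartGraph [∀ i, FiniteDimensional ℂ (W i)]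
    {κ : (j : I) → (VSp v' j →ₗ[ℂ] OutSp W (v' + Pi.single i c) j)}
    {S : Set (RepSpace W (v' + Pi.single i c))} (hS : ∀ x ∈ S, IsUnit (chartMat sgn κ i x))
    (j : I) :
    IsRegular fun x : S => chartGraph sgn κ x.1 j := by
  by_cases hj : j = i
  · subst hj
    have h1 : IsRegular fun x : S => chartMat sgn κ j x.1 := isRegular_val.linear _
    have h2 : IsRegular fun x : S => Ring.inverse (chartMat sgn κ j x.1) :=
      h1.right_inverse fun x => Ring.mul_inverse_cancel _ (hS x.1 x.2)
    have h3 : IsRegular fun x : S => retMap sgn x.1 j := isRegular_val.linear (linRet sgn j)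
    exact (isRegular_const _).comp_linearMap (h3.comp_linearMap
      ((isRegular_const _).comp_linearMap h2))
  · have := subsingleton_single (c := c) hj
    have h : (fun x : S => chartGraph sgn κ x.1 j) = fun _ => 0 := by
      funext x
      exact LinearMap.ext fun u => Subsingleton.elim _ _
    rw [h]
    exact isRegular_const _

theorem isRegular_graphEmb {d : I → ℕ} {E : Type*} [AddCommGroup E] [Module ℂ E] {S : Set E}
    {n : S → (j : I) → VSp v' j →ₗ[ℂ] VSp d j} (hn : ∀ j, IsRegular fun x => n x j) (j : I) :
    IsRegular fun x => graphEmb (n x) j :=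
  (isRegular_const _).add ((isRegular_const _).comp_linearMap (hn j))

theorem isRegular_res [∀ i, FiniteDimensional ℂ (W i)] {d : I → ℕ} {S : Set (RepSpace W (v' + d))}
    {n : S → (j : I) → VSp v' j →ₗ[ℂ] VSp d j} (hn : ∀ j, IsRegular fun x => n x j) :
    IsRegular fun x : S => res (n x) x.1 :=
  RepSpace.isRegular_of_components
    (fun i _ τ => (isRegular_const _).comp_linearMap
      ((isRegular_val.linear (RepSpace.linB τ)).comp_linearMap (isRegular_graphEmb hn i)))
    (fun i => (isRegular_val.linear (RepSpace.linT i)).comp_linearMap (isRegular_graphEmb hn i))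
    (fun i => (isRegular_const _).comp_linearMap (isRegular_val.linear (RepSpace.linS i)))

/-! ### The projection of a stratum -/

section Down

variable [IsEmpty (i ⟶ i)]

theorem res_mem_lagSet {n : (j : I) → VSp v' j →ₗ[ℂ] VSp (Pi.single i c : I → ℕ) j}
    {x : RepSpace W (v' + Pi.single i c)}
    (h : IsAdapted n x) (hx : x ∈ lagSet sgn W (v' + Pi.single i c)) :
    res n x ∈ lagSet sgn W v' :=
  mem_lagSet_of_isMor h.isMor (graphEmb_injective n) hx

theorem exists_heckeRel (q : stratum sgn W i c (v' + Pi.single i c)) :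
    ∃ q' : Lagrangian sgn W v', HeckeRel q'.1 q.1.1 := by
  obtain ⟨x, rfl⟩ := toStrat_surjective q
  obtain ⟨g, κ, hκ⟩ := exists_chart (sgn := sgn) x.2.2
  have hgx := smul_mem_lagSet g x.2.1
  have ha := isAdapted_chartGraph (by rw [RepSpace.eps_smul]; exact x.2.2) hκ
  refine ⟨toLag ⟨_, res_mem_lagSet ha hgx⟩, heckeRel_iff.2 ⟨⟨_, (res_mem_lagSet ha hgx).1⟩,
    ⟨_, hgx.1⟩, _, rfl, mk_eq_mk_iff.2 ⟨g⁻¹, inv_smul_smul _ _⟩, graphEmb_injective _, ha.isMor⟩⟩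

/-- The projection of the stratum `ε_i = c` to the stratum `ε_i = 0` for the smaller dimension
vector: the restriction of a representation to the image of its incoming map at `i`. -/
def down (q : stratum sgn W i c (v' + Pi.single i c)) : Lagrangian sgn W v' :=
  (exists_heckeRel q).choose

theorem heckeRel_down (q : stratum sgn W i c (v' + Pi.single i c)) : HeckeRel (down q).1 q.1.1 :=
  (exists_heckeRel q).choose_spec

theorem heckeRel_iff_down_eq {q : stratum sgn W i c (v' + Pi.single i c)}
    {q' : Lagrangian sgn W v'} : HeckeRel q'.1 q.1.1 ↔ down q = q' := by
  constructor
  · exact fun h => Subtype.ext ((heckeRel_down q).unique h q.2)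
  · rintro rfl
    exact heckeRel_down q

theorem eps_down (q : stratum sgn W i c (v' + Pi.single i c)) :
    QuiverVariety.eps i (down q).1 = 0 := by
  have h := (heckeRel_down q).eps_eq
  have h2 : QuiverVariety.eps i q.1.1 = c := q.2
  omega

theorem down_toStrat {x : stratLift sgn W i c (v' + Pi.single i c)} {x' : lagSet sgn W v'}
    {φ : (j : I) → (VSp v' j →ₗ[ℂ] VSp (v' + Pi.single i c) j)}
    (hφ : ∀ j, Function.Injective (φ j)) (h : IsMor φ x'.1 x.1) :
    down (toStrat x) = toLag x' :=
  heckeRel_iff_down_eq.1 (heckeRel_iff.2 ⟨⟨x'.1, x'.2.1⟩, ⟨x.1, x.2.1.1⟩, φ, rfl, rfl, hφ, h⟩)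

theorem continuous_down [∀ i, FiniteDimensional ℂ (W i)] :
    Continuous (down (sgn := sgn) (W := W) (i := i) (c := c) (v' := v')) := by
  have hquot : Topology.IsQuotientMap
      (toStrat (sgn := sgn) (W := W) (i := i) (c := c) (v := v' + Pi.single i c)) :=
    isOpenMap_toStrat.isQuotientMap continuous_toStrat toStrat_surjective
  rw [hquot.continuous_iff, continuous_iff_continuousAt]
  intro x₀
  obtain ⟨g, κ, hκ⟩ := exists_chart (sgn := sgn) x₀.2.2
  let T : Set (RepSpace W (v' + Pi.single i c)) :=
    {y | y ∈ stratLift sgn W i c (v' + Pi.single i c) ∧ IsUnit (chartMat sgn κ i y)}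
  have hT : ∀ y : T, IsAdapted (chartGraph sgn κ y.1) y.1 := fun y =>
    isAdapted_chartGraph y.2.1.2 y.2.2
  let Ψ : T → RepSpace W v' := fun y => res (chartGraph sgn κ y.1) y.1
  have hΨ : Continuous Ψ := (isRegular_res (n := fun y : T => chartGraph sgn κ y.1)
    (isRegular_chartGraph fun x hx => hx.2)).continuous
  let Ψ' : T → Lagrangian sgn W v' := fun y => toLag ⟨Ψ y, res_mem_lagSet (hT y) y.2.1.1⟩
  have hΨ' : Continuous Ψ' := continuous_toLag.comp (hΨ.subtype_mk _)
  let O : Set (stratLift sgn W i c (v' + Pi.single i c)) :=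
    {x | IsUnit (chartMat sgn κ i (g • x.1))}
  have hO : IsOpen O := by
    simp only [O, isUnit_iff_le_finrank_range]
    exact (isOpen_le_finrank_range (chartMat sgn κ i) _).preimage
      ((continuous_smul_gauge g).comp continuous_subtype_val)
  have hgx : ∀ x : stratLift sgn W i c (v' + Pi.single i c),
      g • x.1 ∈ stratLift sgn W i c (v' + Pi.single i c) := fun x =>
    ⟨smul_mem_lagSet g x.2.1, by rw [RepSpace.eps_smul]; exact x.2.2⟩
  refine ContinuousOn.continuousAt (s := O) ?_ (hO.mem_nhds hκ)
  rw [continuousOn_iff_continuous_domRestrict]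
  have hcont : Continuous fun x : O => (⟨g • x.1.1, hgx x.1, x.2⟩ : T) :=
    Continuous.subtype_mk ((continuous_smul_gauge g).comp
      (continuous_subtype_val.comp continuous_subtype_val)) _
  convert hΨ'.comp hcont using 1
  funext x
  have h1 : toStrat x.1 = toStrat ⟨g • x.1.1, hgx x.1⟩ :=
    Subtype.ext (toLag_eq_iff.2 ⟨g, rfl⟩)
  change down (toStrat x.1) = _
  rw [h1]
  exact down_toStrat (graphEmb_injective _) (hT ⟨g • x.1.1, hgx x.1, x.2⟩).isMor

end Down

end Strata

/-! ### The fibres of the projection -/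

section Fibres

variable {I : Type*} [Fintype I] [DecidableEq I] [Quiver I] [Quiver.HasInvolutiveReverse I]
  [∀ i j : I, Fintype (i ⟶ j)] {sgn : (i j : I) → (i ⟶ j) → ℂˣ}
  {W : I → Type*} [∀ i, AddCommGroup (W i)] [∀ i, Module ℂ (W i)]
  {i : I} {c : ℕ} {v v' d : I → ℕ}

variable (sgn) in
/-- The composition of `(ε(τ) B_{τ̄}, s_j)` with a fixed map, as a linear function of the point. -/
def retMat (κ : (j : I) → (VSp v' j →ₗ[ℂ] OutSp W v' j)) (j : I) :
    RepSpace W v' →ₗ[ℂ] (VSp v' j →ₗ[ℂ] VSp v' j) where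
  toFun x := retMap sgn x j ∘ₗ κ j
  map_add' x y := LinearMap.ext fun u => LinearMap.congr_fun ((linRet sgn j).map_add x y) (κ j u)
  map_smul' a x := LinearMap.ext fun u => LinearMap.congr_fun ((linRet sgn j).map_smul a x) (κ j u)

variable (sgn) in
/-- The projection of outgoing components to the kernel of `(ε(τ) B_{τ̄}, s_j)` along the image
of `κ`, if the image of `κ` is complementary to that kernel. At the other vertices of a one-vertex
extension `f j` is `0`, so the value `0` of `Ring.inverse` at non-units does no harm. -/
def extProj (κ : (j : I) → (VSp v' j →ₗ[ℂ] OutSp W v' j)) (x : RepSpace W v') (f : ExtSp W v' d) :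
    ExtSp W v' d := fun j =>
  f j - κ j ∘ₗ Ring.inverse (retMat sgn κ j x) ∘ₗ retMap sgn x j ∘ₗ f j

theorem retMap_extProj {κ : (j : I) → (VSp v' j →ₗ[ℂ] OutSp W v' j)} {x : RepSpace W v'}
    (hκ : IsUnit (retMat sgn κ i x)) (f : ExtSp W v' (Pi.single i c)) (j : I)
    (u : VSp (Pi.single i c : I → ℕ) j) : retMap sgn x j (extProj sgn κ x f j u) = 0 := by
  by_cases hj : j = i
  · subst hj
    have h := LinearMap.congr_fun (Ring.mul_inverse_cancel _ hκ) (retMap sgn x j (f j u))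
    have h' : retMap sgn x j (κ j ((Ring.inverse (retMat sgn κ j x) : VSp v' j →ₗ[ℂ] VSp v' j)
      (retMap sgn x j (f j u)))) = retMap sgn x j (f j u) := h
    simp only [extProj, LinearMap.sub_apply, LinearMap.comp_apply, map_sub]
    rw [h', sub_self]
  · have := subsingleton_single (c := c) hj
    rw [Subsingleton.elim u 0, map_zero, map_zero]

theorem extProj_eq_self {κ : (j : I) → (VSp v' j →ₗ[ℂ] OutSp W v' j)} {x : RepSpace W v'}
    {f : ExtSp W v' d} (hf : ∀ j u, retMap sgn x j (f j u) = 0) : extProj sgn κ x f = f := by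
  refine funext fun j => LinearMap.ext fun u => ?_
  simp [extProj, hf]

theorem surjective_retMap_of_eps_eq_zero {x : RepSpace W v'} (hx : x.eps i = 0) :
    Function.Surjective (retMap sgn x i) := by
  rw [← LinearMap.range_eq_top, range_retMap]
  apply Submodule.eq_top_of_finrank_eq
  have h := eps_add_finrank_range_inMap x i
  rw [Module.finrank_fin_fun]
  omega

theorem eps_eq_zero_of_isUnit {κ : (j : I) → (VSp v' j →ₗ[ℂ] OutSp W v' j)} {x : RepSpace W v'}
    (hκ : IsUnit (retMat sgn κ i x)) : x.eps i = 0 := by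
  have h1 : Function.Surjective (retMap sgn x i) := fun u =>
    ⟨_, LinearMap.congr_fun (Ring.mul_inverse_cancel _ hκ) u⟩
  have h2 := eps_add_finrank_range_inMap x i
  rw [← range_retMap sgn, LinearMap.range_eq_top.2 h1, finrank_top, Module.finrank_fin_fun] at h2
  omega

theorem exists_isUnit_retMat {x : RepSpace W v'} (hx : x.eps i = 0) :
    ∃ κ : (j : I) → (VSp v' j →ₗ[ℂ] OutSp W v' j), IsUnit (retMat sgn κ i x) := by
  have hκ : ∀ j, ∃ κ : VSp v' j →ₗ[ℂ] OutSp W v' j, j = i →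
      retMap sgn x j ∘ₗ κ = LinearMap.id := by
    intro j
    by_cases hj : j = i
    · subst hj
      obtain ⟨κ, hκ⟩ := LinearMap.exists_rightInverse_of_surjective _
        (LinearMap.range_eq_top.2 (surjective_retMap_of_eps_eq_zero (sgn := sgn) hx))
      exact ⟨κ, fun _ => hκ⟩
    · exact ⟨0, fun h => absurd h hj⟩
  choose κ hκ using hκ
  refine ⟨κ, ?_⟩
  have h4 : retMat sgn κ i x = 1 := hκ i rfl
  rw [h4]
  exact isUnit_one

section Regular

variable [∀ i, FiniteDimensional ℂ (W i)] {E : Type*} [AddCommGroup E] [Module ℂ E] {S : Set E}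
  {x : S → RepSpace W v'}

theorem isRegular_outMap (hx : IsRegular x) (j : I) : IsRegular fun a => outMap (x a) j :=
  hx.linear (linOut j)

theorem isRegular_retMap (hx : IsRegular x) (j : I) : IsRegular fun a => retMap sgn (x a) j :=
  hx.linear (linRet sgn j)

theorem isRegular_graphQuot {n : S → (j : I) → VSp v' j →ₗ[ℂ] VSp d j}
    (hn : ∀ j, IsRegular fun a => n a j) (j : I) : IsRegular fun a => graphQuot (n a) j :=
  (isRegular_const _).sub ((hn j).comp_linearMap (isRegular_const _))

theorem isRegular_glue {n : S → (j : I) → VSp v' j →ₗ[ℂ] VSp d j} {f : S → ExtSp W v' d}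
    (hx : IsRegular x) (hn : ∀ j, IsRegular fun a => n a j) (hf : ∀ j, IsRegular fun a => f a j) :
    IsRegular fun a => glue (x a) (n a) (f a) := by
  have hout : ∀ j, IsRegular fun a => glueOut (x a) (n a) (f a) j := fun j =>
    ((isRegular_outMap hx j).comp_linearMap (isRegular_const _)).add
      ((hf j).comp_linearMap (isRegular_graphQuot hn j))
  exact RepSpace.isRegular_of_components
    (fun i j _ => (isRegular_graphEmb hn j).comp_linearMap ((isRegular_const _).comp_linearMap
      ((isRegular_const _).comp_linearMap (hout i))))
    (fun i => (isRegular_const _).comp_linearMap (hout i))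
    (fun i => (isRegular_graphEmb hn i).comp_linearMap (hx.linear (RepSpace.linS i)))

theorem isRegular_inverse_retMat {κ : (j : I) → (VSp v' j →ₗ[ℂ] OutSp W v' j)}
    (hx : IsRegular x) (hκ : ∀ a, IsUnit (retMat sgn κ i (x a))) :
    IsRegular fun a => Ring.inverse (retMat sgn κ i (x a)) :=
  IsRegular.right_inverse (f := fun a => retMat sgn κ i (x a)) (hx.linear _)
    fun a => Ring.mul_inverse_cancel _ (hκ a)

theorem isRegular_of_ne {V : I → Type*} [∀ j, AddCommGroup (V j)] [∀ j, Module ℂ (V j)] {j : I}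
    (hj : j ≠ i) (f : S → (VSp (Pi.single i c : I → ℕ) j →ₗ[ℂ] V j)) : IsRegular f := by
  have := subsingleton_single (c := c) hj
  have h : f = fun _ => 0 := funext fun a => LinearMap.ext fun u => by
    rw [Subsingleton.elim u 0, map_zero, map_zero]
  rw [h]
  exact isRegular_const _

theorem isRegular_extProj {κ : (j : I) → (VSp v' j →ₗ[ℂ] OutSp W v' j)}
    {f : S → ExtSp W v' (Pi.single i c)} (hx : IsRegular x)
    (hκ : ∀ a, IsUnit (retMat sgn κ i (x a))) (hf : ∀ j, IsRegular fun a => f a j) (j : I) :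
    IsRegular fun a => extProj sgn κ (x a) (f a) j := by
  by_cases hj : j = i
  · subst hj
    exact (hf j).sub ((isRegular_const _).comp_linearMap
      ((isRegular_inverse_retMat hx hκ).comp_linearMap
      ((isRegular_retMap hx j).comp_linearMap (hf j))))
  · exact isRegular_of_ne (V := fun j => OutSp W v' j) hj _

end Regular

/-- An extension of a point of the Lagrangian subvariety by outgoing components in the kernel of
`(ε(τ) B_{τ̄}, s_j)` is in the Lagrangian subvariety if the outgoing maps are injective. -/
theorem glue_mem_lagSet {x' : RepSpace W v'} (hx' : x' ∈ lagSet sgn W v')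
    (n : (j : I) → VSp v' j →ₗ[ℂ] VSp d j) {f : ExtSp W v' d}
    (hf : ∀ j u, retMap sgn x' j (f j u) = 0)
    (ho : ∀ j, Function.Injective (outMap (glue x' n f) j)) :
    glue x' n f ∈ lagSet sgn W (v' + d) := by
  have hr : ∀ (i j : I) (τ : i ⟶ j) (u : VSp (v' + d) i),
      (glue x' n f).B τ u ∈ LinearMap.range (graphEmb n j) := fun i j τ u => ⟨_, rfl⟩
  have hm := glue_isMor n x' f
  exact ⟨⟨fun j => moment_glue sgn n (hx'.1.1 j) (hf j), hm.isStable_of_range hr ho hx'.1.2⟩,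
    fun j => (hm.s_eq_zero_iff (graphEmb_injective n) j).1 (hx'.2.1 j),
    hm.isNilpotent_of_range hr hx'.2.2⟩

theorem eps_glue [IsEmpty (i ⟶ i)] (x' : RepSpace W v')
    (n : (j : I) → VSp v' j →ₗ[ℂ] VSp (Pi.single i c : I → ℕ) j)
    (f : ExtSp W v' (Pi.single i c)) (hx' : x'.eps i = 0) : (glue x' n f).eps i = c := by
  have h := (glue_isMor n x' f).eps_add (graphEmb_injective n)
    (surjective_at_ne (graphEmb_injective n))
  have h2 : (v' + Pi.single i c : I → ℕ) i = v' i + c := by simp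
  omega

theorem isOpen_outMap_injective [∀ i, FiniteDimensional ℂ (W i)] :
    IsOpen {x : RepSpace W v | ∀ j, Function.Injective (outMap x j)} := by
  have h : {x : RepSpace W v | ∀ j, Function.Injective (outMap x j)} =
      ⋂ j, {x | Module.finrank ℂ (VSp v j) ≤ Module.finrank ℂ (LinearMap.range (linOut j x))} := by
    ext x
    rw [mem_iInter]
    exact forall_congr' fun j => injective_iff_le_finrank_range (outMap x j)
  rw [h]
  exact isOpen_iInter_of_finite fun j =>
    isOpen_le_finrank_range (E := RepSpace W v) (linOut j) (Module.finrank ℂ (VSp v j))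

/-- A point containing `x'` as the graph of `n` is an extension of `x'`. -/
theorem IsMor.isAdapted_and_res_eq [IsEmpty (i ⟶ i)]
    {n : (j : I) → VSp v' j →ₗ[ℂ] VSp (Pi.single i c : I → ℕ) j} {x' : RepSpace W v'}
    {x : RepSpace W (v' + Pi.single i c)} (h : IsMor (graphEmb n) x' x) (hx : x.eps i = c) :
    IsAdapted n x ∧ res n x = x' := by
  have hr := h.range_le (graphEmb_injective n) hx
  have key : ∀ j, ∀ y ∈ LinearMap.range (x.inMap j), graphQuot n j y = 0 := by
    intro j y hy
    obtain ⟨z, rfl⟩ := hr j hy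
    exact graphQuot_graphEmb n z
  refine ⟨⟨fun k j τ u => key j _ (B_mem_range_inMap x τ u),
    fun j w => key j _ (s_mem_range_inMap x j w)⟩, ?_⟩
  refine RepSpace.ext (fun k j τ => LinearMap.ext fun u => ?_) (fun j => LinearMap.ext fun u => ?_)
    (fun j => LinearMap.ext fun w => ?_)
  · change prl v' _ j (x.B τ (graphEmb n k u)) = _
    rw [← h.B_apply, prl_graphEmb]
  · exact (h.t_apply j u).symm
  · change prl v' _ j (x.s j w) = _
    rw [← h.s_apply, prl_graphEmb]

variable [IsEmpty (i ⟶ i)] [∀ i, FiniteDimensional ℂ (W i)]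

/-- The projection has a continuous local section through every point. -/
theorem isOpenMap_down : IsOpenMap (down (sgn := sgn) (W := W) (i := i) (c := c) (v' := v')) := by
  rintro _ ⟨U, hU, rfl⟩
  obtain ⟨O, hO, hOU⟩ := hU.preimage continuous_toLag
  rw [isOpen_iff_forall_mem_open]
  rintro _ ⟨q, hqU, rfl⟩
  obtain ⟨x, rfl⟩ := toStrat_surjective q
  obtain ⟨g, κ₀, hκ₀⟩ := exists_chart (sgn := sgn) x.2.2
  set y := g • x.1
  have hy : y ∈ stratLift sgn W i c (v' + Pi.single i c) :=
    ⟨smul_mem_lagSet g x.2.1, by rw [RepSpace.eps_smul]; exact x.2.2⟩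
  have hxy : toStrat x = toStrat ⟨y, hy⟩ := Subtype.ext (toLag_eq_iff.2 ⟨g, rfl⟩)
  rw [hxy] at hqU ⊢
  have ha := isAdapted_chartGraph hy.2 hκ₀
  set n := chartGraph sgn κ₀ y
  set x₀ := res n y
  set f := extPart y
  have hx₀ : x₀ ∈ lagSet sgn W v' := res_mem_lagSet ha hy.1
  have hd : down (toStrat ⟨y, hy⟩) = toLag ⟨x₀, hx₀⟩ := down_toStrat (graphEmb_injective n) ha.isMor
  have he : x₀.eps i = 0 := by
    have := eps_down (toStrat ⟨y, hy⟩)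
    rwa [hd] at this
  have hf : ∀ j u, retMap sgn x₀ j (f j u) = 0 := fun j u => retMap_extPart sgn _ ha (hy.1.1.1 j) u
  obtain ⟨κ, hκ⟩ := exists_isUnit_retMat (sgn := sgn) he
  let Y : Set (RepSpace W v') := {x' | x' ∈ lagSet sgn W v' ∧ IsUnit (retMat sgn κ i x')}
  -- A section of the projection through the given point: the component of `f` along the image of
  -- `κ` is removed.
  let σ : Y → RepSpace W (v' + Pi.single i c) := fun x' => glue x'.1 n (extProj sgn κ x'.1 f)
  have hσ : Continuous σ := (isRegular_glue isRegular_val (fun j => isRegular_const (n j))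
    (isRegular_extProj isRegular_val (fun x' => x'.2.2) fun j => isRegular_const (f j))).continuous
  have hσ₀ : σ ⟨x₀, hx₀, hκ⟩ = y := by
    change glue x₀ n (extProj sgn κ x₀ f) = y
    rw [extProj_eq_self hf]
    exact ha.glue_res
  obtain ⟨O', hO', hOσ⟩ := (hO.inter isOpen_outMap_injective).preimage hσ
  have hY : IsOpen {x' : RepSpace W v' | IsUnit (retMat sgn κ i x')} := by
    simp only [isUnit_iff_le_finrank_range]
    exact isOpen_le_finrank_range (retMat sgn κ i) _
  refine ⟨toLag '' (Subtype.val ⁻¹' (O' ∩ {x' | IsUnit (retMat sgn κ i x')})), ?_,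
    isOpenMap_toLag _ ((hO'.inter hY).preimage continuous_subtype_val), ?_⟩
  · rintro _ ⟨x', ⟨hx'O, hx'u⟩, rfl⟩
    have h1 : (⟨x'.1, x'.2, hx'u⟩ : Y) ∈ σ ⁻¹' (O ∩ {x | ∀ j, Function.Injective (outMap x j)}) :=
      hOσ ▸ hx'O
    have hz : σ ⟨x'.1, x'.2, hx'u⟩ ∈ stratLift sgn W i c (v' + Pi.single i c) :=
      ⟨glue_mem_lagSet x'.2 n (retMap_extProj hx'u f) h1.2,
        eps_glue _ _ _ (eps_eq_zero_of_isUnit hx'u)⟩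
    refine ⟨toStrat ⟨_, hz⟩, ?_, down_toStrat (graphEmb_injective n) (glue_isMor n _ _)⟩
    have h2 : (⟨_, hz.1⟩ : lagSet sgn W (v' + Pi.single i c)) ∈ Subtype.val ⁻¹' O := h1.1
    rw [hOU] at h2
    exact h2
  · rw [hd]
    refine ⟨⟨x₀, hx₀⟩, ⟨?_, hκ⟩, rfl⟩
    have h1 : (⟨x₀, hx₀, hκ⟩ : Y) ∈ σ ⁻¹' (O ∩ {x | ∀ j, Function.Injective (outMap x j)}) := by
      rw [mem_preimage, hσ₀]
      refine ⟨?_, outMap_injective hy.1.1.2⟩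
      have h2 : (⟨y, hy.1⟩ : lagSet sgn W (v' + Pi.single i c)) ∈ toLag ⁻¹' U := hqU
      rw [← hOU] at h2
      exact h2
    rw [← hOσ] at h1
    exact h1

/-- A fibre is the image of an open subset of the vector space of all `f` with values in the kernel
of `(ε(τ) B_{τ̄}, s_j)`. -/
theorem isPreirreducible_fiber_down (q' : Lagrangian sgn W v') :
    IsPreirreducible (down (i := i) (c := c) ⁻¹' {q'}) := by
  obtain he | hne := (down (i := i) (c := c) ⁻¹' {q'}).eq_empty_or_nonempty
  · rw [he]; exact isPreirreducible_empty
  have he : QuiverVariety.eps i q'.1 = 0 := by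
    obtain ⟨q, rfl⟩ := hne
    exact eps_down q
  obtain ⟨x', rfl⟩ := toLag_surjective q'
  let K : Submodule ℂ (ExtSp W v' (Pi.single i c)) :=
    { carrier := {f | ∀ j u, retMap sgn x'.1 j (f j u) = 0}
      zero_mem' := fun j u => by simp
      add_mem' := fun {f g} hf hg j u => by
        rw [Pi.add_apply, LinearMap.add_apply, map_add, hf, hg, add_zero]
      smul_mem' := fun a f hf j u => by
        rw [Pi.smul_apply, LinearMap.smul_apply, map_smul, hf, smul_zero] }
  let Θ : ↥(univ : Set ↥K) → RepSpace W (v' + Pi.single i c) := fun f =>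
    glue x'.1 0 (K.subtype f.1)
  have hΘ : IsRegular Θ := isRegular_glue (isRegular_const _) (fun j => isRegular_const _)
    fun j => isRegular_val.linear (E := ↥K) (show ↥K →ₗ[ℂ] _ from
      LinearMap.proj (R := ℂ) (φ := fun j => VSp (Pi.single i c : I → ℕ) j →ₗ[ℂ] OutSp W v' j) j ∘ₗ
        K.subtype)
  have hR := (isIrreducible_iff_zariskiIrreducible.2 (zariskiIrreducible_univ.range hΘ)).2
  let R : Set (RepSpace W (v' + Pi.single i c)) :=
    Set.range Θ ∩ {x | ∀ j, Function.Injective (outMap x j)}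
  have hRJ : IsPreirreducible R := by
    rintro u w hu hw ⟨a, ⟨ha, haJ⟩, hau⟩ ⟨b, ⟨hb, hbJ⟩, hbw⟩
    obtain ⟨z, hz, h1, h2⟩ := hR _ _ (hu.inter isOpen_outMap_injective)
      (hw.inter isOpen_outMap_injective) ⟨a, ha, hau, haJ⟩ ⟨b, hb, hbw, hbJ⟩
    exact ⟨z, ⟨hz, h1.2⟩, h1.1, h2.1⟩
  have hRs : R ⊆ stratLift sgn W i c (v' + Pi.single i c) := by
    rintro _ ⟨⟨f, rfl⟩, hJ⟩
    exact ⟨glue_mem_lagSet x'.2 0 f.1.2 hJ, eps_glue _ _ _ he⟩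
  convert (isPreirreducible_preimage_val hRJ hRs).image toStrat continuous_toStrat.continuousOn
  ext q
  constructor
  · rintro hq
    obtain ⟨x, rfl⟩ := toStrat_surjective q
    have hH := heckeRel_iff_down_eq.2 hq
    obtain ⟨φ, hφ, hm⟩ := HeckeRel.exists_isMor (x' := ⟨x'.1, x'.2.1⟩) (x := ⟨x.1, x.2.1.1⟩) hH
    choose g hg using fun j => exists_linearEquiv_comp_eq (hφ j)
      (Function.LeftInverse.injective (g := prl v' (Pi.single i c) j) prl_incl)
    have hy : g • x.1 ∈ stratLift sgn W i c (v' + Pi.single i c) :=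
      ⟨smul_mem_lagSet _ x.2.1, by rw [RepSpace.eps_smul]; exact x.2.2⟩
    have hm' : IsMor (graphEmb 0) x'.1 ((g : GaugeGroup (v' + Pi.single i c)) • x.1) := by
      convert hm.smul_right g using 1
      funext j
      refine LinearMap.ext fun u => ?_
      rw [LinearMap.comp_apply]
      exact (by simp [graphEmb] : graphEmb 0 j u = incl v' _ j u).trans (hg j u).symm
    obtain ⟨ha, hres⟩ := hm'.isAdapted_and_res_eq hy.2
    have hK : extPart ((g : GaugeGroup (v' + Pi.single i c)) • x.1) ∈ K := fun j u => by
      rw [← hres]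
      exact retMap_extPart sgn _ ha (hy.1.1.1 j) u
    refine ⟨⟨_, hy⟩, ⟨⟨⟨⟨_, hK⟩, mem_univ _⟩, ?_⟩,
      outMap_injective hy.1.1.2⟩, Subtype.ext (toLag_eq_iff.2 ⟨g⁻¹, inv_smul_smul _ _⟩)⟩
    · change glue x'.1 0 (extPart _) = _
      rw [← hres]
      exact ha.glue_res
  · rintro ⟨x, ⟨⟨f, hf⟩, -⟩, rfl⟩
    refine down_toStrat (graphEmb_injective 0) (φ := graphEmb 0) ?_
    rw [← hf]
    exact glue_isMor _ _ _

/-- A point with `ε_i = 0` has an extension in the Lagrangian subvariety if `c` is not too large. -/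
theorem exists_glue_injective (hc : 2 * v' i + c ≤ Module.finrank ℂ (OutSp W v' i))
    {x' : RepSpace W v'} (hx' : x' ∈ lagSet sgn W v') (he : x'.eps i = 0) :
    ∃ f : ExtSp W v' (Pi.single i c), (∀ j u, retMap sgn x' j (f j u) = 0) ∧
      ∀ j, Function.Injective (outMap (glue x' 0 f) j) := by
  have h : ∀ j, v' j + (Pi.single i c : I → ℕ) j ≤
      Module.finrank ℂ (LinearMap.ker (retMap sgn x' j)) := by
    intro j
    by_cases hj : j = i
    · subst hj
      have h1 := (retMap sgn x' j).finrank_range_add_finrank_ker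
      rw [LinearMap.range_eq_top.2 (surjective_retMap_of_eps_eq_zero he), finrank_top,
        Module.finrank_fin_fun] at h1
      rw [Pi.single_eq_same]
      omega
    · have h1 : LinearMap.range (outMap x' j) ≤ LinearMap.ker (retMap sgn x' j) := by
        rintro _ ⟨u, rfl⟩
        have := hx'.1.1 j
        rw [moment_eq_retMap_comp_outMap] at this
        exact LinearMap.congr_fun this u
      have h2 := Submodule.finrank_mono h1
      rw [LinearMap.finrank_range_of_inj (outMap_injective hx'.1.2 j), Module.finrank_fin_fun] at h2
      simpa [hj] using h2
  choose f hf hinj using fun j => exists_extension sgn (hx'.1.1 j) hx'.1.2 (h j)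
  refine ⟨f, hf, fun j => ?_⟩
  have h1 : glueOut x' 0 f j = outMap x' j ∘ₗ prl v' (Pi.single i c) j + f j ∘ₗ prr v' _ j := by
    simp [glueOut, graphQuot]
  intro a b hab
  rw [outMap_glue, outMap_glue] at hab
  have h2 := outSpMap_injective (graphEmb_injective 0) j hab
  rw [h1] at h2
  exact hinj j h2

/-- The fibre over a point with `ε_i = 0` is non-empty if `c` is not too large. -/
theorem exists_down_eq (hc : 2 * v' i + c ≤ Module.finrank ℂ (OutSp W v' i))
    {q' : Lagrangian sgn W v'} (hq' : QuiverVariety.eps i q'.1 = 0) :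
    ∃ q : stratum sgn W i c (v' + Pi.single i c), down q = q' := by
  obtain ⟨x', rfl⟩ := toLag_surjective q'
  obtain ⟨f, hf, ho⟩ := exists_glue_injective hc x'.2 hq'
  exact ⟨toStrat ⟨_, glue_mem_lagSet x'.2 0 hf ho, eps_glue _ _ _ hq'⟩,
    down_toStrat (graphEmb_injective 0) (glue_isMor 0 _ _)⟩

/-- The existence of a point with `ε_i = c` bounds `c`. -/
theorem le_finrank_outSp (q : QuiverVariety sgn W (v' + Pi.single i c))
    (hq : QuiverVariety.eps i q = c) : 2 * v' i + c ≤ Module.finrank ℂ (OutSp W v' i) := by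
  obtain ⟨x, rfl⟩ : ∃ x, QuiverVariety.mk x = q := Quotient.exists_rep q
  have h1 : LinearMap.range (outMap x.1 i) ≤ LinearMap.ker (retMap sgn x.1 i) := by
    rintro _ ⟨u, rfl⟩
    have := x.2.1 i
    rw [moment_eq_retMap_comp_outMap] at this
    exact LinearMap.congr_fun this u
  have h2 := Submodule.finrank_mono h1
  rw [LinearMap.finrank_range_of_inj (outMap_injective x.2.2 i), Module.finrank_fin_fun] at h2
  have h3 := (retMap sgn x.1 i).finrank_range_add_finrank_ker
  rw [range_retMap, finrank_range_inMap hq, finrank_outSp_add_single] at h3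
  have h4 : (v' + Pi.single i c : I → ℕ) i = v' i + c := by simp
  omega

end Fibres

/-! ### The dimension of the preimage of a subset under the projection -/

section Poly

variable {E : Type*} [AddCommGroup E] [Module ℂ E] {S : Set E}

theorem hasDim_inter_ne_zero_iff (hS : ZariskiIrreducible S) {q : E → ℂ}
    (hq : q ∈ polynomialFunctions E) (hne : ∃ x ∈ S, q x ≠ 0) {n : ℕ} :
    HasDim {x ∈ S | q x ≠ 0} n ↔ HasDim S n :=
  HasDim.of_dense (sep_subset _ _) fun f hf h0 x hx => by
    by_contra hfx
    obtain ⟨z, hz, h1, h2⟩ := hS.2 f hf q hq ⟨x, hx, hfx⟩ hne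
    exact h1 (h0 z ⟨hz, h2⟩)

theorem exists_polynomial_ne_zero_iff {r : S → ℂ} (hr : r ∈ regularRing S) :
    ∃ p ∈ polynomialFunctions E, ∀ x : S, p x ≠ 0 ↔ r x ≠ 0 := by
  obtain ⟨p, hp, q, hq, h⟩ := hr
  refine ⟨p, hp, fun x => ?_⟩
  rw [← (h x).2, mul_ne_zero_iff]
  exact and_iff_left (h x).1

theorem det_mem_polynomialFunctions {m : ℕ}
    (L : E →ₗ[ℂ] ((Fin m → ℂ) →ₗ[ℂ] (Fin m → ℂ))) :
    (fun x => LinearMap.det (L x)) ∈ polynomialFunctions E := by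
  have h := (det_mem_of_forall_mem (polynomialFunctions E)
    (M := fun x => LinearMap.toMatrix' (L x)) fun i j =>
      dual_mem_polynomialFunctions (LinearMap.proj (R := ℂ) (φ := fun _ : Fin m => ℂ) i ∘ₗ
        (LinearMap.applyₗ (Pi.single j (1 : ℂ)) : ((Fin m → ℂ) →ₗ[ℂ] (Fin m → ℂ)) →ₗ[ℂ] _) ∘ₗ
          L)).1
  simpa only [LinearMap.det_toMatrix'] using h

theorem isUnit_iff_det_ne_zero {m : ℕ} (f : (Fin m → ℂ) →ₗ[ℂ] (Fin m → ℂ)) :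
    IsUnit f ↔ LinearMap.det f ≠ 0 := by
  rw [LinearMap.isUnit_iff_isUnit_det, isUnit_iff_ne_zero]

end Poly

section Chart

variable {I : Type*} [Fintype I] [DecidableEq I] [Quiver I] [Quiver.HasInvolutiveReverse I]
  [∀ i j : I, Fintype (i ⟶ j)] (sgn : (i j : I) → (i ⟶ j) → ℂˣ)
  {W : I → Type*} [∀ i, AddCommGroup (W i)] [∀ i, Module ℂ (W i)]
  {i : I} {c : ℕ} {v' d : I → ℕ}

/-- A section of the map `(ε(τ) B_{τ̄}, s_j)` at points of the representation space of `V'`, viewed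
in the representation space of `V' ⊕ C`. -/
def upSection (d : I → ℕ) (κ : (j : I) → (VSp v' j →ₗ[ℂ] OutSp W v' j)) (j : I) :
    VSp v' j →ₗ[ℂ] OutSp W (v' + d) j :=
  outSpMap (incl v' d) j ∘ₗ κ j

variable (κ : (j : I) → (VSp v' j →ₗ[ℂ] OutSp W v' j))
  (θ : (j : I) → (VSp d j →ₗ[ℂ] VSp v' j) ≃ₗ[ℂ] (VSp v' j →ₗ[ℂ] VSp d j))

/-- The chart sending `(x', f)` to the extension of `x'` by the component of `f` in the kernel of
`(ε(τ) B_{τ̄}, s_j)` in which `x'` is embedded as the graph of a map obtained from the remaining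
component of `f` via the identification `θ` of vector spaces of the same dimension. -/
def extChart (t : RepSpace W v' × ExtSp W v' d) : RepSpace W (v' + d) :=
  glue t.1 (fun j => θ j (retMap sgn t.1 j ∘ₗ t.2 j)) (extProj sgn κ t.1 t.2)

/-- The inverse of the chart `extChart`. -/
def extChartInv (x : RepSpace W (v' + d)) : RepSpace W v' × ExtSp W v' d :=
  (res (chartGraph sgn (upSection d κ) x) x, fun j =>
    extPart x j + κ j ∘ₗ
      Ring.inverse (retMat sgn κ j (res (chartGraph sgn (upSection d κ) x) x)) ∘ₗ
        (θ j).symm (chartGraph sgn (upSection d κ) x j))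

variable {sgn κ θ}

section

variable [IsEmpty (i ⟶ i)]

theorem retMap_outSpMap_incl {n : (j : I) → VSp v' j →ₗ[ℂ] VSp (Pi.single i c : I → ℕ) j}
    {x' : RepSpace W v'} {x : RepSpace W (v' + Pi.single i c)} (h : IsMor (graphEmb n) x' x)
    (y : OutSp W v' i) :
    retMap sgn x i (outSpMap (incl v' (Pi.single i c)) i y) =
      graphEmb n i (retMap sgn x' i y) := by
  rw [h.retMap_apply]
  congr 1
  rw [outSpMap_apply, outSpMap_apply]
  refine Prod.ext (funext fun p => ?_) rfl
  have hp : p.1 ≠ i := fun hp => IsEmpty.false (α := i ⟶ i) (cast (by rw [hp]) p.2)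
  have := subsingleton_single (c := c) hp
  have h0 : n p.1 (y.1 p) = 0 := Subsingleton.elim _ _
  simp [graphEmb, h0]

theorem chartMat_upSection {n : (j : I) → VSp v' j →ₗ[ℂ] VSp (Pi.single i c : I → ℕ) j}
    {x' : RepSpace W v'} {x : RepSpace W (v' + Pi.single i c)} (h : IsMor (graphEmb n) x' x) :
    chartMat sgn (upSection _ κ) i x = retMat sgn κ i x' := by
  refine LinearMap.ext fun u => ?_
  change prl v' _ i (retMap sgn x i (outSpMap (incl v' _) i (κ i u))) = _
  rw [retMap_outSpMap_incl h, prl_graphEmb]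
  rfl

theorem chartGraph_upSection {n : (j : I) → VSp v' j →ₗ[ℂ] VSp (Pi.single i c : I → ℕ) j}
    {x' : RepSpace W v'} {x : RepSpace W (v' + Pi.single i c)} (h : IsMor (graphEmb n) x' x)
    (hκ : IsUnit (retMat sgn κ i x')) : chartGraph sgn (upSection _ κ) x = n := by
  refine funext fun j => LinearMap.ext fun u => ?_
  by_cases hj : j = i
  · subst hj
    rw [chartGraph, chartMat_upSection h]
    set w : VSp v' j := (Ring.inverse (retMat sgn κ j x') : VSp v' j →ₗ[ℂ] VSp v' j) u
    change prr v' _ j (retMap sgn x j (outSpMap (incl v' _) j (κ j w))) = _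
    rw [retMap_outSpMap_incl h, prr_graphEmb]
    exact congrArg (n j) (LinearMap.congr_fun (Ring.mul_inverse_cancel _ hκ) u)
  · have := subsingleton_single (c := c) hj
    exact Subsingleton.elim _ _

variable {θ : (j : I) → (VSp (Pi.single i c : I → ℕ) j →ₗ[ℂ] VSp v' j) ≃ₗ[ℂ]
  (VSp v' j →ₗ[ℂ] VSp (Pi.single i c : I → ℕ) j)}

theorem extChartInv_extChart {t : RepSpace W v' × ExtSp W v' (Pi.single i c)}
    (hκ : IsUnit (retMat sgn κ i t.1)) :
    extChartInv sgn κ θ (extChart sgn κ θ t) = t := by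
  have h1 := chartGraph_upSection (glue_isMor (fun j => θ j (retMap sgn t.1 j ∘ₗ t.2 j)) t.1
    (extProj sgn κ t.1 t.2)) hκ
  change chartGraph sgn (upSection _ κ) (extChart sgn κ θ t) = _ at h1
  have h2 : res (fun j => θ j (retMap sgn t.1 j ∘ₗ t.2 j)) (extChart sgn κ θ t) = t.1 :=
    res_glue _ _ _
  have h3 : extPart (extChart sgn κ θ t) = extProj sgn κ t.1 t.2 := extPart_glue _ _ _
  refine Prod.ext ?_ (funext fun j => ?_)
  · change res (chartGraph sgn (upSection _ κ) (extChart sgn κ θ t)) _ = _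
    rw [h1, h2]
  · simp only [extChartInv]
    rw [h1, h2, h3, LinearEquiv.symm_apply_apply, extProj, sub_add_cancel]

theorem retMap_comp_extChartInv {x : RepSpace W (v' + Pi.single i c)}
    (hx : x ∈ stratLift sgn W i c (v' + Pi.single i c))
    (hκ : IsUnit (chartMat sgn (upSection _ κ) i x)) (j : I) :
    retMap sgn (extChartInv sgn κ θ x).1 j ∘ₗ (extChartInv sgn κ θ x).2 j =
      (θ j).symm (chartGraph sgn (upSection _ κ) x j) := by
  by_cases hj : j = i
  · subst hj
    have ha := isAdapted_chartGraph hx.2 hκ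
    rw [chartMat_upSection ha.isMor] at hκ
    refine LinearMap.ext fun u => ?_
    simp only [extChartInv]
    rw [LinearMap.comp_apply, LinearMap.add_apply, map_add,
      retMap_extPart sgn _ ha (hx.1.1.1 j), zero_add]
    exact LinearMap.congr_fun (Ring.mul_inverse_cancel _ hκ) _
  · have := subsingleton_single (c := c) hj
    refine LinearMap.ext fun u => ?_
    rw [Subsingleton.elim u 0, map_zero, map_zero]

theorem extChart_extChartInv {x : RepSpace W (v' + Pi.single i c)}
    (hx : x ∈ stratLift sgn W i c (v' + Pi.single i c))
    (hκ : IsUnit (chartMat sgn (upSection _ κ) i x)) :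
    extChart sgn κ θ (extChartInv sgn κ θ x) = x := by
  have ha := isAdapted_chartGraph hx.2 hκ
  have h1 : extProj sgn κ (extChartInv sgn κ θ x).1 (extChartInv sgn κ θ x).2 = extPart x := by
    refine funext fun j => ?_
    rw [extProj, retMap_comp_extChartInv hx hκ]
    exact add_sub_cancel_right _ _
  rw [extChart, h1]
  simp only [retMap_comp_extChartInv hx hκ, LinearEquiv.apply_symm_apply]
  exact ha.glue_res

end

section Dimension

variable [IsEmpty (i ⟶ i)] [∀ i, FiniteDimensional ℂ (W i)]
  {θ : (j : I) → (VSp (Pi.single i c : I → ℕ) j →ₗ[ℂ] VSp v' j) ≃ₗ[ℂ]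
    (VSp v' j →ₗ[ℂ] VSp (Pi.single i c : I → ℕ) j)}

theorem isRegular_extChart {S : Set (RepSpace W v' × ExtSp W v' (Pi.single i c))}
    (hS : ∀ t ∈ S, IsUnit (retMat sgn κ i t.1)) :
    IsRegular fun t : S => extChart sgn κ θ t.1 := by
  have h1 : IsRegular fun t : S => t.1.1 :=
    isRegular_val.linear (LinearMap.fst ℂ (RepSpace W v') (ExtSp W v' (Pi.single i c)))
  have h2 : IsRegular fun t : S => t.1.2 :=
    isRegular_val.linear (LinearMap.snd ℂ (RepSpace W v') (ExtSp W v' (Pi.single i c)))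
  have h3 : ∀ j, IsRegular fun t : S => t.1.2 j := fun j => h2.linear (LinearMap.proj (R := ℂ)
    (φ := fun j => VSp (Pi.single i c : I → ℕ) j →ₗ[ℂ] OutSp W v' j) j)
  exact isRegular_glue h1
    (fun j => ((isRegular_retMap h1 j).comp_linearMap (h3 j)).linear (θ j).toLinearMap)
    (isRegular_extProj h1 (fun t => hS t.1 t.2) h3)

/-- The outgoing components on `C_j` as a linear function of the point. -/
def linExtPart {d : I → ℕ} (j : I) :
    RepSpace W (v' + d) →ₗ[ℂ] (VSp d j →ₗ[ℂ] OutSp W v' j) where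
  toFun x := extPart x j
  map_add' _ _ := LinearMap.ext fun _ => Prod.ext (funext fun p => map_add (prl v' d p.1) _ _) rfl
  map_smul' _ _ := LinearMap.ext fun _ => Prod.ext (funext fun p => map_smul (prl v' d p.1) _ _) rfl

theorem isRegular_extPart {d : I → ℕ} {S : Set (RepSpace W (v' + d))} (j : I) :
    IsRegular fun x : S => extPart x.1 j :=
  IsRegular.linear (f := fun x : S => x.1) isRegular_val (linExtPart (d := d) j)

theorem isRegular_extChartInv {S : Set (RepSpace W (v' + Pi.single i c))}
    (hS : ∀ x ∈ S, x ∈ stratLift sgn W i c (v' + Pi.single i c) ∧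
      IsUnit (chartMat sgn (upSection _ κ) i x)) :
    IsRegular fun x : S => extChartInv sgn κ θ x.1 := by
  have hn := fun j => isRegular_chartGraph (sgn := sgn) (fun x hx => (hS x hx).2) j
  have hres := isRegular_res hn
  refine hres.prodMk (IsRegular.pi fun j => ?_)
  by_cases hj : j = i
  · subst hj
    refine (isRegular_extPart j).add ((isRegular_const _).comp_linearMap
      (IsRegular.comp_linearMap ?_ ((hn j).linear (θ j).symm.toLinearMap)))
    refine isRegular_inverse_retMat hres fun x => ?_
    rw [← chartMat_upSection (isAdapted_chartGraph (hS x.1 x.2).1.2 (hS x.1 x.2).2).isMor]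
    exact (hS x.1 x.2).2
  · exact isRegular_of_ne (V := fun j => OutSp W v' j) hj _

theorem exists_polynomial_outMap_injective {v : I → ℕ} {x₀ : RepSpace W v}
    (h : ∀ j, Function.Injective (outMap x₀ j)) :
    ∃ p ∈ polynomialFunctions (RepSpace W v), p x₀ ≠ 0 ∧
      ∀ x, p x ≠ 0 → ∀ j, Function.Injective (outMap x j) := by
  choose p hp hp0 hpx using fun j =>
    exists_polynomial_le_finrank_range (linOut (W := W) (v := v) j) (x₀ := x₀)
      ((injective_iff_le_finrank_range (outMap x₀ j)).1 (h j))
  refine ⟨∏ j, p j, prod_mem fun j _ => hp j, ?_, fun x hx j => ?_⟩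
  · rw [Finset.prod_apply]
    exact Finset.prod_ne_zero_iff.2 fun j _ => hp0 j
  · rw [Finset.prod_apply] at hx
    exact (injective_iff_le_finrank_range (outMap x j)).2
      (hpx j x (Finset.prod_ne_zero_iff.1 hx j (Finset.mem_univ j)))

theorem finrank_extSp : Module.finrank ℂ (ExtSp W v' (Pi.single i c)) =
    c * Module.finrank ℂ (OutSp W v' i) := by
  rw [Module.finrank_pi_fintype, Finset.sum_eq_single i]
  · rw [Module.finrank_linearMap, Module.finrank_fin_fun, Pi.single_eq_same]
  · intro j _ hj
    rw [Module.finrank_linearMap, Module.finrank_fin_fun, Pi.single_eq_of_ne hj, zero_mul]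
  · simp

variable (i c) in
/-- The preimage of a subset of the Lagrangian subvariety under the projection. -/
def upSet (S : Set (Lagrangian sgn W v')) :
    Set (Lagrangian sgn W (v' + Pi.single i c)) :=
  Subtype.val '' (down (i := i) (c := c) ⁻¹' S)

theorem mem_lift_upSet_iff {S : Set (Lagrangian sgn W v')}
    {n : (j : I) → VSp v' j →ₗ[ℂ] VSp (Pi.single i c : I → ℕ) j} {x' : RepSpace W v'}
    {x : RepSpace W (v' + Pi.single i c)} (h : IsMor (graphEmb n) x' x)
    (hx : x ∈ stratLift sgn W i c (v' + Pi.single i c)) :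
    x ∈ lift (upSet i c S) ↔ x' ∈ lift S := by
  have hx' : x' ∈ lagSet sgn W v' := mem_lagSet_of_isMor h (graphEmb_injective n) hx.1
  have hd : down (toStrat ⟨x, hx⟩) = toLag ⟨x', hx'⟩ := down_toStrat (graphEmb_injective n) h
  rw [mem_lift, mem_lift]
  constructor
  · rintro ⟨h1, q, hq, hqx⟩
    have : q = toStrat ⟨x, hx⟩ := Subtype.ext hqx
    subst this
    exact ⟨hx', hd ▸ hq⟩
  · rintro ⟨h1, h2⟩
    exact ⟨hx.1, toStrat ⟨x, hx⟩, by rw [mem_preimage, hd]; exact h2, rfl⟩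

theorem lift_upSet_subset (S : Set (Lagrangian sgn W v')) :
    lift (upSet i c S) ⊆ stratLift sgn W i c (v' + Pi.single i c) := by
  intro x hx
  obtain ⟨h1, q, hq, hqx⟩ := mem_lift.1 hx
  refine ⟨h1, ?_⟩
  have := q.2
  rw [hqx] at this
  exact this

theorem isIrreducible_upSet (hc : 2 * v' i + c ≤ Module.finrank ℂ (OutSp W v' i))
    {S : Set (Lagrangian sgn W v')} (hS : IsIrreducible S)
    (hS0 : ∀ q ∈ S, QuiverVariety.eps i q.1 = 0) : IsIrreducible (upSet i c S) := by
  refine IsIrreducible.image ?_ _ continuous_subtype_val.continuousOn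
  refine hS.preimage_of_isPreirreducible_fiber down isOpenMap_down isPreirreducible_fiber_down ?_
  obtain ⟨q', hq'⟩ := hS.1
  exact ⟨q', hq', exists_down_eq hc (hS0 q' hq')⟩

/-- Taking the preimage under `down` raises the dimension by `c` times the dimension of the outgoing
space: `extChart` identifies principal open subsets of the lift of the preimage and of the product
of the lift of `S` with the vector space `ExtSp`. -/
theorem hasDim_lift_upSet (hc : 2 * v' i + c ≤ Module.finrank ℂ (OutSp W v' i))
    {S : Set (Lagrangian sgn W v')} (hS : IsIrreducible S)
    (hS0 : ∀ q ∈ S, QuiverVariety.eps i q.1 = 0) {n : ℕ} (hn : HasDim (lift S) n) :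
    HasDim (lift (upSet i c S)) (n + c * Module.finrank ℂ (OutSp W v' i)) := by
  obtain ⟨q₀, hq₀⟩ := hS.1
  obtain ⟨x₀, rfl⟩ := toLag_surjective q₀
  have he₀ : x₀.1.eps i = 0 := hS0 _ hq₀
  obtain ⟨κ, hκ⟩ := exists_isUnit_retMat (sgn := sgn) he₀
  obtain ⟨f₀, hf₀, ho₀⟩ := exists_glue_injective hc x₀.2 he₀
  obtain ⟨p, hp, hp0, hpx⟩ := exists_polynomial_outMap_injective ho₀
  let θ : (j : I) → (VSp (Pi.single i c : I → ℕ) j →ₗ[ℂ] VSp v' j) ≃ₗ[ℂ]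
      (VSp v' j →ₗ[ℂ] VSp (Pi.single i c : I → ℕ) j) := fun j =>
    LinearEquiv.ofFinrankEq _ _
      (by rw [Module.finrank_linearMap, Module.finrank_linearMap, mul_comm])
  -- The domain of the chart: a non-empty principal open subset of the product.
  let t₀ : RepSpace W v' × ExtSp W v' (Pi.single i c) := (x₀.1, f₀)
  have ht₀ : extChart sgn κ θ t₀ = glue x₀.1 0 f₀ := by
    rw [extChart, extProj_eq_self hf₀]
    congr 1
    funext j
    have : retMap sgn x₀.1 j ∘ₗ f₀ j = 0 := LinearMap.ext (hf₀ j)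
    change θ j (retMap sgn x₀.1 j ∘ₗ f₀ j) = 0
    rw [this, map_zero]
  obtain ⟨hirr, hdim⟩ := irreducible_and_hasDim_prod_univ (F := ExtSp W v' (Pi.single i c))
    (zariskiIrreducible_lift hS) hn
  rw [finrank_extSp] at hdim
  have hx₀S : x₀.1 ∈ lift S := mem_lift.2 ⟨x₀.2, hq₀⟩
  let δ : RepSpace W v' × ExtSp W v' (Pi.single i c) → ℂ := fun t =>
    LinearMap.det (retMat sgn κ i t.1)
  have hδ : δ ∈ polynomialFunctions _ := det_mem_polynomialFunctions
    (retMat sgn κ i ∘ₗ LinearMap.fst ℂ (RepSpace W v') (ExtSp W v' (Pi.single i c)))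
  have hδ₀ : ∃ t ∈ lift S ×ˢ (univ : Set (ExtSp W v' (Pi.single i c))), δ t ≠ 0 :=
    ⟨t₀, ⟨hx₀S, mem_univ _⟩, (isUnit_iff_det_ne_zero _).1 hκ⟩
  have hirr₁ := hirr.inter_ne_zero hδ hδ₀
  have hdim₁ := (hasDim_inter_ne_zero_iff hirr hδ hδ₀).2 hdim
  set T₁ := {t ∈ lift S ×ˢ (univ : Set (ExtSp W v' (Pi.single i c))) | δ t ≠ 0} with hT₁
  have hσ : IsRegular fun t : T₁ => extChart sgn κ θ t.1 :=
    isRegular_extChart fun t ht => (isUnit_iff_det_ne_zero _).2 ht.2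
  obtain ⟨P, hP, hPσ⟩ := exists_polynomial_ne_zero_iff
    (mem_regularRing_of_mem_polynomialFunctions hσ hp)
  have hP₀ : ∃ t ∈ T₁, P t ≠ 0 := by
    have h1 : t₀ ∈ T₁ := ⟨⟨hx₀S, mem_univ _⟩, (isUnit_iff_det_ne_zero _).1 hκ⟩
    refine ⟨t₀, h1, (hPσ ⟨t₀, h1⟩).2 ?_⟩
    change p (extChart sgn κ θ t₀) ≠ 0
    rw [ht₀]
    exact hp0
  have hirr₂ := hirr₁.inter_ne_zero hP hP₀
  have hdim₂ := (hasDim_inter_ne_zero_iff hirr₁ hP hP₀).2 hdim₁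
  set T := {t ∈ T₁ | P t ≠ 0} with hT
  -- The image of the chart: a principal open subset of the preimage.
  let Δ : RepSpace W (v' + Pi.single i c) → ℂ := fun x =>
    LinearMap.det (chartMat sgn (upSection _ κ) i x) * p x
  have hΔ : Δ ∈ polynomialFunctions _ := mul_mem (det_mem_polynomialFunctions _) hp
  have hΔ' : ∀ x, Δ x ≠ 0 ↔ IsUnit (chartMat sgn (upSection _ κ) i x) ∧ p x ≠ 0 := fun x => by
    rw [isUnit_iff_det_ne_zero, mul_ne_zero_iff]
  let Z : Set (RepSpace W (v' + Pi.single i c)) := {x ∈ lift (upSet i c S) | Δ x ≠ 0}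
  have hforward : ∀ t ∈ T, extChart sgn κ θ t ∈ Z := by
    rintro t ht
    have hu : IsUnit (retMat sgn κ i t.1) := (isUnit_iff_det_ne_zero _).2 ht.1.2
    have hpt : p (extChart sgn κ θ t) ≠ 0 := (hPσ ⟨t, ht.1⟩).1 ht.2
    have hm : IsMor (graphEmb fun j => θ j (retMap sgn t.1 j ∘ₗ t.2 j)) t.1
        (extChart sgn κ θ t) := glue_isMor _ _ _
    obtain ⟨hL, -⟩ := mem_lift.1 ht.1.1.1
    have hs : extChart sgn κ θ t ∈ stratLift sgn W i c (v' + Pi.single i c) :=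
      ⟨glue_mem_lagSet hL _ (retMap_extProj hu t.2) (hpx _ hpt),
        eps_glue _ _ _ (eps_eq_zero_of_isUnit hu)⟩
    exact ⟨(mem_lift_upSet_iff hm hs).2 ht.1.1.1,
      (hΔ' _).2 ⟨by rw [chartMat_upSection hm]; exact hu, hpt⟩⟩
  have hbackward : ∀ x ∈ Z, extChartInv sgn κ θ x ∈ T := by
    rintro x ⟨hxS, hxΔ⟩
    obtain ⟨hu, hpx'⟩ := (hΔ' x).1 hxΔ
    have hs := lift_upSet_subset S hxS
    have hm := (isAdapted_chartGraph hs.2 hu).isMor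
    have h1 : extChartInv sgn κ θ x ∈ T₁ :=
      ⟨⟨(mem_lift_upSet_iff hm hs).1 hxS, mem_univ _⟩,
        (isUnit_iff_det_ne_zero _).1 (by rw [chartMat_upSection hm] at hu; exact hu)⟩
    refine ⟨h1, (hPσ ⟨_, h1⟩).2 ?_⟩
    change p (extChart sgn κ θ (extChartInv sgn κ θ x)) ≠ 0
    rw [extChart_extChartInv hs hu]
    exact hpx'
  let e : T ≃ Z :=
    { toFun := fun t => ⟨_, hforward t.1 t.2⟩
      invFun := fun x => ⟨_, hbackward x.1 x.2⟩
      left_inv := fun t => Subtype.ext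
        (extChartInv_extChart ((isUnit_iff_det_ne_zero _).2 t.2.1.2))
      right_inv := fun x => Subtype.ext
        (extChart_extChartInv (lift_upSet_subset S x.2.1) ((hΔ' _).1 x.2.2).1) }
  have hZ₀ : ∃ x ∈ lift (upSet i c S), Δ x ≠ 0 := by
    obtain ⟨t, ht⟩ := hirr₂.1
    exact ⟨_, hforward t ht⟩
  have hirrZ := zariskiIrreducible_lift (isIrreducible_upSet hc hS hS0)
  refine (hasDim_inter_ne_zero_iff hirrZ hΔ hZ₀).1
    ((HasDim.of_biregular hirr₂ (hirrZ.inter_ne_zero hΔ hZ₀) e ?_ ?_).1 hdim₂)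
  · exact isRegular_extChart fun t ht => (isUnit_iff_det_ne_zero _).2 ht.1.2
  · exact isRegular_extChartInv fun x hx => ⟨lift_upSet_subset S hx.1, ((hΔ' _).1 hx.2).1⟩

end Dimension

end Chart

/-! ### Purity of dimension and the correspondence of components -/

section Components

variable {I : Type*} [Fintype I] [DecidableEq I] [Quiver I] [Quiver.HasInvolutiveReverse I]
  [∀ i j : I, Fintype (i ⟶ j)] {sgn : (i j : I) → (i ⟶ j) → ℂˣ}
  {W : I → Type*} [∀ i, AddCommGroup (W i)] [∀ i, Module ℂ (W i)]
  [∀ i, FiniteDimensional ℂ (W i)] {i : I} {c : ℕ} {v v' : I → ℕ}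

/-- The points of a component with a given value of `ε_i`. -/
def Comp.epsPart (Z : Comp sgn W v) (i : I) (c : ℕ) : Set (Lagrangian sgn W v) :=
  {q ∈ Z.1 | QuiverVariety.eps i q.1 = c}

theorem Comp.epsPart_eq_inter {Z : Comp sgn W v} (hZ : Z.HasGenericEps i c) :
    Z.epsPart i c = Z.1 ∩ {q | QuiverVariety.eps i q.1 ≤ c} := by
  ext q
  constructor
  · rintro ⟨h1, h2⟩
    exact ⟨h1, h2.le⟩
  · rintro ⟨h1, h2⟩
    exact ⟨h1, le_antisymm h2 ((hasGenericEps_iff.1 hZ).1 q h1)⟩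

theorem Comp.epsPart_nonempty {Z : Comp sgn W v} (hZ : Z.HasGenericEps i c) :
    (Z.epsPart i c).Nonempty :=
  let ⟨q, hq, h⟩ := (hasGenericEps_iff.1 hZ).2
  ⟨q, hq, h⟩

theorem Comp.closure_epsPart {Z : Comp sgn W v} (hZ : Z.HasGenericEps i c) :
    closure (Z.epsPart i c) = Z.1 := by
  have hsub : Z.epsPart i c ⊆ Z.1 := fun _ hq => hq.1
  apply (closure_minimal hsub (isClosed_comp Z)).antisymm
  have h := Z.epsPart_nonempty hZ
  rw [epsPart_eq_inter hZ] at h ⊢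
  exact subset_closure_inter_of_isPreirreducible_of_isOpen (isIrreducible_comp Z).2
    (isOpen_eps_le i c) h

theorem Comp.isIrreducible_epsPart {Z : Comp sgn W v} (hZ : Z.HasGenericEps i c) :
    IsIrreducible (Z.epsPart i c) := by
  rw [← isIrreducible_iff_closure, closure_epsPart hZ]
  exact isIrreducible_comp Z

theorem Comp.hasDim_epsPart_iff {Z : Comp sgn W v} (hZ : Z.HasGenericEps i c) {n : ℕ} :
    HasDim (lift (Z.epsPart i c)) n ↔ HasDim (lift Z.1) n :=
  hasDim_lift_iff_of_subset_closure (sep_subset _ _) (closure_epsPart hZ).ge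

/-- A component with non-empty locus `ε_i = 0` has generic value `0`. -/
theorem hasGenericEps_zero_iff {Z : Comp sgn W v} :
    Z.HasGenericEps i 0 ↔ ∃ q ∈ Z.1, QuiverVariety.eps i q.1 = 0 := by
  rw [hasGenericEps_iff]
  exact and_iff_right fun _ _ => Nat.zero_le _

section

variable [IsEmpty (i ⟶ i)]

theorem heckeImage_eq_upSet {S : Set (Lagrangian sgn W v')}
    (hS : ∀ q ∈ S, QuiverVariety.eps i q.1 = 0) :
    heckeImage (v' + Pi.single i c) S = upSet i c S := by
  ext q
  constructor
  · rintro ⟨q', hq', h⟩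
    have he : QuiverVariety.eps i q.1 = c := by
      have := h.eps_eq
      rw [hS q' hq'] at this
      omega
    refine ⟨⟨q, he⟩, ?_, rfl⟩
    have h1 : down ⟨q, he⟩ = q' := heckeRel_iff_down_eq.1 h
    rw [mem_preimage, h1]
    exact hq'
  · rintro ⟨q, hq, rfl⟩
    exact ⟨down q, hq, heckeRel_down q⟩

theorem matches_iff {Z' : Comp sgn W v'} {Z : Comp sgn W (v' + Pi.single i c)} :
    Z'.Matches i c Z ↔ upSet i c (Z'.epsPart i 0) = Z.epsPart i c := by
  rw [← heckeImage_eq_upSet fun q hq => hq.2]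
  rfl

theorem eps_of_mem_upSet {S : Set (Lagrangian sgn W v')}
    {q : Lagrangian sgn W (v' + Pi.single i c)} (hq : q ∈ upSet i c S) :
    QuiverVariety.eps i q.1 = c := by
  obtain ⟨q, -, rfl⟩ := hq
  exact q.2

theorem upSet_injective (hc : 2 * v' i + c ≤ Module.finrank ℂ (OutSp W v' i))
    {S T : Set (Lagrangian sgn W v')} (hS : ∀ q ∈ S, QuiverVariety.eps i q.1 = 0)
    (h : upSet i c S ⊆ upSet i c T) : S ⊆ T := by
  intro q' hq'
  obtain ⟨q, rfl⟩ := exists_down_eq hc (hS q' hq')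
  obtain ⟨r, hr, hrq⟩ := h ⟨q, hq', rfl⟩
  rw [← Subtype.ext hrq]
  exact hr

/-- Every component with generic value `c` of `ε_i` corresponds to a component with generic
value `0`. -/
theorem exists_matches_of_hasGenericEps {Z : Comp sgn W (v' + Pi.single i c)}
    (hZ : Z.HasGenericEps i c) :
    ∃ Z' : Comp sgn W v', Z'.HasGenericEps i 0 ∧ Z'.Matches i c Z := by
  have hY := Z.isIrreducible_epsPart hZ
  have hYs : Z.epsPart i c ⊆ stratum sgn W i c (v' + Pi.single i c) := fun q hq => hq.2
  let Y : Set (stratum sgn W i c (v' + Pi.single i c)) := Subtype.val ⁻¹' Z.epsPart i c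
  have hYirr : IsIrreducible Y :=
    ⟨let ⟨q, hq⟩ := hY.1; ⟨⟨q, hYs hq⟩, hq⟩, isPreirreducible_preimage_val hY.2 hYs⟩
  obtain ⟨Z', hZ', hsub⟩ := exists_mem_irreducibleComponents_subset_of_isIrreducible _
    (hYirr.image down continuous_down.continuousOn)
  obtain ⟨q, hq⟩ := hYirr.1
  have hgen : Comp.HasGenericEps (sgn := sgn) i ⟨Z', hZ'⟩ 0 :=
    hasGenericEps_zero_iff.2 ⟨down q, hsub ⟨q, hq, rfl⟩, eps_down q⟩
  refine ⟨⟨Z', hZ'⟩, hgen, matches_iff.2 ?_⟩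
  have h1 : Z.epsPart i c ⊆ upSet i c (Comp.epsPart (sgn := sgn) ⟨Z', hZ'⟩ i 0) := fun r hr =>
    ⟨⟨r, hr.2⟩, ⟨hsub ⟨⟨r, hr.2⟩, hr, rfl⟩, eps_down _⟩, rfl⟩
  have h2 := isIrreducible_upSet (c := c) (le_finrank_outSp q.1.1 q.2)
    (Comp.isIrreducible_epsPart hgen) fun q hq => hq.2
  have h3 := comp_eq_of_subset (Z := Z) h2.closure
    (by rw [← Z.closure_epsPart hZ]; exact closure_mono h1)
  refine Subset.antisymm (fun r hr => ⟨?_, eps_of_mem_upSet hr⟩) h1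
  rw [h3]
  exact subset_closure hr

end

variable (W) in
/-- Twice the dimension of the lift of the Lagrangian subvariety to the representation space. -/
def twiceDim (v : I → ℕ) : ℕ :=
  ∑ k, ∑ j, Fintype.card (k ⟶ j) * (v k * v j) + 2 * ∑ k, Module.finrank ℂ (W k) * v k

theorem card_hom_comm (k j : I) : Fintype.card (k ⟶ j) = Fintype.card (j ⟶ k) :=
  Fintype.card_congr
    ⟨Quiver.reverse, Quiver.reverse, Quiver.reverse_reverse, Quiver.reverse_reverse⟩

theorem twiceDim_add_single [IsEmpty (i ⟶ i)] : twiceDim W (v' + Pi.single i c) =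
    twiceDim W v' + 2 * (c * Module.finrank ℂ (OutSp W v' i)) := by
  have h1 : ∀ k j, Fintype.card (k ⟶ j) * ((v' + Pi.single i c : I → ℕ) k *
      (v' + Pi.single i c : I → ℕ) j) = Fintype.card (k ⟶ j) * (v' k * v' j) +
        (if k = i then c * (Fintype.card (i ⟶ j) * v' j) else 0) +
        (if j = i then c * (Fintype.card (i ⟶ k) * v' k) else 0) := by
    intro k j
    by_cases hk : k = i
    · subst hk
      by_cases hj : j = k
      · subst hj
        simp
      · simp [hj]
        ring
    · by_cases hj : j = i
      · subst hj
        simp [hk, card_hom_comm k]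
        ring
      · simp [hk, hj]
  have h2 : ∀ k, Module.finrank ℂ (W k) * (v' + Pi.single i c : I → ℕ) k =
      Module.finrank ℂ (W k) * v' k + if k = i then c * Module.finrank ℂ (W i) else 0 := by
    intro k
    by_cases hk : k = i
    · subst hk
      simp
      ring
    · simp [hk]
  have h3 : ∀ k, ∑ j, (if k = i then c * (Fintype.card (i ⟶ j) * v' j) else 0) =
      if k = i then ∑ j, c * (Fintype.card (i ⟶ j) * v' j) else 0 := fun k => by
    split_ifs <;> simp
  simp only [twiceDim, h1, h2, Finset.sum_add_distrib, h3, Finset.sum_ite_eq', Finset.mem_univ,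
    if_true, finrank_outSp, ← Finset.mul_sum]
  ring

variable [∀ i : I, IsEmpty (i ⟶ i)]

/-- Otherwise some point has `ε_i = 0` for all `i`, which nilpotency forbids. -/
theorem exists_hasGenericEps_pos (hv : v ≠ 0) (Z : Comp sgn W v) :
    ∃ i c, 0 < c ∧ Z.HasGenericEps i c := by
  classical
  by_contra! h
  have h0 : ∀ i, Z.HasGenericEps i 0 := fun i => by
    obtain ⟨c, hc, -⟩ := existsUnique_hasGenericEps i Z
    obtain rfl | hpos := c.eq_zero_or_pos
    · exact hc
    · exact absurd hc (h i c hpos)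
  obtain ⟨q, hqZ, hq⟩ := isIrreducible_iff_sInter.1 (isIrreducible_comp Z)
    (Finset.univ.image fun i => {q : Lagrangian sgn W v | QuiverVariety.eps i q.1 ≤ 0})
    (fun u hu => by
      obtain ⟨i, -, rfl⟩ := Finset.mem_image.1 hu
      exact isOpen_eps_le i 0)
    (fun u hu => by
      obtain ⟨i, -, rfl⟩ := Finset.mem_image.1 hu
      obtain ⟨q, hq, h⟩ := hasGenericEps_zero_iff.1 (h0 i)
      exact ⟨q, hq, h.le⟩)
  obtain ⟨x, rfl⟩ := toLag_surjective q
  refine hv (eq_zero_of_isNilpotent x.2.2.2 x.2.2.1 fun i => ?_)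
  exact Nat.le_zero.1 (mem_sInter.1 hq _ (Finset.mem_coe.2
    (Finset.mem_image_of_mem _ (Finset.mem_univ i))))

theorem le_of_hasGenericEps {Z : Comp sgn W v} (hZ : Z.HasGenericEps i c) : c ≤ v i := by
  obtain ⟨q, -, hq⟩ := (hasGenericEps_iff.1 hZ).2
  obtain ⟨x, rfl⟩ := toLag_surjective q
  have h1 : x.1.eps i = c := hq
  have h2 := eps_add_finrank_range_inMap x.1 i
  omega

theorem exists_eq_add_single (h : c ≤ v i) : ∃ v' : I → ℕ, v = v' + Pi.single i c := by
  refine ⟨fun j => v j - (Pi.single i c : I → ℕ) j, funext fun j => ?_⟩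
  by_cases hj : j = i
  · subst hj
    simp [h]
  · simp [hj]

/-- All components have the same dimension: half the dimension of the representation space. -/
theorem exists_hasDim_comp (v : I → ℕ) (Z : Comp sgn W v) :
    ∃ n, HasDim (lift Z.1) n ∧ 2 * n = twiceDim W v := by
  induction hN : ∑ k, v k using Nat.strong_induction_on generalizing v with
  | _ N ih =>
  subst hN
  by_cases hv : v = 0
  · subst hv
    refine ⟨0, hasDim_zero_of_subsingleton ?_ (zariskiIrreducible_lift (isIrreducible_comp Z)).1,
      by simp [twiceDim]⟩
    have hV : ∀ j, Subsingleton (VSp (0 : I → ℕ) j) := fun j =>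
      inferInstanceAs (Subsingleton (Fin 0 → ℂ))
    intro x _ y _
    exact RepSpace.ext (fun i j τ => LinearMap.ext fun u => Subsingleton.elim _ _)
      (fun i => LinearMap.ext fun u => by rw [Subsingleton.elim u 0, map_zero, map_zero])
      (fun i => LinearMap.ext fun w => Subsingleton.elim _ _)
  · obtain ⟨i, c, hc, hZ⟩ := exists_hasGenericEps_pos hv Z
    obtain ⟨v', rfl⟩ := exists_eq_add_single (le_of_hasGenericEps hZ)
    obtain ⟨Z', hZ', hm⟩ := exists_matches_of_hasGenericEps hZ
    have hlt : ∑ k, v' k < ∑ k, (v' + Pi.single i c : I → ℕ) k := by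
      simp only [Pi.add_apply, Finset.sum_add_distrib, Finset.sum_pi_single', Finset.mem_univ,
        if_true]
      simpa using hc
    obtain ⟨n, hn, h2n⟩ := ih _ hlt v' Z' rfl
    obtain ⟨q, -, hq⟩ := (hasGenericEps_iff.1 hZ).2
    have h1 := hasDim_lift_upSet (c := c) (le_finrank_outSp q.1 hq) (Z'.isIrreducible_epsPart hZ')
      (fun q hq => hq.2) ((Z'.hasDim_epsPart_iff hZ').2 hn)
    rw [matches_iff.1 hm, Z.hasDim_epsPart_iff hZ] at h1
    exact ⟨_, h1, by rw [twiceDim_add_single, mul_add, h2n]⟩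

/-- Every component with generic value `0` of `ε_i` corresponds to a component with generic
value `c`, if `c` is not too large: the closure of the preimage has the dimension of a component. -/
theorem exists_matches_of_hasGenericEps_zero
    (hc : 2 * v' i + c ≤ Module.finrank ℂ (OutSp W v' i)) {Z' : Comp sgn W v'}
    (hZ' : Z'.HasGenericEps i 0) :
    ∃ Z : Comp sgn W (v' + Pi.single i c), Z.HasGenericEps i c ∧ Z'.Matches i c Z := by
  have hirr := isIrreducible_upSet hc (Z'.isIrreducible_epsPart hZ') fun q hq => hq.2
  obtain ⟨Z, hZ, hsub⟩ := exists_mem_irreducibleComponents_subset_of_isIrreducible _ hirr.closure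
  obtain ⟨n, hn, h2n⟩ := exists_hasDim_comp v' Z'
  obtain ⟨m, hm, h2m⟩ := exists_hasDim_comp _ (⟨Z, hZ⟩ : Comp sgn W (v' + Pi.single i c))
  have hdim := hasDim_lift_upSet hc (Z'.isIrreducible_epsPart hZ') (fun q hq => hq.2)
    ((Z'.hasDim_epsPart_iff hZ').2 hn)
  rw [hasDim_lift_iff_of_subset_closure subset_closure subset_rfl] at hdim
  have heq : closure (upSet i c (Z'.epsPart i 0)) = Z := by
    by_contra hne
    have h1 := hasDim_lift_lt hirr.closure hZ.1 isClosed_closure (ssubset_of_subset_of_ne hsub hne)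
      hdim hm
    rw [twiceDim_add_single] at h2m
    omega
  have hgen : Comp.HasGenericEps (sgn := sgn) i ⟨Z, hZ⟩ c := by
    refine hasGenericEps_iff.2 ⟨fun q hq => ?_, ?_⟩
    · have h1 : closure (upSet i c (Z'.epsPart i 0)) ⊆
          {q : Lagrangian sgn W (v' + Pi.single i c) | c ≤ QuiverVariety.eps i q.1} :=
        closure_minimal (fun r hr => (eps_of_mem_upSet hr).ge) (isClosed_le_eps i c)
      rw [heq] at h1
      exact h1 hq
    · obtain ⟨q, hq⟩ := hirr.1
      exact ⟨q, hsub (subset_closure hq), eps_of_mem_upSet hq⟩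
  refine ⟨⟨Z, hZ⟩, hgen, matches_iff.2 (Subset.antisymm
    (fun q hq => ⟨hsub (subset_closure hq), eps_of_mem_upSet hq⟩) ?_)⟩
  rintro q ⟨hqZ, hq⟩
  refine ⟨⟨q, hq⟩, ⟨?_, eps_down _⟩, rfl⟩
  replace hqZ : q ∈ closure (upSet i c (Z'.epsPart i 0)) := heq.symm ▸ hqZ
  have h1 : (⟨q, hq⟩ : stratum sgn W i c (v' + Pi.single i c)) ∈
      closure (down ⁻¹' Z'.epsPart i 0) := closure_subtype.2 hqZ
  have h2 : down ⁻¹' Z'.epsPart i 0 ⊆ down (i := i) (c := c) ⁻¹' Z'.1 := fun r hr => hr.1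
  exact closure_minimal h2 ((isClosed_comp Z').preimage continuous_down) h1

theorem Comp.Matches.right_unique {Z' : Comp sgn W v'} {Z₁ Z₂ : Comp sgn W (v' + Pi.single i c)}
    (h₁ : Z'.Matches i c Z₁) (h₂ : Z'.Matches i c Z₂) (hZ₁ : Z₁.HasGenericEps i c)
    (hZ₂ : Z₂.HasGenericEps i c) : Z₁ = Z₂ := by
  rw [matches_iff] at h₁ h₂
  rw [Subtype.ext_iff, ← Z₁.closure_epsPart hZ₁, ← Z₂.closure_epsPart hZ₂, ← h₁, h₂]

theorem Comp.Matches.left_unique {Z₁ Z₂ : Comp sgn W v'} {Z : Comp sgn W (v' + Pi.single i c)}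
    (h₁ : Z₁.Matches i c Z) (h₂ : Z₂.Matches i c Z) (hZ₁ : Z₁.HasGenericEps i 0)
    (hZ₂ : Z₂.HasGenericEps i 0) (hZ : Z.HasGenericEps i c) : Z₁ = Z₂ := by
  obtain ⟨q, -, hq⟩ := (hasGenericEps_iff.1 hZ).2
  have hc := le_finrank_outSp q.1 hq
  rw [matches_iff] at h₁ h₂
  rw [Subtype.ext_iff, ← Z₁.closure_epsPart hZ₁, ← Z₂.closure_epsPart hZ₂,
    (upSet_injective hc (fun q hq => hq.2) (h₁.trans h₂.symm).subset).antisymm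
      (upSet_injective hc (fun q hq => hq.2) (h₂.trans h₁.symm).subset)]

/-- The bijection between components with generic values `0` and `c` of `ε_i`. -/
theorem exists_equiv_compEps (hc : 2 * v' i + c ≤ Module.finrank ℂ (OutSp W v' i)) :
    ∃ F : CompEps sgn W v' i 0 ≃ CompEps sgn W (v' + Pi.single i c) i c,
      ∀ Z' Z, F Z' = Z ↔ Comp.Matches i c Z'.1 Z.1 := by
  choose F hF hm using fun Z' : CompEps sgn W v' i 0 =>
    exists_matches_of_hasGenericEps_zero hc Z'.2
  choose G hG hm' using fun Z : CompEps sgn W (v' + Pi.single i c) i c =>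
    exists_matches_of_hasGenericEps Z.2
  refine ⟨⟨fun Z' => ⟨F Z', hF Z'⟩, fun Z => ⟨G Z, hG Z⟩, fun Z' => ?_, fun Z => ?_⟩,
    fun Z' Z => ?_⟩
  · exact Subtype.ext ((hm' ⟨F Z', hF Z'⟩).left_unique (hm Z') (hG _) Z'.2 (hF Z'))
  · exact Subtype.ext ((hm ⟨G Z, hG Z⟩).right_unique (hm' Z) (hF _) Z.2)
  · constructor
    · rintro rfl
      exact hm Z'
    · exact fun h => Subtype.ext ((hm Z').right_unique h (hF _) Z.2)

end Components

/-! ### The crystal structure -/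

/-- The partial function defined by a functional relation. -/
def partialFun {B : Type*} (r : B → B → Prop) (b : B) : Option B :=
  open Classical in if h : ∃ b', r b b' then some h.choose else none

theorem partialFun_eq_some_iff {B : Type*} {r : B → B → Prop}
    (hr : ∀ b b₁ b₂, r b b₁ → r b b₂ → b₁ = b₂) {b b' : B} :
    partialFun r b = some b' ↔ r b b' := by
  unfold partialFun
  split_ifs with h
  · rw [Option.some.injEq]
    constructor
    · rintro rfl
      exact h.choose_spec
    · exact hr _ _ _ h.choose_spec
  · exact ⟨nofun, fun h' => absurd ⟨b', h'⟩ h⟩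

theorem partialFun_eq_none_iff {B : Type*} {r : B → B → Prop} {b : B} :
    partialFun r b = none ↔ ¬ ∃ b', r b b' := by
  unfold partialFun
  split_ifs with h
  · simp [h]
  · simp [h]

section Strings

variable {I : Type*} [Fintype I] [DecidableEq I] [Quiver I] [Quiver.HasInvolutiveReverse I]
  [∀ i j : I, Fintype (i ⟶ j)] {sgn : (i j : I) → (i ⟶ j) → ℂˣ}
  {W : I → Type*} [∀ i, AddCommGroup (W i)] [∀ i, Module ℂ (W i)]
  [∀ i, FiniteDimensional ℂ (W i)] {i : I} {c : ℕ}

/-- The generic value of `ε_i` on a component. -/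
def genEps (i : I) (Z : AllComp sgn W) : ℕ := (existsUnique_hasGenericEps i Z.2).choose

theorem hasGenericEps_iff_genEps {Z : AllComp sgn W} :
    Z.2.HasGenericEps i c ↔ genEps i Z = c := by
  have h : Z.2.HasGenericEps i (genEps i Z) := (existsUnique_hasGenericEps i Z.2).choose_spec.1
  exact ⟨fun h' => hasGenericEps_unique h h', fun h' => h' ▸ h⟩

variable [∀ i : I, IsEmpty (i ⟶ i)] {Z Z' Z₁ Z₂ : AllComp sgn W}

theorem IsStringPair.right_unique (h₁ : IsStringPair i c Z' Z₁) (h₂ : IsStringPair i c Z' Z₂) :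
    Z₁ = Z₂ := by
  obtain ⟨v₁, Z₁⟩ := Z₁
  obtain ⟨v₂, Z₂⟩ := Z₂
  obtain ⟨rfl, -, hZ₁, hm₁⟩ := h₁
  obtain ⟨rfl, -, hZ₂, hm₂⟩ := h₂
  exact congrArg (Sigma.mk _) (hm₁.right_unique hm₂ hZ₁ hZ₂)

theorem IsStringPair.left_unique (h₁ : IsStringPair i c Z₁ Z) (h₂ : IsStringPair i c Z₂ Z) :
    Z₁ = Z₂ := by
  obtain ⟨v₁, Z₁⟩ := Z₁
  obtain ⟨v₂, Z₂⟩ := Z₂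
  obtain ⟨v, Z⟩ := Z
  obtain ⟨rfl, hZ₁, hZ, hm₁⟩ := h₁
  obtain ⟨hv, hZ₂, -, hm₂⟩ := h₂
  obtain rfl : v₁ = v₂ := add_right_cancel hv
  exact congrArg (Sigma.mk _) (hm₁.left_unique hm₂ hZ₁ hZ₂ hZ)

theorem IsStringPair.le (h : IsStringPair i c Z' Z) :
    2 * Z'.1 i + c ≤ Module.finrank ℂ (OutSp W Z'.1 i) := by
  obtain ⟨v, Z⟩ := Z
  obtain ⟨rfl, -, hZ, -⟩ := h
  obtain ⟨q, -, hq⟩ := (hasGenericEps_iff.1 hZ).2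
  exact le_finrank_outSp q.1 hq

theorem exists_isStringPair_left (h : Z.2.HasGenericEps i c) : ∃ Z', IsStringPair i c Z' Z := by
  obtain ⟨v, Z⟩ := Z
  obtain ⟨v', rfl⟩ := exists_eq_add_single (le_of_hasGenericEps h)
  obtain ⟨Z', hZ', hm⟩ := exists_matches_of_hasGenericEps h
  exact ⟨⟨v', Z'⟩, rfl, hZ', h, hm⟩

theorem exists_isStringPair_right (h : Z'.2.HasGenericEps i 0)
    (hc : 2 * Z'.1 i + c ≤ Module.finrank ℂ (OutSp W Z'.1 i)) : ∃ Z, IsStringPair i c Z' Z := by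
  obtain ⟨Z, hZ, hm⟩ := exists_matches_of_hasGenericEps_zero hc h
  exact ⟨⟨_, Z⟩, rfl, h, hZ, hm⟩

/-- The relation `Z₁ = ẽ_i Z`, equivalently `Z = f̃_i Z₁`: both components are in the same
`i`-string, at consecutive positions. -/
def LowerRel (i : I) (Z Z₁ : AllComp sgn W) : Prop :=
  ∃ (c : ℕ) (Z' : AllComp sgn W), IsStringPair i (c + 1) Z' Z ∧ IsStringPair i c Z' Z₁

theorem LowerRel.right_unique (h₁ : LowerRel i Z Z₁) (h₂ : LowerRel i Z Z₂) : Z₁ = Z₂ := by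
  obtain ⟨c, Z', h, h'⟩ := h₁
  obtain ⟨d, Z'', k, k'⟩ := h₂
  obtain rfl : c = d := Nat.succ_injective (hasGenericEps_unique h.2.2.1 k.2.2.1)
  obtain rfl := h.left_unique k
  exact h'.right_unique k'

theorem LowerRel.left_unique (h₁ : LowerRel i Z₁ Z) (h₂ : LowerRel i Z₂ Z) : Z₁ = Z₂ := by
  obtain ⟨c, Z', h, h'⟩ := h₁
  obtain ⟨d, Z'', k, k'⟩ := h₂
  obtain rfl : c = d := hasGenericEps_unique h'.2.2.1 k'.2.2.1
  obtain rfl := h'.left_unique k'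
  exact h.right_unique k

theorem LowerRel.genEps_eq (h : LowerRel i Z Z₁) : genEps i Z = genEps i Z₁ + 1 := by
  obtain ⟨c, Z', h, h'⟩ := h
  rw [hasGenericEps_iff_genEps.1 h.2.2.1, hasGenericEps_iff_genEps.1 h'.2.2.1]

theorem LowerRel.dim_eq (h : LowerRel i Z Z₁) : Z.1 = Z₁.1 + Pi.single i 1 := by
  obtain ⟨c, Z', h, h'⟩ := h
  rw [h.1, h'.1, add_assoc, ← Pi.single_add]

theorem exists_lowerRel_left_iff : (∃ Z₁, LowerRel i Z Z₁) ↔ genEps i Z ≠ 0 := by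
  constructor
  · rintro ⟨Z₁, h⟩
    rw [h.genEps_eq]
    exact Nat.succ_ne_zero _
  · intro h
    obtain ⟨c, hc⟩ := Nat.exists_eq_succ_of_ne_zero h
    obtain ⟨Z', hZ'⟩ := exists_isStringPair_left (hasGenericEps_iff_genEps.2 hc)
    obtain ⟨Z₁, hZ₁⟩ := exists_isStringPair_right (c := c) hZ'.2.1 (by have := hZ'.le; omega)
    exact ⟨Z₁, c, Z', hZ', hZ₁⟩

/-- The operator `f̃_i` is defined at `Z` if and only if `φ_i > 0`. -/
theorem exists_lowerRel_right_iff : (∃ Z₁, LowerRel i Z₁ Z) ↔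
    0 < (genEps i Z : ℤ) + (Module.finrank ℂ (OutSp W Z.1 i) - 2 * Z.1 i) := by
  obtain ⟨Z', hZ'⟩ := exists_isStringPair_left (hasGenericEps_iff_genEps.2 (rfl : genEps i Z = _))
  have h1 : Module.finrank ℂ (OutSp W Z.1 i) = Module.finrank ℂ (OutSp W Z'.1 i) := by
    rw [hZ'.1, finrank_outSp_add_single]
  have h2 : Z.1 i = Z'.1 i + genEps i Z := by rw [hZ'.1]; simp
  rw [h1]
  constructor
  · rintro ⟨Z₁, c, Z'', h, h'⟩
    obtain rfl : genEps i Z = c := hasGenericEps_iff_genEps.1 h'.2.2.1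
    obtain rfl := hZ'.left_unique h'
    have := h.le
    omega
  · intro h
    obtain ⟨Z₁, hZ₁⟩ := exists_isStringPair_right (c := genEps i Z + 1) hZ'.2.1 (by omega)
    exact ⟨Z₁, _, Z', hZ₁, hZ'⟩

/-- The operator `ẽ_i` on components. -/
def opE (i : I) (Z : AllComp sgn W) : Option (AllComp sgn W) := partialFun (LowerRel i) Z

/-- The operator `f̃_i` on components. -/
def opF (i : I) (Z : AllComp sgn W) : Option (AllComp sgn W) :=
  partialFun (fun Z Z₁ => LowerRel i Z₁ Z) Z

theorem opE_eq_some_iff : opE i Z = some Z₁ ↔ LowerRel i Z Z₁ :=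
  partialFun_eq_some_iff (r := LowerRel i) fun _ _ _ => LowerRel.right_unique

theorem opF_eq_some_iff : opF i Z = some Z₁ ↔ LowerRel i Z₁ Z :=
  partialFun_eq_some_iff (r := fun Z Z₁ => LowerRel i Z₁ Z) fun _ _ _ => LowerRel.left_unique

theorem opF_eq_some_iff_exists : opF i Z = some Z₁ ↔ ∃ (c : ℕ) (Z' : AllComp sgn W),
    IsStringPair i c Z' Z ∧ IsStringPair i (c + 1) Z' Z₁ :=
  opF_eq_some_iff.trans (exists_congr fun _ => exists_congr fun _ => and_comm)

theorem opE_eq_none_iff : opE i Z = none ↔ genEps i Z = 0 := by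
  rw [opE, partialFun_eq_none_iff, exists_lowerRel_left_iff, not_not]

theorem opF_eq_none_iff : opF i Z = none ↔
    (genEps i Z : ℤ) + (Module.finrank ℂ (OutSp W Z.1 i) - 2 * Z.1 i) ≤ 0 := by
  rw [opF, partialFun_eq_none_iff, exists_lowerRel_right_iff, not_lt]

section Weights

variable {A : Matrix I I ℤ} {P : Type*} [AddCommGroup P] (R : WeightData A P)

theorem weight_add_single_one (v : I → ℕ) :
    weight R W (v + Pi.single i 1) + R.α i = weight R W v := by
  have h : ∑ j, (v + Pi.single i 1 : I → ℕ) j • R.α j = ∑ j, v j • R.α j + R.α i := by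
    simp [add_smul, Finset.sum_add_distrib, Pi.single_apply, ite_smul]
  rw [weight, weight, h]
  abel

theorem pairing_weight (hA : IsSymmetricGCM A) (hQ : IsQuiverOf A) (v : I → ℕ) :
    R.h i (weight R W v) = Module.finrank ℂ (OutSp W v i) - 2 * v i := by
  have h1 : ∀ j, A i j = (if i = j then 2 else 0) - Fintype.card (i ⟶ j) := by
    intro j
    rw [hQ i j]
    split_ifs with hij
    · subst hij
      simp [hA.diag]
    · have := hA.nonpos i j hij
      omega
  rw [finrank_outSp]
  simp [weight, R.h_α, R.h_Λ, h1, mul_sub, Finset.sum_sub_distrib, mul_comm]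
  ring

/-- The crystal of irreducible components. -/
def compCrystal (hA : IsSymmetricGCM A) : Crystal R (AllComp sgn W) where
  wt Z := weight R W Z.1
  ε i Z := ((genEps i Z : ℤ) : WithBot ℤ)
  φ i Z := ((genEps i Z : ℤ) : WithBot ℤ) + ((R.h i (weight R W Z.1) : ℤ) : WithBot ℤ)
  e := opE
  f := opF
  φ_eq _ _ := rfl
  wt_e i Z Z₁ h := by
    rw [opE_eq_some_iff] at h
    rw [h.dim_eq, weight_add_single_one]
  ε_e i Z Z₁ h := by
    rw [opE_eq_some_iff] at h
    rw [h.genEps_eq, ← WithBot.coe_add]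
    congr 1
    push_cast
    ring
  φ_e i Z Z₁ h := by
    rw [opE_eq_some_iff] at h
    have h1 := congrArg (R.h i) (weight_add_single_one R (W := W) (i := i) Z₁.1)
    rw [map_add, R.h_α, hA.diag] at h1
    rw [h.dim_eq, h.genEps_eq, ← h1]
    simp only [← WithBot.coe_add]
    congr 1
    push_cast
    ring
  wt_f i Z Z₁ h := by
    rw [opF_eq_some_iff] at h
    rw [h.dim_eq, ← weight_add_single_one (i := i) R Z.1, add_sub_cancel_right]
  ε_f i Z Z₁ h := by
    rw [opF_eq_some_iff] at h
    rw [h.genEps_eq, ← WithBot.coe_add]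
    rfl
  φ_f i Z Z₁ h := by
    rw [opF_eq_some_iff] at h
    have h1 := congrArg (R.h i) (weight_add_single_one R (W := W) (i := i) Z.1)
    rw [map_add, R.h_α, hA.diag] at h1
    rw [h.dim_eq, h.genEps_eq, ← h1]
    simp only [← WithBot.coe_add]
    congr 1
    push_cast
    ring
  e_iff_f i Z Z₁ := by
    rw [opE_eq_some_iff, opF_eq_some_iff]
  e_eq_none i Z h := absurd h (by rw [← WithBot.coe_add]; exact WithBot.coe_ne_bot)
  f_eq_none i Z h := absurd h (by rw [← WithBot.coe_add]; exact WithBot.coe_ne_bot)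

end Weights

end Strings

end QuiverCrystal

end

open QuiverCrystal in
theorem theorem4p4p2
    {I : Type*} [Fintype I] [DecidableEq I]
    (A : Matrix I I ℤ) (hA : IsSymmetricGCM A)
    {P : Type*} [AddCommGroup P] [Module.Free ℤ P] [Module.Finite ℤ P] (R : WeightData A P)
    [Quiver I] [Quiver.HasInvolutiveReverse I] [∀ i j : I, Fintype (i ⟶ j)]
    (hQ : IsQuiverOf A)
    (sgn : (i j : I) → (i ⟶ j) → ℂˣ)
    (hsgn : ∀ (i j : I) (τ : i ⟶ j), (sgn i j τ : ℂ) + (sgn j i (Quiver.reverse τ) : ℂ) = 0)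
    (W : I → Type*) [∀ i, AddCommGroup (W i)] [∀ i, Module ℂ (W i)]
    [∀ i, FiniteDimensional ℂ (W i)] :
    -- the generic value of `ε_i` on each irreducible component is well defined
    (∀ (i : I) (v : I → ℕ) (Z : Comp sgn W v), ∃! c : ℕ, Z.HasGenericEps i c) ∧
    -- the component bijections, whenever the stratum `𝔛(ν)_{i,c}` is non-empty
    (∀ (i : I) (c : ℕ) (v : I → ℕ),
      (∃ q : QuiverVariety sgn W (v + Pi.single i c), QuiverVariety.eps i q = c) →
      ∃ F : CompEps sgn W v i 0 ≃ CompEps sgn W (v + Pi.single i c) i c,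
        ∀ Z' Z, F Z' = Z ↔ Comp.Matches i c Z'.1 Z.1) ∧
    -- the crystal structure
    ∃! C : Crystal R (AllComp sgn W),
      (∀ Z, C.wt Z = weight R W Z.1) ∧
      (∀ (i : I) (Z : AllComp sgn W) (c : ℕ), C.ε i Z = ((c : ℤ) : WithBot ℤ) ↔
        Z.2.HasGenericEps i c) ∧
      (∀ (i : I) (Z : AllComp sgn W),
        C.φ i Z = C.ε i Z + ((R.h i (C.wt Z) : ℤ) : WithBot ℤ)) ∧
      -- `ẽ_i = f̃_i^{c-1} ∘ ẽ_i^c` on components with `ε_i = c ≥ 1`, and `0` if `ε_i = 0`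
      (∀ (i : I) (Z Z₁ : AllComp sgn W), C.e i Z = some Z₁ ↔
        ∃ (c : ℕ) (Z' : AllComp sgn W), IsStringPair i (c + 1) Z' Z ∧ IsStringPair i c Z' Z₁) ∧
      (∀ (i : I) (Z : AllComp sgn W), C.e i Z = none ↔ C.ε i Z = 0) ∧
      -- `f̃_i = f̃_i^{c+1} ∘ ẽ_i^c` on components with `ε_i = c` and `φ_i > 0`, and `0` otherwise
      (∀ (i : I) (Z Z₁ : AllComp sgn W), C.f i Z = some Z₁ ↔
        ∃ (c : ℕ) (Z' : AllComp sgn W), IsStringPair i c Z' Z ∧ IsStringPair i (c + 1) Z' Z₁) ∧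
      (∀ (i : I) (Z : AllComp sgn W), C.f i Z = none ↔ C.φ i Z ≤ 0) := by
  have : ∀ i : I, IsEmpty (i ⟶ i) := fun i =>
    Fintype.card_eq_zero_iff.1 ((hQ i i).trans (if_pos rfl))
  refine ⟨fun i v Z => existsUnique_hasGenericEps i Z, fun i c v ⟨q, hq⟩ =>
    exists_equiv_compEps (le_finrank_outSp q hq), compCrystal R hA, ⟨fun Z => rfl, fun i Z c => ?_,
      fun i Z => rfl, fun i Z Z₁ => ?_, fun i Z => ?_, fun i Z Z₁ => ?_, fun i Z => ?_⟩, ?_⟩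
  · rw [hasGenericEps_iff_genEps]
    change ((genEps i Z : ℤ) : WithBot ℤ) = _ ↔ _
    rw [WithBot.coe_inj, Nat.cast_inj]
  · exact opE_eq_some_iff
  · change opE i Z = none ↔ ((genEps i Z : ℤ) : WithBot ℤ) = ((0 : ℤ) : WithBot ℤ)
    rw [opE_eq_none_iff, WithBot.coe_inj]
    exact Nat.cast_eq_zero.symm
  · exact opF_eq_some_iff_exists
  · change opF i Z = none ↔ ((genEps i Z : ℤ) : WithBot ℤ) +
      ((R.h i (weight R W Z.1) : ℤ) : WithBot ℤ) ≤ ((0 : ℤ) : WithBot ℤ)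
    rw [opF_eq_none_iff, pairing_weight R hA hQ, ← WithBot.coe_add, WithBot.coe_le_coe]
  · rintro C ⟨hwt, hε, hφ, he, -, hf, -⟩
    have hwt' : C.wt = (compCrystal (sgn := sgn) (W := W) R hA).wt := funext hwt
    have hε' : C.ε = (compCrystal (sgn := sgn) (W := W) R hA).ε := funext fun i => funext fun Z =>
      (hε i Z _).2 (hasGenericEps_iff_genEps.2 rfl)
    refine Crystal.ext hwt' hε' (funext fun i => funext fun Z => ?_)
      (funext fun i => funext fun Z => Option.ext fun Z₁ => ?_)
      (funext fun i => funext fun Z => Option.ext fun Z₁ => ?_)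
    · rw [hφ, hε', hwt']
      rfl
    · rw [he]
      exact opE_eq_some_iff.symm
    · rw [hf]
      exact opF_eq_some_iff_exists.symm
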